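/- **Setting.** Let $\beta>0$, $\kappa>0$ and let $\gamma\ge 1$ be an integer. Let $\Sigma\subseteq\mathbb R$ be a closed (bounded or unbounded) interval with more than one point, with $\Sigma\subseteq[0,\infty)$ if $\gamma$ is even. Let $p(n)$ be nonnegative integers with $p(n)/n\to\kappa$. Let $w_n:\Sigma\to[0,\infty)$ $(n\in\mathbb N)$ and $w:\Sigma\to[0,\infty)$ be continuous; write $\mathcal N(f)$ for the zero set of $f$ and $\log 0=-\infty$. Assume: (a1) $\mathcal N(w)$ is finite and $\mathcal N(w_n)\subseteq\mathcal N(w)$ for all large $n$; $w_n\to w$ uniformly on compact subsets of $\Sigma$; and, on every compact subset of $\Sigma\setminus\mathcal N(w)$, $\log w_n\to\log w$ uniformly and $\log w$ is Lipschitz. (a2) If $\Sigma$ is unbounded, there are $n_0\in\mathbb N$ and $\epsilon>0$ such that $|x|^{\gamma\kappa\max(\beta,1)+\epsilon}\,\sup_{n\ge n_0}w_n(x)\to0$ as $|x|\to\infty$, $x\in\Sigma$. Let $$Z_n=\int_{\Sigma^{p(n)}}\prod_{1\le i<j\le p(n)}|x_i^\gamma-x_j^\gamma|^\beta\prod_{j=1}^{p(n)}w_n(x_j)^n\,dx\in[0,\infty],$$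 and let $Q_n$ be the measure on $\Sigma^{p(n)}$ with Lebesgue density $Z_n^{-1}\prod_{i<j}|x_i^\gamma-x_j^\gamma|^\beta\prod_jw_n(x_j)^n$. Let $\mathcal M_1(\Sigma)$ be the space of Borel probability measures on $\Sigma$ with the weak topology, and $L_n(x)=\frac1{p(n)}\sum_{j=1}^{p(n)}\delta_{x_j}\in\mathcal M_1(\Sigma)$ for $x\in\Sigma^{p(n)}$, $p(n)\geq 1$. For $\mu\in\mathcal M_1(\Sigma)$ put $$H(\mu)=\iint F\,d\mu\,d\mu,\qquad F(x,y)=\frac\beta2\kappa^2\log|x^\gamma-y^\gamma|^{-1}-\frac\kappa2\bigl(\log w(x)+\log w(y)\bigr)\in(-\infty,\infty].$$ **Theorem.** For all large $n$ one has $0<Z_n<\infty$ and $Q_n$ is a probability measure. For every $\mu\in\mathcal M_1(\Sigma)$ the negative part of $F$ is $\mu\otimes\mu$-integrable, so that $H(\mu)\in(-\infty,\infty]$ is well defined; moreover $$H(\mu)=\frac\beta2\kappa^2\iint\log|x^\gamma-y^\gamma|^{-1}\,\mu(dx)\,\mu(dy)-\kappa\int\log w\,d\mu\quad\text{if }\int\log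 w\,d\mu>-\infty,$$ and $H(\mu)=\infty$ if $\int\log w\,d\mu=-\infty$. The limit $$c=\lim_{n\to\infty}\frac1{n^2}\log Z_n$$ exists and is finite, and the laws $Q_n\circ L_n^{-1}$ satisfy a large deviation principle on $\mathcal M_1(\Sigma)$ with speed $n^2$ and good rate function $I(\mu)=H(\mu)+c$. That is, $I$ takes values in $[0,\infty]$, is lower semicontinuous and has compact level sets $\{I\le L\}$ for all $L\in[0,\infty)$, and $$\liminf_{n\to\infty}\frac1{n^2}\log Q_n(L_n\in G)\ge-\inf_{G}I,\qquad\limsup_{n\to\infty}\frac1{n^2}\log Q_n(L_n\in A)\le-\inf_{A}I$$ for all open $G$ and all closed $A$ in $\mathcal M_1(\Sigma)$. -/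

import Mathlib

open MeasureTheory Filter Topology Set
open scoped ENNReal NNReal

noncomputable section

/-! ### Large deviation principles -/

/-- A good rate function: `[0, ∞]`-valued, lower semicontinuous, with compact level sets. -/
structure IsGoodRateFunction {X : Type*} [TopologicalSpace X] (I : X → EReal) : Prop where
  nonneg : ∀ x, 0 ≤ I x
  lowerSemicontinuous : LowerSemicontinuous I
  isCompact_level : ∀ L : ℝ, 0 ≤ L → IsCompact {x | I x ≤ (L : EReal)}

/-- The sequence `ν` of Borel measures on `X` satisfies a large deviation principle with speed `s`
and good rate function `I`. Logarithms and inequalities are in `[-∞, ∞]`, with `log 0 = -∞` and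
`inf ∅ = ∞`. -/
structure SatisfiesLDP {X : Type*} [TopologicalSpace X] (ν : ℕ → @Measure X (borel X))
    (s : ℕ → ℝ) (I : X → EReal) : Prop where
  goodRate : IsGoodRateFunction I
  lower : ∀ G : Set X, IsOpen G →
    -(⨅ x ∈ G, I x) ≤ liminf (fun n => (((s n)⁻¹ : ℝ) : EReal) * ENNReal.log (ν n G)) atTop
  upper : ∀ A : Set X, IsClosed A →
    limsup (fun n => (((s n)⁻¹ : ℝ) : EReal) * ENNReal.log (ν n A)) atTop ≤ -(⨅ x ∈ A, I x)

/-! ### Empirical measures -/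

/-- The empirical measure `k⁻¹ ∑ⱼ δ_{xⱼ}` as a measure (the zero measure for `k = 0`). -/
def empiricalAux {X : Type*} [MeasurableSpace X] {k : ℕ} (x : Fin k → X) : Measure X :=
  (k : ℝ≥0∞)⁻¹ • ∑ j, Measure.dirac (x j)

theorem isProbabilityMeasure_empiricalAux {X : Type*} [MeasurableSpace X] {k : ℕ} (hk : k ≠ 0)
    (x : Fin k → X) : IsProbabilityMeasure (empiricalAux x) := by
  constructor
  have h : (k : ℝ≥0∞) ≠ 0 := by exact_mod_cast hk
  simp [empiricalAux, ENNReal.inv_mul_cancel h (ENNReal.natCast_ne_top k)]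

/-- The empirical measure `L(x) = k⁻¹ ∑ⱼ δ_{xⱼ}` of `k ≥ 1` points, as a probability measure.
For `k = 0` (which occurs for finitely many indices at most) it is an arbitrary point mass. -/
def empiricalMeasure {X : Type*} [MeasurableSpace X] [Nonempty X] {k : ℕ} (x : Fin k → X) :
    ProbabilityMeasure X :=
  if hk : k = 0 then ⟨Measure.dirac (Classical.arbitrary X), inferInstance⟩
  else ⟨empiricalAux x, isProbabilityMeasure_empiricalAux hk x⟩

/-! ### The particle ensemble on a set `S` of reals -/

/-- Unnormalized density `∏_{i<j} |xᵢ^γ - xⱼ^γ|^β ∏ⱼ w(xⱼ)^n` of `k` points in `S`. -/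
def ensembleDensity {S : Set ℝ} (β : ℝ) (γ n k : ℕ) (w : S → ℝ) (x : Fin k → S) : ℝ :=
  (∏ i : Fin k, ∏ j ∈ Finset.Ioi i, |(x i : ℝ) ^ γ - (x j : ℝ) ^ γ| ^ β) * ∏ j, w (x j) ^ n

/-- The measure on `S^k` with density `ensembleDensity` with respect to Lebesgue measure. -/
def unnormalizedEnsemble {S : Set ℝ} (β : ℝ) (γ n k : ℕ) (w : S → ℝ) : Measure (Fin k → S) :=
  (Measure.pi fun _ : Fin k => Measure.comap ((↑) : S → ℝ) volume).withDensity
    fun x => ENNReal.ofReal (ensembleDensity β γ n k w x)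

/-- The normalizing constant, an element of `[0, ∞]`. -/
def partitionFunction {S : Set ℝ} (β : ℝ) (γ n k : ℕ) (w : S → ℝ) : ℝ≥0∞ :=
  unnormalizedEnsemble β γ n k w univ

/-- The normalized joint law of the `k` points. -/
def ensemble {S : Set ℝ} (β : ℝ) (γ n k : ℕ) (w : S → ℝ) : Measure (Fin k → S) :=
  (partitionFunction β γ n k w)⁻¹ • unnormalizedEnsemble β γ n k w

/-- The law of the empirical measure of the ensemble: a Borel measure on the space of probability
measures on `S` with its weak topology. -/
def empiricalLaw {S : Set ℝ} [Nonempty S] (β : ℝ) (γ n k : ℕ) (w : S → ℝ) :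
    @Measure (ProbabilityMeasure S) (borel (ProbabilityMeasure S)) :=
  @Measure.map (Fin k → S) (ProbabilityMeasure S) inferInstance (borel (ProbabilityMeasure S))
    empiricalMeasure (ensemble β γ n k w)

/-! ### Assumptions on the weights -/

/-- `v n` converges to the limit weight `w`. Compact sets are compact subsets of `S`. -/
structure WeightConvergence {S : Set ℝ} (v : ℕ → S → ℝ) (w : S → ℝ) : Prop where
  continuous : Continuous w
  nonneg : ∀ x, 0 ≤ w x
  finite_zeros : {x | w x = 0}.Finite
  zeros_subset : ∀ᶠ n in atTop, {x | v n x = 0} ⊆ {x | w x = 0}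
  tendsto : ∀ K : Set S, IsCompact K → TendstoUniformlyOn v w atTop K
  tendsto_log : ∀ K : Set S, IsCompact K → Disjoint K {x | w x = 0} →
    TendstoUniformlyOn (fun n x => Real.log (v n x)) (fun x => Real.log (w x)) atTop K
  lipschitz_log : ∀ K : Set S, IsCompact K → Disjoint K {x | w x = 0} →
    ∃ C : ℝ≥0, LipschitzOnWith C (fun x => Real.log (w x)) K

/-- If `S` is unbounded, then `|x|^(γκ max(β,1) + ε) sup_{n ≥ n₀} v n x → 0` as `x → ±∞` in `S`,
for some `n₀` and some `ε > 0`. -/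
def WeightDecay {S : Set ℝ} (β κ : ℝ) (γ : ℕ) (v : ℕ → S → ℝ) : Prop :=
  ¬ Bornology.IsBounded S → ∃ n₀ : ℕ, ∃ ε : ℝ, 0 < ε ∧
    Tendsto (fun x : S => ENNReal.ofReal (|(x : ℝ)| ^ ((γ : ℝ) * κ * max β 1 + ε)) *
        ⨆ n ≥ n₀, ENNReal.ofReal (v n x))
      (comap ((↑) : S → ℝ) (Bornology.cobounded ℝ)) (𝓝 0)

/-! ### The energy functional -/

/-- Logarithm of a nonnegative real number, with `log 0 = -∞`. -/
def logE (t : ℝ) : EReal := ENNReal.log (ENNReal.ofReal t)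

/-- Integral of an extended-real function, as integral of the positive part minus integral of the
negative part; it is meaningful when one of the two is finite. -/
def eintegral {α : Type*} [MeasurableSpace α] (μ : Measure α) (f : α → EReal) : EReal :=
  ((∫⁻ a, (f a).toENNReal ∂μ : ℝ≥0∞) : EReal) - ((∫⁻ a, (-f a).toENNReal ∂μ : ℝ≥0∞) : EReal)

/-- `F(x,y) = (β/2) κ² log |x^γ - y^γ|⁻¹ - (κ/2) (log w(x) + log w(y))`, which is `∞` if
`x^γ = y^γ`, `w(x) = 0` or `w(y) = 0`. -/
def pairEnergy {S : Set ℝ} (β κ : ℝ) (γ : ℕ) (w : S → ℝ) (x y : S) : EReal :=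
  ((β / 2 * κ ^ 2 : ℝ) : EReal) * (-logE |(x : ℝ) ^ γ - (y : ℝ) ^ γ|)
    - ((κ / 2 : ℝ) : EReal) * (logE (w x) + logE (w y))

/-- `(β/2) κ² ∬ log |x^γ - y^γ|⁻¹ dμ dμ - κ ∫ log w dμ`, read as the single integral `∬ F dμ dμ`. -/
def energy {S : Set ℝ} (β κ : ℝ) (γ : ℕ) (w : S → ℝ) (μ : ProbabilityMeasure S) : EReal :=
  eintegral ((μ : Measure S).prod (μ : Measure S)) fun z => pairEnergy β κ γ w z.1 z.2

end

/-! ### Energies of kernels vanishing at infinity -/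

/-! Put `G(x,y) = |x^γ - y^γ|^β (w(x) w(y))^(1/κ)`. Each of the `k = p(n)` points lies in `k - 1`
pairs and `n/(k-1) → 1/κ`, so heuristically the density is the product of `G(xᵢ,xⱼ)` over `i < j`,
which is `exp(-(k²/2) ∬ -log G dL dL)` with the diagonal left out. As `k² ~ κ²n²` and `F = -(κ²/2)
log G`, the exponent is `-n² H(L)`. The decay assumption makes `G` bounded and vanishing at
infinity. Hence `C - log G ≥ 0` for a suitable `C`, and `H` is an increasing affine function of the
energy of this nonnegative interaction (`pairEnergy_eq`, `energy_eq`).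

Upper bound. Replacing `G` by `G + η` gives an interaction that is bounded and continuous, so its
energy is weakly continuous, and the missing diagonal contributes only `k log η`. A fixed power `m`
of each weight is set aside to make the one-point integrals finite; the other `n - m` powers are
spread over the pairs, and uniform convergence with decay bounds the pair factors by `G + η`
(`eventually_ensembleDensity_le`). It remains to let `η → 0` on a closed set. Since `G` vanishes at
infinity, a bound on the regularized energy forces tightness, so Prokhorov's theorem shows that the
infima of the regularized energies exceed every level lying below the energy on the whole set
(`exists_regularizedEnergy_ge`). The same tightness gives compact level sets, and no separate
exponential tightness estimate is needed.

Lower bound. Let `ν` have a density bounded by `M` and compact support off the zeros of `w`. The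
product law `ν^k` is at most `M^k` times Lebesgue measure, a loss of order `e^{O(n)}`. A Jensen type
inequality and the law of large numbers bound the mass near `ν` from below by the exponential of the
mean log-density (`eventually_ofReal_exp_le_unnormalizedEnsemble`). Such `ν` are dense in energy
(`exists_isTame_mem`): a measure of finite energy has no atoms, so it can be conditioned on compact
sets avoiding the endpoints, the zeros of `w` and the origin, and then convolved with a short
uniform law. There `G` is `|x - y|^β` times a positive continuous factor, and averaging a
logarithmic singularity costs little.

The bounds on the whole space identify `c = -inf H`, and dividing by the total mass gives the
principle (`HasEnergyBounds.satisfiesLDP`). -/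

/-- A continuous symmetric kernel `G ≥ 0`, bounded by `exp C - 1`, that vanishes on the diagonal and
at infinity. The associated pair energy is `-log G`. -/
structure VanishingKernel {X : Type*} [TopologicalSpace X] (G : X × X → ℝ) (C : ℝ) : Prop where
  continuous : Continuous G
  nonneg : ∀ z, 0 ≤ G z
  add_one_le : ∀ z, G z + 1 ≤ Real.exp C
  symm : ∀ x y, G (x, y) = G (y, x)
  diag : ∀ x, G (x, x) = 0
  vanish : ∀ s : ℝ, 0 < s → ∃ K : Set X, IsCompact K ∧ ∀ x ∉ K, ∀ y, G (x, y) ≤ s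

/-- The energy of `μ` for the bounded pair interaction `-log (G + η)`. -/
noncomputable def regularizedEnergy {X : Type*} [MeasurableSpace X] (G : X × X → ℝ) (η : ℝ)
    (μ : ProbabilityMeasure X) : ℝ :=
  ∫ z, -Real.log (G z + η) ∂((μ : Measure X).prod (μ : Measure X))

/-- The nonnegative pair interaction `C - log G`, with value `∞` where `G` vanishes. -/
noncomputable def gapLog {X : Type*} (G : X × X → ℝ) (C : ℝ) (z : X × X) : ℝ≥0∞ :=
  ⨆ m : ℕ, ENNReal.ofReal (C - Real.log (G z + 1 / ((m : ℝ) + 1)))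

/-- The energy of `μ` for the pair interaction `C - log G`. -/
noncomputable def kernelEnergy {X : Type*} [MeasurableSpace X] (G : X × X → ℝ) (C : ℝ)
    (μ : ProbabilityMeasure X) : ℝ≥0∞ :=
  ∫⁻ z, gapLog G C z ∂((μ : Measure X).prod (μ : Measure X))

section gapLog

variable {X : Type*} {G : X × X → ℝ} {C : ℝ}

theorem monotone_ofReal_sub_log (h0 : ∀ z, 0 ≤ G z) :
    Monotone fun (m : ℕ) (z : X × X) =>
      ENNReal.ofReal (C - Real.log (G z + 1 / ((m : ℝ) + 1))) := by
  intro m m' hm z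
  have h1 : (0 : ℝ) < 1 / ((m' : ℝ) + 1) := Nat.one_div_pos_of_nat
  have h2 : 1 / ((m' : ℝ) + 1) ≤ 1 / ((m : ℝ) + 1) := Nat.one_div_le_one_div hm
  have := h0 z
  apply ENNReal.ofReal_le_ofReal
  have := Real.log_le_log (by linarith : 0 < G z + 1 / ((m' : ℝ) + 1))
    (by linarith : _ ≤ G z + 1 / ((m : ℝ) + 1))
  linarith

theorem gapLog_of_pos (h0 : ∀ z, 0 ≤ G z) {z : X × X} (hz : 0 < G z) :
    gapLog G C z = ENNReal.ofReal (C - Real.log (G z)) := by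
  have h1 : Tendsto (fun m : ℕ => ENNReal.ofReal (C - Real.log (G z + 1 / ((m : ℝ) + 1)))) atTop
      (𝓝 (ENNReal.ofReal (C - Real.log (G z)))) := by
    apply ENNReal.tendsto_ofReal
    refine tendsto_const_nhds.sub ((Real.continuousAt_log hz.ne').tendsto.comp ?_)
    simpa using tendsto_const_nhds.add (tendsto_one_div_add_atTop_nhds_zero_nat (𝕜 := ℝ))
  exact tendsto_nhds_unique
    (tendsto_atTop_iSup fun m m' h => monotone_ofReal_sub_log h0 h z) h1

theorem gapLog_of_eq_zero (h0 : ∀ z, 0 ≤ G z) {z : X × X} (hz : G z = 0) : gapLog G C z = ⊤ := by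
  have h1 : Tendsto (fun m : ℕ => ENNReal.ofReal (C - Real.log (G z + 1 / ((m : ℝ) + 1)))) atTop
      (𝓝 ⊤) := by
    rw [ENNReal.tendsto_ofReal_nhds_top]
    simp only [hz, zero_add, one_div, Real.log_inv, sub_neg_eq_add]
    refine tendsto_atTop_add_const_left _ _ (Real.tendsto_log_atTop.comp ?_)
    exact tendsto_atTop_add_const_right _ _ tendsto_natCast_atTop_atTop
  exact tendsto_nhds_unique
    (tendsto_atTop_iSup fun m m' h => monotone_ofReal_sub_log h0 h z) h1

theorem measurable_gapLog [MeasurableSpace X] (hG : Measurable G) : Measurable (gapLog G C) :=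
  Measurable.iSup fun _ => (by fun_prop)

end gapLog

/-! ### Regularized energies: continuity, monotone approximation and tightness. -/

namespace VanishingKernel

variable {X : Type*} [TopologicalSpace X] {G : X × X → ℝ} {C : ℝ}

theorem log_add_le (hG : VanishingKernel G C) {η : ℝ} (hη : 0 < η) (hη1 : η ≤ 1) (z : X × X) :
    Real.log (G z + η) ≤ C := by
  rw [Real.log_le_iff_le_exp (by linarith [hG.nonneg z])]
  linarith [hG.add_one_le z]

theorem log_le_log_add (hG : VanishingKernel G C) {η : ℝ} (hη : 0 < η) (z : X × X) :
    Real.log η ≤ Real.log (G z + η) :=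
  Real.log_le_log hη (by linarith [hG.nonneg z])

theorem continuous_log_add (hG : VanishingKernel G C) {η : ℝ} (hη : 0 < η) :
    Continuous fun z => Real.log (G z + η) :=
  (hG.continuous.add continuous_const).log fun z => by
    exact (add_pos_of_nonneg_of_pos (hG.nonneg z) hη).ne'

theorem abs_log_add_le (hG : VanishingKernel G C) {η : ℝ} (hη : 0 < η) (hη1 : η ≤ 1)
    (z : X × X) : |Real.log (G z + η)| ≤ |C| + |Real.log η| := by
  have h1 := hG.log_add_le hη hη1 z
  have h2 := hG.log_le_log_add hη z
  rw [abs_le]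
  constructor <;> linarith [neg_abs_le C, le_abs_self C, neg_abs_le (Real.log η),
    le_abs_self (Real.log η)]

variable [MeasurableSpace X] [BorelSpace X]

theorem integrable_log_add [SecondCountableTopology X] (hG : VanishingKernel G C) {η : ℝ}
    (hη : 0 < η) (hη1 : η ≤ 1) (μ : Measure (X × X)) [IsFiniteMeasure μ] :
    Integrable (fun z => Real.log (G z + η)) μ :=
  Integrable.of_bound (hG.continuous_log_add hη).aestronglyMeasurable (|C| + |Real.log η|)
    (ae_of_all _ fun z => hG.abs_log_add_le hη hη1 z)

/-- This is what the regularization buys: for `η > 0` the integrand is bounded and continuous, and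
`μ ↦ μ ⊗ μ` is weakly continuous. -/
theorem continuous_regularizedEnergy [SecondCountableTopology X]
    [TopologicalSpace.PseudoMetrizableSpace X] (hG : VanishingKernel G C) {η : ℝ}
    (hη : 0 < η) (hη1 : η ≤ 1) : Continuous (regularizedEnergy G η) := by
  let f : BoundedContinuousFunction (X × X) ℝ :=
    BoundedContinuousFunction.ofNormedAddCommGroup (fun z => -Real.log (G z + η))
      (hG.continuous_log_add hη).neg (|C| + |Real.log η|)
      (fun z => by rw [norm_neg]; exact hG.abs_log_add_le hη hη1 z)
  have h : Continuous fun μ : ProbabilityMeasure X => μ.prod μ :=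
    ProbabilityMeasure.continuous_prod.comp (continuous_id.prodMk continuous_id)
  exact (ProbabilityMeasure.continuous_integral_boundedContinuousFunction f).comp h

theorem regularizedEnergy_anti [SecondCountableTopology X] (hG : VanishingKernel G C) {η η' : ℝ}
    (hη : 0 < η) (hηη' : η ≤ η') (hη1 : η' ≤ 1) (μ : ProbabilityMeasure X) :
    regularizedEnergy G η' μ ≤ regularizedEnergy G η μ := by
  refine integral_mono (hG.integrable_log_add (hη.trans_le hηη') hη1 _).neg
    (hG.integrable_log_add hη (hηη'.trans hη1) _).neg fun z => ?_
  exact neg_le_neg (Real.log_le_log (by linarith [hG.nonneg z]) (by linarith))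

/-- Monotone convergence along `η = 1/(m+1)`. The energy becomes a supremum of continuous
functionals, hence lower semicontinuous. -/
theorem kernelEnergy_eq_iSup [SecondCountableTopology X] (hG : VanishingKernel G C)
    (μ : ProbabilityMeasure X) :
    kernelEnergy G C μ =
      ⨆ m : ℕ, ENNReal.ofReal (C + regularizedEnergy G (1 / ((m : ℝ) + 1)) μ) := by
  unfold kernelEnergy gapLog
  have hm := hG.continuous.measurable
  rw [lintegral_iSup (fun m => by fun_prop) (monotone_ofReal_sub_log hG.nonneg)]
  congr 1 with m
  have h1 : (0 : ℝ) < 1 / ((m : ℝ) + 1) := Nat.one_div_pos_of_nat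
  have h2 : 1 / ((m : ℝ) + 1) ≤ 1 := by
    have := Nat.one_div_le_one_div (α := ℝ) (Nat.zero_le m)
    simpa using this
  have h3 := hG.integrable_log_add h1 h2 ((μ : Measure X).prod (μ : Measure X))
  have h4 : Integrable (fun z => C - Real.log (G z + 1 / ((m : ℝ) + 1)))
      ((μ : Measure X).prod (μ : Measure X)) := (integrable_const C).sub h3
  rw [← ofReal_integral_eq_lintegral_ofReal h4
    (ae_of_all _ fun z => sub_nonneg.2 (hG.log_add_le h1 h2 z)),
    integral_sub (integrable_const C) h3]
  simp [regularizedEnergy, integral_neg, sub_eq_add_neg]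

/-- Mass escaping to infinity costs energy. -/
theorem measureReal_compl_mul_le [T2Space X] [SecondCountableTopology X]
    (hG : VanishingKernel G C) {η s : ℝ} (hη : 0 < η) (hη1 : η ≤ 1) {K : Set X}
    (hK : IsCompact K) (hKs : ∀ x ∉ K, ∀ y, G (x, y) ≤ s) (μ : ProbabilityMeasure X) :
    (μ : Measure X).real Kᶜ * (C - Real.log (s + η)) ≤ C + regularizedEnergy G η μ := by
  have hKm : MeasurableSet Kᶜ := hK.measurableSet.compl
  have hi := hG.integrable_log_add hη hη1 ((μ : Measure X).prod (μ : Measure X))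
  have h1 : ∫ z, (Kᶜ ×ˢ (univ : Set X)).indicator (fun _ => C - Real.log (s + η)) z
      ∂((μ : Measure X).prod (μ : Measure X)) ≤
      ∫ z, (C - Real.log (G z + η)) ∂((μ : Measure X).prod (μ : Measure X)) := by
    refine integral_mono ((integrable_const _).indicator (hKm.prod MeasurableSet.univ))
      ((integrable_const C).sub hi) fun z => ?_
    by_cases hz : z.1 ∈ K
    · simp only [indicator, mem_prod, mem_compl_iff, hz, not_true_eq_false, false_and, if_false]
      exact sub_nonneg.2 (hG.log_add_le hη hη1 z)
    · simp only [indicator, mem_prod, mem_compl_iff, hz, not_false_eq_true, mem_univ, and_self,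
        if_true]
      have := Real.log_le_log (by linarith [hG.nonneg z] : 0 < G z + η)
        (by linarith [hKs z.1 hz z.2] : G z + η ≤ s + η)
      linarith
  rw [integral_indicator (hKm.prod MeasurableSet.univ), setIntegral_const,
    integral_sub (integrable_const C) hi] at h1
  simp only [measureReal_prod_prod, probReal_univ, mul_one, integral_const, smul_eq_mul,
    one_mul] at h1
  simpa [regularizedEnergy, integral_neg, sub_eq_add_neg] using h1

/-- Off a large compact set the interaction is at least `T` for every small `η`, so Markov's
inequality bounds the escaping mass by `a / T`. The compact set does not depend on `η`, which lets
`η` vary along a sequence later. -/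
theorem exists_compact_compl_le [T2Space X] [SecondCountableTopology X]
    (hG : VanishingKernel G C) (a : ℝ) {ε : ℝ≥0∞} (hε : 0 < ε) :
    ∃ K : Set X, IsCompact K ∧ ∃ η₀ : ℝ, 0 < η₀ ∧ η₀ ≤ 1 ∧ ∀ η, 0 < η → η ≤ η₀ →
      ∀ μ : ProbabilityMeasure X, C + regularizedEnergy G η μ ≤ a → (μ : Measure X) Kᶜ ≤ ε := by
  obtain ⟨e, he0, heε⟩ : ∃ e : ℝ, 0 < e ∧ ENNReal.ofReal e ≤ ε := by
    obtain ⟨r, hr0, hr⟩ := ENNReal.lt_iff_exists_nnreal_btwn.1 hε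
    exact ⟨r, by exact_mod_cast hr0, by simpa using hr.le⟩
  set T : ℝ := max 1 (a / e) with hT
  have hT0 : 0 < T := lt_of_lt_of_le one_pos (le_max_left _ _)
  -- Since `η ≤ s`, the factor `1/2` yields `s + η ≤ exp (C - T)`.
  set s : ℝ := min 1 (Real.exp (C - T) / 2) with hs
  have hs0 : 0 < s := lt_min one_pos (by positivity)
  obtain ⟨K, hK, hKs⟩ := hG.vanish s hs0
  refine ⟨K, hK, s, hs0, min_le_left _ _, fun η hη hηs μ hμ => ?_⟩
  have h1 := (hG.measureReal_compl_mul_le hη (hηs.trans (min_le_left _ _)) hK hKs μ).trans hμ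
  have h2 : Real.log (s + η) ≤ C - T := by
    rw [Real.log_le_iff_le_exp (by linarith)]
    linarith [min_le_right 1 (Real.exp (C - T) / 2)]
  have h3 : (μ : Measure X).real Kᶜ * T ≤ a :=
    (mul_le_mul_of_nonneg_left (by linarith) measureReal_nonneg).trans h1
  have h4 : a ≤ e * T := by
    rw [← div_le_iff₀' he0]
    exact le_max_right _ _
  have h5 : (μ : Measure X).real Kᶜ ≤ e := le_of_mul_le_mul_right (h3.trans h4) hT0
  refine le_trans ?_ heε
  rw [← ENNReal.ofReal_toReal (measure_ne_top (μ : Measure X) Kᶜ)]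
  exact ENNReal.ofReal_le_ofReal h5

theorem kernelEnergy_le_ofReal_iff [SecondCountableTopology X] (hG : VanishingKernel G C) {a : ℝ}
    (ha : 0 ≤ a) (μ : ProbabilityMeasure X) :
    kernelEnergy G C μ ≤ ENNReal.ofReal a ↔
      ∀ m : ℕ, C + regularizedEnergy G (1 / ((m : ℝ) + 1)) μ ≤ a := by
  simp [hG.kernelEnergy_eq_iSup, ENNReal.ofReal_le_ofReal_iff ha]

theorem one_div_succ_le_one (m : ℕ) : 1 / ((m : ℝ) + 1) ≤ 1 := by
  simpa using Nat.one_div_le_one_div (α := ℝ) (Nat.zero_le m)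

theorem isClosed_kernelEnergy_le [SecondCountableTopology X]
    [TopologicalSpace.PseudoMetrizableSpace X] (hG : VanishingKernel G C) (a : ℝ≥0∞) :
    IsClosed {μ : ProbabilityMeasure X | kernelEnergy G C μ ≤ a} := by
  simp only [hG.kernelEnergy_eq_iSup, iSup_le_iff, ofPred_forall]
  refine isClosed_iInter fun m => isClosed_le ?_ continuous_const
  exact ENNReal.continuous_ofReal.comp (continuous_const.add
    (hG.continuous_regularizedEnergy Nat.one_div_pos_of_nat (one_div_succ_le_one m)))

/-- Prokhorov: a single regularized energy at a small enough scale already lies below the energy and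
forces tightness. -/
theorem isCompact_kernelEnergy_le [T2Space X] [SecondCountableTopology X]
    [TopologicalSpace.PseudoMetrizableSpace X] (hG : VanishingKernel G C) (a : ℝ≥0∞)
    (ha : a ≠ ⊤) : IsCompact {μ : ProbabilityMeasure X | kernelEnergy G C μ ≤ a} := by
  have : NormalSpace X := by
    let := TopologicalSpace.pseudoMetrizableSpacePseudoMetric X
    infer_instance
  rw [← (hG.isClosed_kernelEnergy_le a).closure_eq]
  refine isCompact_closure_of_isTightMeasureSet
    (isTightMeasureSet_iff_exists_isCompact_measure_compl_le.2 fun ε hε => ?_)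
  obtain ⟨K, hK, η₀, hη0, -, h⟩ := hG.exists_compact_compl_le a.toReal hε
  obtain ⟨m, hm⟩ := exists_nat_one_div_lt hη0
  refine ⟨K, hK, ?_⟩
  rintro _ ⟨μ, hμ, rfl⟩
  refine h _ Nat.one_div_pos_of_nat hm.le μ ?_
  refine (hG.kernelEnergy_le_ofReal_iff ENNReal.toReal_nonneg μ).1 ?_ m
  rwa [ENNReal.ofReal_toReal ha]

/-- On closed sets the infimum of the energy is the limit of the infima of the regularized
energies. -/
theorem exists_regularizedEnergy_ge [T2Space X] [SecondCountableTopology X]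
    [TopologicalSpace.IsCompletelyPseudoMetrizableSpace X] (hG : VanishingKernel G C)
    {A : Set (ProbabilityMeasure X)} (hA : IsClosed A) {a : ℝ} (ha : 0 ≤ a)
    (h : ∀ μ ∈ A, ENNReal.ofReal a < kernelEnergy G C μ) :
    ∃ m : ℕ, ∀ μ ∈ A, a ≤ C + regularizedEnergy G (1 / ((m : ℝ) + 1)) μ := by
  have : NormalSpace X := by
    let := TopologicalSpace.pseudoMetrizableSpacePseudoMetric X
    infer_instance
  -- Otherwise there are measures in `A` whose `m`-th regularized energies stay below the level.
  -- They form a tight sequence, and any cluster point contradicts the hypothesis.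
  by_contra! hcon
  choose μ hμA hμ using hcon
  have hcomp : IsCompact (closure (range μ)) := by
    refine isCompact_closure_of_isTightMeasureSet
      (isTightMeasureSet_iff_exists_isCompact_measure_compl_le.2 fun ε hε => ?_)
    obtain ⟨K, hK, η₀, hη0, -, hKη⟩ := hG.exists_compact_compl_le a hε
    obtain ⟨M, hM⟩ := exists_nat_one_div_lt hη0
    -- The finitely many measures with scale above `η₀` escape the uniform estimate; each is tight
    -- by itself, because the space is Polish.
    have hsing : ∀ m, ∃ K' : Set X, IsCompact K' ∧ (μ m : Measure X) K'ᶜ ≤ ε := fun m => by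
      obtain ⟨K', hK', h'⟩ := isTightMeasureSet_iff_exists_isCompact_measure_compl_le.1
        (isTightMeasureSet_singleton (μ := (μ m : Measure X))) ε hε
      exact ⟨K', hK', h' _ rfl⟩
    choose K' hK' hK'ε using hsing
    refine ⟨K ∪ ⋃ m ∈ Finset.range M, K' m,
      hK.union ((Finset.range M).isCompact_biUnion fun m _ => hK' m), ?_⟩
    rintro _ ⟨_, ⟨m, rfl⟩, rfl⟩
    rcases lt_or_ge m M with hm | hm
    · refine (measure_mono (compl_subset_compl.2 ?_)).trans (hK'ε m)
      exact (subset_biUnion_of_mem (u := fun m => K' m)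
        (Finset.mem_coe.2 (Finset.mem_range.2 hm))).trans subset_union_right
    · refine (measure_mono (compl_subset_compl.2 subset_union_left)).trans
        (hKη _ Nat.one_div_pos_of_nat ((Nat.one_div_le_one_div hm).trans hM.le) _ (hμ m).le)
  obtain ⟨ν, -, hν⟩ := hcomp.exists_mapClusterPt (f := atTop) (u := μ)
    (tendsto_principal.2 (Eventually.of_forall fun m => subset_closure (mem_range_self m)))
  have hmem : ∀ F : Set (ProbabilityMeasure X), IsClosed F → (∀ᶠ m in atTop, μ m ∈ F) → ν ∈ F :=
    fun F hF hev => by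
      have : MapClusterPt ν atTop μ := hν
      exact isClosed_iff_clusterPt.1 hF ν (this.clusterPt.mono (le_principal_iff.2 hev))
  refine (h ν (hmem A hA (Eventually.of_forall hμA))).not_ge
    ((hG.kernelEnergy_le_ofReal_iff ha ν).2 fun m => ?_)
  refine hmem {ρ | C + regularizedEnergy G (1 / ((m : ℝ) + 1)) ρ ≤ a}
    (isClosed_le (continuous_const.add (hG.continuous_regularizedEnergy Nat.one_div_pos_of_nat
      (one_div_succ_le_one m))) continuous_const) ?_
  -- Regularized energies grow as the scale shrinks, so all later terms also satisfy the bound at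
  -- the fixed scale `m`, a closed condition inherited by the cluster point.
  filter_upwards [eventually_ge_atTop m] with m' hm'
  exact (add_le_add_right (hG.regularizedEnergy_anti Nat.one_div_pos_of_nat
    (Nat.one_div_le_one_div hm') (one_div_succ_le_one m) _) C).trans (hμ m').le

end VanishingKernel

/-! ### Empirical measures -/

section Empirical

variable {X : Type*} [MeasurableSpace X]

theorem coe_empiricalMeasure [Nonempty X] {k : ℕ} (hk : k ≠ 0) (x : Fin k → X) :
    (empiricalMeasure x : Measure X) = empiricalAux x := by
  simp [empiricalMeasure, hk]

theorem integral_empiricalMeasure [Nonempty X] [MeasurableSingletonClass X] {k : ℕ} (hk : k ≠ 0)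
    (x : Fin k → X) (f : X → ℝ) :
    ∫ a, f a ∂(empiricalMeasure x : Measure X) = (k : ℝ)⁻¹ * ∑ j, f (x j) := by
  rw [coe_empiricalMeasure hk, empiricalAux, integral_smul_measure,
    integral_finsetSum_measure fun j _ => integrable_dirac (by simp)]
  simp

theorem continuous_empiricalMeasure [Nonempty X] [TopologicalSpace X] [T1Space X] [BorelSpace X]
    {k : ℕ} : Continuous (empiricalMeasure : (Fin k → X) → ProbabilityMeasure X) := by
  by_cases hk : k = 0
  · subst hk
    exact continuous_of_const fun x y => by rw [Subsingleton.elim x y]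
  refine continuous_iff_continuousAt.2 fun x => ?_
  refine ProbabilityMeasure.tendsto_iff_forall_integral_tendsto.2 fun f => ?_
  simp only [integral_empiricalMeasure hk]
  exact Continuous.tendsto (by fun_prop) x

/-- The product of an empirical measure with itself charges the diagonal, so the terms `i = j` are
present; only the regularization keeps them finite. -/
theorem regularizedEnergy_empiricalMeasure [Nonempty X] [TopologicalSpace X] [T1Space X]
    [BorelSpace X] [SecondCountableTopology X] {G : X × X → ℝ} {C : ℝ}
    (hG : VanishingKernel G C) {η : ℝ} (hη : 0 < η) (hη1 : η ≤ 1) {k : ℕ} (hk : k ≠ 0)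
    (x : Fin k → X) :
    (k : ℝ) ^ 2 * regularizedEnergy G η (empiricalMeasure x) =
      ∑ i, ∑ j, -Real.log (G (x i, x j) + η) := by
  have hk' : (k : ℝ) ≠ 0 := by exact_mod_cast hk
  have hi : Integrable (fun z => -Real.log (G z + η))
      ((empiricalMeasure x : Measure X).prod (empiricalMeasure x : Measure X)) :=
    (hG.integrable_log_add hη hη1 _).neg
  rw [regularizedEnergy, integral_prod _ hi]
  simp only [integral_empiricalMeasure hk]
  rw [← Finset.mul_sum]
  field_simp

end Empirical

/-! ### Products over pairs -/

section Pairs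

variable {k : ℕ}

theorem sum_sum_eq_two_mul_sum_Ioi_add_diag (f : Fin k → Fin k → ℝ) (hf : ∀ i j, f i j = f j i) :
    ∑ i, ∑ j, f i j = 2 * (∑ i, ∑ j ∈ Finset.Ioi i, f i j) + ∑ i, f i i := by
  have h := Finset.sum_sum_Ioi_add_eq_sum_sum_off_diag f
  have h1 : ∀ i, ∑ j ∈ {i}ᶜ, f j i = ∑ j, f i j - f i i := fun i => by
    rw [← Finset.sum_compl_add_sum {i} fun j => f i j, Finset.sum_singleton, add_sub_cancel_right]
    exact Finset.sum_congr rfl fun j _ => hf j i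
  simp only [h1, Finset.sum_sub_distrib] at h
  rw [← sub_eq_iff_eq_add, ← h, Finset.mul_sum]
  refine Finset.sum_congr rfl fun i _ => ?_
  rw [Finset.mul_sum]
  refine Finset.sum_congr rfl fun j _ => ?_
  rw [hf j i, two_mul]

/-- Every index occurs in exactly `k - 1` pairs. Read backwards, this distributes one-point weights
over the pair factors. -/
theorem prod_prod_Ioi_mul (t : Fin k → ℝ) :
    ∏ i, ∏ j ∈ Finset.Ioi i, (t i * t j) = ∏ i, t i ^ (k - 1) := by
  have h := Finset.prod_prod_Ioi_mul_eq_prod_prod_off_diag fun i _ : Fin k => t i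
  simp only [mul_comm (t _) (t _)] at h ⊢
  rw [h, Finset.prod_comm' (t' := Finset.univ) (s' := fun j => {j}ᶜ)
    (by simp [Finset.mem_compl, eq_comm])]
  refine Finset.prod_congr rfl fun i _ => ?_
  rw [Finset.prod_const, Finset.card_compl, Finset.card_singleton, Fintype.card_fin]

theorem sum_sum_Ioi_const : (∑ i : Fin k, ∑ _j ∈ Finset.Ioi i, (1 : ℝ)) = k * (k - 1) / 2 := by
  have h := sum_sum_eq_two_mul_sum_Ioi_add_diag (k := k) (fun _ _ => 1) fun _ _ => rfl
  simp at h ⊢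
  linarith

/-- As `G` vanishes on the diagonal, the terms `i = j` of the double sum add up to `-k log η`. This
is linear in `k`, hence negligible against `k²`. -/
theorem prod_prod_Ioi_le_exp {X : Type*} [MeasurableSpace X] [Nonempty X] [TopologicalSpace X]
    [T1Space X] [BorelSpace X] [SecondCountableTopology X] {G : X × X → ℝ} {C : ℝ}
    (hG : VanishingKernel G C) {η : ℝ} (hη : 0 < η) (hη1 : η ≤ 1) (hk : k ≠ 0) {t : ℝ}
    (x : Fin k → X) (ht : t ≤ regularizedEnergy G η (empiricalMeasure x)) :
    ∏ i, ∏ j ∈ Finset.Ioi i, (G (x i, x j) + η) ≤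
      Real.exp (-((k : ℝ) ^ 2 * t + k * Real.log η) / 2) := by
  have hpos : ∀ i j, 0 < G (x i, x j) + η := fun i j => by linarith [hG.nonneg (x i, x j)]
  have h1 := regularizedEnergy_empiricalMeasure hG hη hη1 hk x
  rw [sum_sum_eq_two_mul_sum_Ioi_add_diag _ fun i j => by rw [hG.symm]] at h1
  simp only [hG.diag, zero_add, Finset.sum_const, Finset.card_univ, Fintype.card_fin,
    nsmul_eq_mul, Finset.sum_neg_distrib] at h1
  have h2 : ∏ i, ∏ j ∈ Finset.Ioi i, (G (x i, x j) + η) =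
      Real.exp (∑ i, ∑ j ∈ Finset.Ioi i, Real.log (G (x i, x j) + η)) := by
    simp only [Real.exp_sum, Real.exp_log (hpos _ _)]
  rw [h2, Real.exp_le_exp]
  have h3 := mul_le_mul_of_nonneg_left ht (sq_nonneg (k : ℝ))
  linarith

end Pairs

/-- If the density is dominated by `∏ h(xⱼ) ∏_{i<j} (G + η)(xᵢ, xⱼ)`, then events on which the
empirical measure has large regularized energy have small mass. -/
theorem lintegral_preimage_empiricalMeasure_le {X : Type*} [MeasurableSpace X] [Nonempty X]
    [TopologicalSpace X] [T1Space X] [BorelSpace X] [SecondCountableTopology X] {G : X × X → ℝ}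
    {C : ℝ} (hG : VanishingKernel G C) {η : ℝ} (hη : 0 < η) (hη1 : η ≤ 1) {k : ℕ} (hk : k ≠ 0)
    {t : ℝ} {A : Set (ProbabilityMeasure X)} (hAc : IsClosed A)
    (hA : ∀ μ ∈ A, t ≤ regularizedEnergy G η μ)
    (vol : Measure X) [SigmaFinite vol] {h : X → ℝ} (hint : Integrable h vol)
    (h0 : ∀ a, 0 ≤ h a) {D : (Fin k → X) → ℝ}
    (hD : ∀ x, D x ≤ (∏ j, h (x j)) * ∏ i, ∏ j ∈ Finset.Ioi i, (G (x i, x j) + η)) :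
    (Measure.pi fun _ : Fin k => vol).withDensity (fun x => ENNReal.ofReal (D x))
        (empiricalMeasure ⁻¹' A) ≤
      ENNReal.ofReal ((∫ a, h a ∂vol) ^ k *
        Real.exp (-((k : ℝ) ^ 2 * t + k * Real.log η) / 2)) := by
  set P := Measure.pi fun _ : Fin k => vol
  set T := Real.exp (-((k : ℝ) ^ 2 * t + k * Real.log η) / 2)
  have hi : Integrable (fun x : Fin k → X => (∏ j, h (x j)) * T) P :=
    (Integrable.fintype_prod fun _ => hint).mul_const T
  have hn : ∀ x : Fin k → X, 0 ≤ ∏ j, h (x j) := fun x => Finset.prod_nonneg fun j _ => h0 _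
  calc P.withDensity (fun x => ENNReal.ofReal (D x)) (empiricalMeasure ⁻¹' A)
      = ∫⁻ x in empiricalMeasure ⁻¹' A, ENNReal.ofReal (D x) ∂P :=
        withDensity_apply' _ _
    _ ≤ ∫⁻ x in empiricalMeasure ⁻¹' A, ENNReal.ofReal ((∏ j, h (x j)) * T) ∂P := by
        refine setLIntegral_mono' (hAc.preimage continuous_empiricalMeasure).measurableSet
          fun x hx => ENNReal.ofReal_le_ofReal ((hD x).trans ?_)
        exact mul_le_mul_of_nonneg_left (prod_prod_Ioi_le_exp hG hη hη1 hk x (hA _ hx)) (hn x)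
    _ ≤ ∫⁻ x, ENNReal.ofReal ((∏ j, h (x j)) * T) ∂P := setLIntegral_le_lintegral _ _
    _ = ENNReal.ofReal ((∫ a, h a ∂vol) ^ k * T) := by
        rw [← ofReal_integral_eq_lintegral_ofReal hi
          (ae_of_all _ fun x => mul_nonneg (hn x) (Real.exp_pos _).le), integral_mul_const,
          integral_fintype_prod_eq_prod]
        simp

/-! ### Product measures -/

section PiMeasure

variable {ι X : Type*} [Fintype ι] [MeasurableSpace X]

/-- The outer measure behind `Measure.pi` is the largest one bounded on boxes by the product of the
side masses, so no finiteness is needed. -/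
theorem pi_measure_mono {μ ν : Measure X} (h : μ ≤ ν) :
    (Measure.pi fun _ : ι => μ) ≤ Measure.pi fun _ : ι => ν := by
  refine Measure.le_iff.2 fun s hs => ?_
  rw [Measure.pi, Measure.pi, toMeasure_apply _ _ hs, toMeasure_apply _ _ hs]
  refine OuterMeasure.le_pi.2 (fun t _ => (OuterMeasure.pi_pi_le _ t).trans ?_) s
  exact Finset.prod_le_prod' fun i _ => h _

theorem pi_measure_const_smul (μ : Measure X) [SigmaFinite μ] (M : ℝ≥0) :
    (Measure.pi fun _ : ι => M • μ) = M ^ Fintype.card ι • Measure.pi fun _ : ι => μ := by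
  refine Measure.pi_eq fun s _ => ?_
  simp only [Measure.smul_apply, Measure.pi_pi, ENNReal.smul_def, smul_eq_mul,
    Finset.prod_mul_distrib, Finset.prod_const, Finset.card_univ, ENNReal.coe_pow]

theorem map_pair_pi (μ : Measure X) [IsProbabilityMeasure μ] {i j : ι} (hij : i ≠ j) :
    (Measure.pi fun _ : ι => μ).map (fun x => (x i, x j)) = μ.prod μ := by
  have h : ProbabilityTheory.IndepFun (fun x : ι → X => x i) (fun x : ι → X => x j)
      (Measure.pi fun _ : ι => μ) :=
    (ProbabilityTheory.iIndepFun_pi (μ := fun _ : ι => μ) (X := fun _ => id)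
      fun _ => aemeasurable_id).indepFun hij
  have he : ∀ l, (Measure.pi fun _ : ι => μ).map (fun x => x l) = μ := fun l =>
    (measurePreserving_eval (fun _ : ι => μ) l).map_eq
  have hm : ∀ l, AEMeasurable (fun x : ι → X => x l) (Measure.pi fun _ : ι => μ) := fun l =>
    (measurable_pi_apply l).aemeasurable
  have h' := (ProbabilityTheory.indepFun_iff_map_prod_eq_prod_map_map (hm i) (hm j)).1 h
  rwa [he, he] at h'

theorem measurePreserving_pair_pi (μ : Measure X) [IsProbabilityMeasure μ] {i j : ι}
    (hij : i ≠ j) :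
    MeasurePreserving (fun x : ι → X => (x i, x j)) (Measure.pi fun _ : ι => μ) (μ.prod μ) :=
  ⟨by fun_prop, map_pair_pi μ hij⟩

end PiMeasure

/-! ### Weak law of large numbers for empirical measures -/

section LLN

variable {X : Type*} [MeasurableSpace X] [TopologicalSpace X] [BorelSpace X]

/-- Chebyshev: a sum of `k` independent copies has variance `kV`, which gives the bound `V / (k
ε²)`. -/
theorem tendsto_measure_abs_integral_empiricalMeasure_sub_ge [Nonempty X] [T1Space X]
    (ν : ProbabilityMeasure X) (f : BoundedContinuousFunction X ℝ) {ε : ℝ} (hε : 0 < ε) :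
    Tendsto (fun k : ℕ => (Measure.pi fun _ : Fin k => (ν : Measure X))
      {x | ε ≤ |∫ a, f a ∂(empiricalMeasure x : Measure X) - ∫ a, f a ∂(ν : Measure X)|})
      atTop (𝓝 0) := by
  have hf : MemLp f 2 (ν : Measure X) :=
    MemLp.of_bound f.continuous.aestronglyMeasurable ‖f‖ (ae_of_all _ f.norm_coe_le_norm)
  set V := ProbabilityTheory.variance f (ν : Measure X)
  have hlim : Tendsto (fun k : ℕ => ENNReal.ofReal (V / ((k : ℝ) * ε ^ 2))) atTop (𝓝 0) := by
    rw [← ENNReal.ofReal_zero]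
    refine ENNReal.tendsto_ofReal (tendsto_const_nhds.div_atTop ?_)
    exact tendsto_natCast_atTop_atTop.atTop_mul_const (by positivity)
  refine tendsto_of_tendsto_of_tendsto_of_le_of_le' tendsto_const_nhds hlim
    (Eventually.of_forall fun _ => zero_le) ?_
  filter_upwards [eventually_ge_atTop 1] with k hk
  have hk0 : k ≠ 0 := by omega
  have hk' : (0 : ℝ) < k := by exact_mod_cast hk
  set P := Measure.pi fun _ : Fin k => (ν : Measure X)
  set Y : (Fin k → X) → ℝ := ∑ i, fun x => f (x i)
  have hLp : ∀ i : Fin k, MemLp (fun x : Fin k → X => f (x i)) 2 P := fun i =>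
    hf.comp_measurePreserving (measurePreserving_eval _ i)
  have hY : MemLp Y 2 P := memLp_finsetSum' _ fun i _ => hLp i
  have hYint : ∫ x, Y x ∂P = k * ∫ a, f a ∂(ν : Measure X) := by
    simp only [Y, Finset.sum_apply]
    rw [integral_finsetSum _ fun i _ => (hLp i).integrable (by norm_num)]
    simp only [P, integral_comp_eval (μ := fun _ : Fin k => (ν : Measure X))
      f.continuous.aestronglyMeasurable]
    simp
  have hvar : ProbabilityTheory.variance Y P = k * V := by
    simp only [Y, P]
    rw [ProbabilityTheory.variance_sum_pi (X := fun _ : Fin k => f) fun _ => hf]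
    simp [V]
  have hcheb := ProbabilityTheory.meas_ge_le_variance_div_sq hY (c := k * ε) (by positivity)
  rw [hYint, hvar] at hcheb
  refine le_trans (measure_mono fun x hx => ?_) (hcheb.trans_eq ?_)
  · simp only [mem_ofPred_eq, integral_empiricalMeasure hk0] at hx ⊢
    have : Y x - k * ∫ a, f a ∂(ν : Measure X) =
        k * ((k : ℝ)⁻¹ * ∑ j, f (x j) - ∫ a, f a ∂(ν : Measure X)) := by
      simp only [Y, Finset.sum_apply]
      field_simp
    rw [this, abs_mul, abs_of_pos hk']
    gcongr
  · congr 1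
    field_simp

/-- Empirical measures of independent samples converge in probability, in the weak topology. -/
theorem tendsto_measure_preimage_empiricalMeasure_compl [Nonempty X] [T1Space X]
    (ν : ProbabilityMeasure X) {O : Set (ProbabilityMeasure X)} (hO : O ∈ 𝓝 ν) :
    Tendsto (fun k : ℕ => (Measure.pi fun _ : Fin k => (ν : Measure X)) (empiricalMeasure ⁻¹' Oᶜ))
      atTop (𝓝 0) := by
  -- The sets whose complements have vanishing probability form a filter. Its convergence to `ν` can
  -- be tested on one bounded continuous function at a time, which avoids an explicit neighbourhood
  -- base.
  let F : Filter (ProbabilityMeasure X) :=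
    { sets := {O | Tendsto (fun k : ℕ => (Measure.pi fun _ : Fin k => (ν : Measure X))
        (empiricalMeasure ⁻¹' Oᶜ)) atTop (𝓝 0)}
      univ_sets := by simp
      sets_of_superset := fun {s t} hs hst =>
        tendsto_of_tendsto_of_tendsto_of_le_of_le tendsto_const_nhds hs (fun _ => zero_le)
          fun k => measure_mono (preimage_mono (compl_subset_compl.2 hst))
      inter_sets := fun {s t} hs ht => by
        have hst := Tendsto.add hs ht
        rw [add_zero] at hst
        refine tendsto_of_tendsto_of_tendsto_of_le_of_le tendsto_const_nhds hst
          (fun _ => zero_le) fun k => ?_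
        simp only [compl_inter, preimage_union]
        exact measure_union_le _ _ }
  have hF : Tendsto (fun μ : ProbabilityMeasure X => μ) F (𝓝 ν) := by
    refine ProbabilityMeasure.tendsto_iff_forall_integral_tendsto.2 fun f => ?_
    refine Metric.tendsto_nhds.2 fun ε hε => ?_
    change Tendsto _ _ _
    convert tendsto_measure_abs_integral_empiricalMeasure_sub_ge ν f hε using 3 with k
    ext x
    simp [Real.dist_eq]
  exact hF hO

end LLN

/-! ### A lower bound of Jensen type -/

theorem ofReal_integral_le_lintegral_ofReal {Ω : Type*} [MeasurableSpace Ω] {P : Measure Ω}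
    {f : Ω → ℝ} (hf : Integrable f P) :
    ENNReal.ofReal (∫ x, f x ∂P) ≤ ∫⁻ x, ENNReal.ofReal (f x) ∂P := by
  rw [integral_eq_lintegral_pos_part_sub_lintegral_neg_part hf]
  exact (ENNReal.ofReal_le_ofReal (sub_le_self _ ENNReal.toReal_nonneg)).trans
    ENNReal.ofReal_toReal_le

/-- With `m = ∫ g - δ`, the tangent line gives `exp g ≥ exp m * (1 + g - m)`. The bracket has
integral `1 + δ` in total and, by the upper bound `U` and the hypothesis on `Aᶜ`, at most `δ` off
`A`. So its integral over `A` is at least `1`; conditioning on `A` is not needed. -/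
theorem ofReal_exp_integral_sub_le_setLIntegral {Ω : Type*} [MeasurableSpace Ω] {P : Measure Ω}
    [IsProbabilityMeasure P] {g D : Ω → ℝ} {U δ : ℝ} (hg : Integrable g P)
    (hU : ∀ᵐ x ∂P, g x ≤ U) (hD : ∀ᵐ x ∂P, Real.exp (g x) ≤ D x) {A : Set Ω}
    (hA : MeasurableSet A) (h : (1 + U - ∫ x, g x ∂P + δ) * P.real Aᶜ ≤ δ) :
    ENNReal.ofReal (Real.exp (∫ x, g x ∂P - δ)) ≤ ∫⁻ x in A, ENNReal.ofReal (D x) ∂P := by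
  set m := ∫ x, g x ∂P - δ
  have hi : Integrable (fun x => 1 + g x - m) P :=
    ((integrable_const 1).add hg).sub (integrable_const m)
  have h1 : ∫ x, (1 + g x - m) ∂P = 1 + δ := by
    have h0 : ∀ x, 1 + g x - m = g x + (1 - m) := fun x => by ring
    simp only [h0]
    rw [integral_add hg (integrable_const _)]
    simp only [integral_const, probReal_univ, smul_eq_mul, one_mul, m]
    ring
  have h2 : ∫ x in Aᶜ, (1 + g x - m) ∂P ≤ δ := by
    have : ∫ x in Aᶜ, (1 + g x - m) ∂P ≤ ∫ _x in Aᶜ, (1 + U - m) ∂P := by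
      refine setIntegral_mono_ae hi.integrableOn integrableOn_const ?_
      filter_upwards [hU] with x hx
      linarith
    rw [setIntegral_const, smul_eq_mul, mul_comm] at this
    refine this.trans (le_trans (le_of_eq ?_) h)
    simp only [m]
    ring
  have h3 : 1 ≤ ∫ x in A, (1 + g x - m) ∂P := by
    rw [← integral_add_compl hA hi] at h1
    linarith
  calc ENNReal.ofReal (Real.exp m)
      ≤ ENNReal.ofReal (∫ x in A, Real.exp m * (1 + g x - m) ∂P) := by
        rw [integral_const_mul]
        exact ENNReal.ofReal_le_ofReal (le_mul_of_one_le_right (Real.exp_pos m).le h3)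
    _ ≤ ∫⁻ x in A, ENNReal.ofReal (Real.exp m * (1 + g x - m)) ∂P := by
        exact ofReal_integral_le_lintegral_ofReal (hi.const_mul _).integrableOn
    _ ≤ ∫⁻ x in A, ENNReal.ofReal (D x) ∂P := by
        refine lintegral_mono_ae (ae_restrict_of_ae ?_)
        filter_upwards [hD] with x hx
        refine ENNReal.ofReal_le_ofReal (le_trans ?_ hx)
        have := Real.add_one_le_exp (g x - m)
        calc Real.exp m * (1 + g x - m) ≤ Real.exp m * Real.exp (g x - m) :=
              mul_le_mul_of_nonneg_left (by linarith) (Real.exp_pos m).le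
          _ = Real.exp (g x) := by rw [← Real.exp_add]; congr 1; ring

section ProductDensity

variable {X : Type*} [MeasurableSpace X]

/-- Lower bound for the mass that a product density gives to a set `A`, in terms of a probability
measure `ν` dominated by the reference measure. -/
theorem ofReal_exp_le_withDensity_pi {ν vol : Measure X} [IsProbabilityMeasure ν]
    [SigmaFinite vol] {M : ℝ≥0} (hνM : ν ≤ M • vol) {k : ℕ} {a : X × X → ℝ} {b : X → ℝ}
    (ha_int : Integrable (fun z => Real.log (a z)) (ν.prod ν)) {c₁ c₂ : ℝ} (hc₁ : 0 ≤ c₁)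
    (ha : ∀ᵐ z ∂ν.prod ν, 0 < a z ∧ Real.log (a z) ≤ c₁)
    (hb_int : Integrable (fun x => Real.log (b x)) ν)
    (hb : ∀ᵐ x ∂ν, 0 < b x ∧ Real.log (b x) ≤ c₂) {A : Set (Fin k → X)} (hA : MeasurableSet A)
    {δ : ℝ} {m : ℝ}
    (hm : m = k * (k - 1) / 2 * (∫ z, Real.log (a z) ∂ν.prod ν) + k * ∫ x, Real.log (b x) ∂ν)
    (h : (1 + (k ^ 2 * c₁ + k * c₂) - m + δ) * (Measure.pi fun _ : Fin k => ν).real Aᶜ ≤ δ) :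
    ENNReal.ofReal (Real.exp (m - δ)) ≤ (M : ℝ≥0∞) ^ k *
      (Measure.pi fun _ : Fin k => vol).withDensity (fun x => ENNReal.ofReal
        ((∏ i, ∏ j ∈ Finset.Ioi i, a (x i, x j)) * ∏ j, b (x j))) A := by
  set P := Measure.pi fun _ : Fin k => ν
  set g : (Fin k → X) → ℝ := fun x =>
    ∑ i, ∑ j ∈ Finset.Ioi i, Real.log (a (x i, x j)) + ∑ j, Real.log (b (x j))
  set D : (Fin k → X) → ℝ := fun x =>
    (∏ i, ∏ j ∈ Finset.Ioi i, a (x i, x j)) * ∏ j, b (x j)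
  have hpair : ∀ i : Fin k, ∀ j ∈ Finset.Ioi i,
      MeasurePreserving (fun x : Fin k → X => (x i, x j)) P (ν.prod ν) := fun i j hj =>
    measurePreserving_pair_pi ν (Finset.mem_Ioi.1 hj).ne
  have hev : ∀ j : Fin k, MeasurePreserving (fun x : Fin k → X => x j) P ν := fun j =>
    measurePreserving_eval _ j
  have hi1 : ∀ i : Fin k, ∀ j ∈ Finset.Ioi i,
      Integrable (fun x : Fin k → X => Real.log (a (x i, x j))) P := fun i j hj =>
    (hpair i j hj).integrable_comp_of_integrable ha_int
  have hi2 : ∀ j : Fin k, Integrable (fun x : Fin k → X => Real.log (b (x j))) P := fun j =>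
    (hev j).integrable_comp_of_integrable hb_int
  have hi1' : Integrable (fun x => ∑ i, ∑ j ∈ Finset.Ioi i, Real.log (a (x i, x j))) P :=
    integrable_finsetSum _ fun i _ => integrable_finsetSum _ fun j hj => hi1 i j hj
  have hi2' : Integrable (fun x : Fin k → X => ∑ j, Real.log (b (x j))) P :=
    integrable_finsetSum _ fun j _ => hi2 j
  have hg : Integrable g P := hi1'.add hi2'
  have hae1 : ∀ᵐ x ∂P, ∀ i, ∀ j ∈ Finset.Ioi i,
      0 < a (x i, x j) ∧ Real.log (a (x i, x j)) ≤ c₁ := by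
    refine ae_all_iff.2 fun i => ae_all_iff.2 fun j => ?_
    by_cases hj : j ∈ Finset.Ioi i
    · filter_upwards [(hpair i j hj).quasiMeasurePreserving.ae ha] with x hx _ using hx
    · exact ae_of_all _ fun x hx => absurd hx hj
  have hae2 : ∀ᵐ x ∂P, ∀ j, 0 < b (x j) ∧ Real.log (b (x j)) ≤ c₂ :=
    ae_all_iff.2 fun j => (hev j).quasiMeasurePreserving.ae hb
  have hint : ∫ x, g x ∂P = m := by
    have e1 : ∀ i : Fin k, ∀ j ∈ Finset.Ioi i,
        ∫ x, Real.log (a (x i, x j)) ∂P = ∫ z, Real.log (a z) ∂ν.prod ν := fun i j hj => by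
      rw [← (hpair i j hj).map_eq, integral_map (hpair i j hj).measurable.aemeasurable
        (by rw [(hpair i j hj).map_eq]; exact ha_int.aestronglyMeasurable)]
    have e2 : ∀ j : Fin k, ∫ x, Real.log (b (x j)) ∂P = ∫ y, Real.log (b y) ∂ν := fun j =>
      integral_comp_eval (μ := fun _ : Fin k => ν) hb_int.aestronglyMeasurable
    rw [integral_add hi1' hi2', integral_finsetSum _ fun j _ => hi2 j,
      integral_finsetSum _ fun i _ => integrable_finsetSum _ fun j hj => hi1 i j hj,
      Finset.sum_congr rfl fun i _ => integral_finsetSum _ fun j hj => hi1 i j hj,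
      Finset.sum_congr rfl fun i _ => Finset.sum_congr rfl (e1 i), hm]
    simp only [e2, ← sum_sum_Ioi_const, Finset.sum_mul, mul_one, Finset.sum_const,
      Finset.card_univ, Fintype.card_fin, nsmul_eq_mul]
  have hU : ∀ᵐ x ∂P, g x ≤ k ^ 2 * c₁ + k * c₂ := by
    filter_upwards [hae1, hae2] with x h1 h2
    refine add_le_add ?_ ?_
    · calc ∑ i, ∑ j ∈ Finset.Ioi i, Real.log (a (x i, x j))
          ≤ ∑ i : Fin k, ∑ _j ∈ Finset.Ioi i, c₁ :=
            Finset.sum_le_sum fun i _ => Finset.sum_le_sum fun j hj => (h1 i j hj).2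
        _ ≤ ∑ _i : Fin k, ∑ _j : Fin k, c₁ :=
            Finset.sum_le_sum fun i _ =>
              Finset.sum_le_sum_of_subset_of_nonneg (Finset.subset_univ _) fun _ _ _ => hc₁
        _ = k ^ 2 * c₁ := by simp; ring
    · calc ∑ j, Real.log (b (x j)) ≤ ∑ _j : Fin k, c₂ := Finset.sum_le_sum fun j _ => (h2 j).2
        _ = k * c₂ := by simp
  have hD : ∀ᵐ x ∂P, Real.exp (g x) ≤ D x := by
    filter_upwards [hae1, hae2] with x h1 h2
    refine le_of_eq ?_
    simp only [g, D, Real.exp_add, Real.exp_sum]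
    rw [Finset.prod_congr rfl fun i _ => Finset.prod_congr rfl fun j hj =>
      Real.exp_log (h1 i j hj).1, Finset.prod_congr rfl fun j _ => Real.exp_log (h2 j).1]
  have key := ofReal_exp_integral_sub_le_setLIntegral (δ := δ) hg hU hD hA (by rwa [hint])
  rw [hint] at key
  refine key.trans ?_
  -- Passing from the product law to the reference measure costs `M ^ k`, merely exponential in `k`.
  have hle : P ≤ M ^ k • Measure.pi fun _ : Fin k => vol := by
    refine (pi_measure_mono hνM).trans (le_of_eq ?_)
    rw [pi_measure_const_smul, Fintype.card_fin]
  rw [withDensity_apply _ hA]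
  calc ∫⁻ x in A, ENNReal.ofReal (D x) ∂P
      ≤ ∫⁻ x in A, ENNReal.ofReal (D x) ∂(M ^ k • Measure.pi fun _ : Fin k => vol) :=
        lintegral_mono' (Measure.restrict_mono le_rfl hle) le_rfl
    _ = (M : ℝ≥0∞) ^ k * ∫⁻ x in A, ENNReal.ofReal (D x) ∂(Measure.pi fun _ : Fin k => vol) := by
        rw [Measure.restrict_smul, lintegral_smul_measure, ENNReal.smul_def, smul_eq_mul,
          ENNReal.coe_pow]

end ProductDensity

/-! ### The interaction kernel of the ensemble -/

/-- The polynomial growth bound `(1 + |x|^γ)^β`: one has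
`|x^γ - y^γ|^β ≤ growthBound x * growthBound y`. -/
noncomputable def growthBound {S : Set ℝ} (β : ℝ) (γ : ℕ) (x : S) : ℝ :=
  (1 + |(x : ℝ)| ^ γ) ^ β

/-- `G(x, y) = |x^γ - y^γ|^β (w(x) w(y))^a`. -/
noncomputable def interactionKernel {S : Set ℝ} (β a : ℝ) (γ : ℕ) (w : S → ℝ) (z : S × S) : ℝ :=
  |(z.1 : ℝ) ^ γ - (z.2 : ℝ) ^ γ| ^ β * (w z.1 * w z.2) ^ a

section Growth

variable {S : Set ℝ} {β : ℝ} {γ : ℕ}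

theorem one_le_growthBound (hβ : 0 < β) (x : S) : 1 ≤ growthBound β γ x :=
  Real.one_le_rpow (le_add_of_nonneg_right (by positivity)) hβ.le

theorem growthBound_pos (hβ : 0 < β) (x : S) : 0 < growthBound β γ x :=
  one_pos.trans_le (one_le_growthBound hβ x)

theorem continuous_growthBound : Continuous (growthBound β γ : S → ℝ) := by
  refine Continuous.rpow_const (by fun_prop) fun x => Or.inl ?_
  positivity

theorem abs_sub_rpow_le (hβ : 0 < β) (x y : S) :
    |(x : ℝ) ^ γ - (y : ℝ) ^ γ| ^ β ≤ growthBound β γ x * growthBound β γ y := by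
  rw [growthBound, growthBound, ← Real.mul_rpow (by positivity) (by positivity)]
  refine Real.rpow_le_rpow (abs_nonneg _) ?_ hβ.le
  refine (abs_sub _ _).trans ?_
  rw [abs_pow, abs_pow]
  have : 0 ≤ |(x : ℝ)| ^ γ * |(y : ℝ)| ^ γ := by positivity
  nlinarith

theorem growthBound_le (hβ : 0 < β) {x : S} (hx : 1 ≤ |(x : ℝ)|) :
    growthBound β γ x ≤ 2 ^ β * |(x : ℝ)| ^ (γ * β) := by
  have h1 : 1 ≤ |(x : ℝ)| ^ γ := one_le_pow₀ hx
  rw [Real.rpow_mul (abs_nonneg _), Real.rpow_natCast, ← Real.mul_rpow two_pos.le (by positivity)]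
  exact Real.rpow_le_rpow (by positivity) (by linarith) hβ.le

end Growth

/-! ### Decay and convergence of the weights, and domination of the density by pair factors. -/

section Weights

variable {S : Set ℝ} {β κ : ℝ} {γ : ℕ} {v : ℕ → S → ℝ} {w : S → ℝ}

theorem isCompact_abs_le (hS : IsClosed S) (R : ℝ) : IsCompact {x : S | |(x : ℝ)| ≤ R} := by
  have : {x : S | |(x : ℝ)| ≤ R} = (↑) ⁻¹' Metric.closedBall (0 : ℝ) R := by
    ext x
    simp
  rw [this]
  exact hS.isClosedEmbedding_subtypeVal.isCompact_preimage (isCompact_closedBall 0 R)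

/-- Polynomial decay of the weights at infinity (vacuous on bounded sets). -/
theorem WeightDecay.exists_le_rpow (h : WeightDecay β κ γ v) (hκ : 0 < κ) :
    ∃ σ : ℝ, γ * κ * β < σ ∧ ∃ R : ℝ, 1 ≤ R ∧
      ∀ᶠ n in atTop, ∀ x : S, R ≤ |(x : ℝ)| → v n x ≤ |(x : ℝ)| ^ (-σ) := by
  by_cases hb : Bornology.IsBounded S
  · obtain ⟨R, hR⟩ := hb.exists_norm_le
    -- The radius exceeds every point of the bounded set `S`, so the claim is vacuous here.
    refine ⟨γ * κ * β + 1, by linarith, max 1 (R + 1), le_max_left _ _, ?_⟩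
    refine Eventually.of_forall fun n x hx => absurd (hR x x.2) ?_
    rw [Real.norm_eq_abs, not_le]
    linarith [le_max_right 1 (R + 1)]
  · obtain ⟨n₀, ε, hε, ht⟩ := h hb
    set σ := (γ : ℝ) * κ * max β 1 + ε
    have hev := ht.eventually (Iio_mem_nhds (zero_lt_one (α := ℝ≥0∞)))
    rw [eventually_comap] at hev
    obtain ⟨R, hR⟩ := (Metric.hasBasis_cobounded_compl_closedBall (0 : ℝ)).eventually_iff.1 hev
    refine ⟨σ, ?_, max 1 (R + 1), le_max_left _ _, ?_⟩
    · have : (γ : ℝ) * κ * β ≤ γ * κ * max β 1 := by gcongr; exact le_max_left _ _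
      simp only [σ]
      linarith
    filter_upwards [eventually_ge_atTop n₀] with n hn x hx
    have hx1 : 1 ≤ |(x : ℝ)| := (le_max_left _ _).trans hx
    have hx0 : 0 < |(x : ℝ)| := by linarith
    have h1 := hR.2 (show (x : ℝ) ∈ (Metric.closedBall (0 : ℝ) R)ᶜ by
      simp only [mem_compl_iff, Metric.mem_closedBall, dist_zero_right, Real.norm_eq_abs, not_le]
      linarith [le_max_right 1 (R + 1)]) x rfl
    have h2 : ENNReal.ofReal (|(x : ℝ)| ^ σ * v n x) ≤ 1 := by
      rw [ENNReal.ofReal_mul (by positivity)]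
      refine le_trans ?_ (le_of_lt h1)
      gcongr
      exact le_iSup₂ (f := fun n (_ : n ≥ n₀) => ENNReal.ofReal (v n x)) n hn
    rw [ENNReal.ofReal_le_one] at h2
    rw [Real.rpow_neg hx0.le, ← one_div, le_div_iff₀' (by positivity)]
    exact h2

/-- The weights, including the growth bound, are uniformly small off compact sets. -/
theorem WeightDecay.exists_growthBound_mul_le (h : WeightDecay β κ γ v) (hS : IsClosed S)
    (hβ : 0 < β) (hκ : 0 < κ) (hv_nonneg : ∀ n x, 0 ≤ v n x) :
    ∃ a₀ : ℝ, 0 ≤ a₀ ∧ a₀ < 1 / κ ∧ ∀ a > a₀, ∀ s : ℕ → ℝ, Tendsto s atTop (𝓝 a) →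
      ∀ η > 0, ∃ K : Set S, IsCompact K ∧
        ∀ᶠ n in atTop, ∀ x ∉ K, growthBound β γ x * v n x ^ s n ≤ η := by
  obtain ⟨σ, hσ, R, hR1, hR⟩ := h.exists_le_rpow hκ
  have hσ0 : 0 < σ := lt_of_le_of_lt (by positivity) hσ
  -- The growth bound has exponent `γβ` and `v ^ a` decays with exponent `σa`, so `γβ/σ` is the
  -- critical power. It is below `1/κ` exactly because `γκβ < σ`.
  refine ⟨γ * β / σ, by positivity, ?_, fun a ha s hs η hη => ?_⟩
  · rw [div_lt_div_iff₀ hσ0 hκ]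
    linarith [show (γ : ℝ) * κ * β = γ * β * κ by ring]
  have ha0 : 0 < a := lt_of_le_of_lt (by positivity) ha
  rw [gt_iff_lt, div_lt_iff₀ hσ0] at ha
  -- Half of the surplus decay; the other half absorbs the fluctuation of `s n` around `a`.
  set τ := (a * σ - γ * β) / 2 with hτ
  have hτ0 : 0 < τ := by rw [hτ]; linarith
  have hlim : Tendsto (fun r : ℝ => 2 ^ β * r ^ (-τ)) atTop (𝓝 0) := by
    simpa using (tendsto_rpow_neg_atTop hτ0).const_mul ((2 : ℝ) ^ β)
  obtain ⟨R', hR'⟩ := eventually_atTop.1 ((hlim.eventually (Iic_mem_nhds hη)).and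
    (eventually_ge_atTop R))
  refine ⟨{x : S | |(x : ℝ)| ≤ R'}, isCompact_abs_le hS R', ?_⟩
  have hsτ : ∀ᶠ n in atTop, γ * β - σ * s n < -τ := by
    have : Tendsto (fun n => γ * β - σ * s n) atTop (𝓝 (γ * β - σ * a)) :=
      tendsto_const_nhds.sub (hs.const_mul σ)
    refine this.eventually (Iio_mem_nhds ?_)
    rw [hτ]
    linarith
  filter_upwards [hR, hsτ, hs.eventually (Ioi_mem_nhds ha0)] with n hn hnτ hn0 x hx
  simp only [not_le] at hx
  obtain ⟨hxη, hxR⟩ := hR' _ hx.le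
  have hx1 : 1 ≤ |(x : ℝ)| := hR1.trans hxR
  have hx0 : 0 < |(x : ℝ)| := by linarith
  calc growthBound β γ x * v n x ^ s n
      ≤ (2 ^ β * |(x : ℝ)| ^ (γ * β)) * (|(x : ℝ)| ^ (-σ)) ^ s n := by
        exact mul_le_mul (growthBound_le hβ hx1)
          (Real.rpow_le_rpow (hv_nonneg n x) (hn x hxR) (le_of_lt hn0))
          (Real.rpow_nonneg (hv_nonneg n x) _) (by positivity)
    _ = 2 ^ β * |(x : ℝ)| ^ (γ * β - σ * s n) := by
        rw [← Real.rpow_mul hx0.le, mul_assoc, ← Real.rpow_add hx0]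
        congr 2
        ring
    _ ≤ 2 ^ β * |(x : ℝ)| ^ (-τ) := by gcongr
    _ ≤ η := hxη

/-- Uniform upper bounds for the weights on compact sets. -/
theorem WeightConvergence.eventually_le (h : WeightConvergence v w) {K : Set S}
    (hK : IsCompact K) : ∃ B : ℝ, 0 ≤ B ∧ ∀ᶠ n in atTop, ∀ x ∈ K, v n x ≤ B := by
  obtain ⟨B, hB⟩ := (hK.image h.continuous).bddAbove
  refine ⟨max 0 (B + 1), le_max_left _ _, ?_⟩
  filter_upwards [Metric.tendstoUniformlyOn_iff.1 (h.tendsto K hK) 1 one_pos] with n hn x hx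
  have h1 := hn x hx
  rw [Real.dist_eq, abs_lt] at h1
  linarith [hB (mem_image_of_mem w hx), le_max_right 0 (B + 1)]

/-- A fixed power of the weights is dominated by an integrable function. -/
theorem exists_pow_le_div (hS : IsClosed S) (hβ : 0 < β) (hκ : 0 < κ)
    (hv_nonneg : ∀ n x, 0 ≤ v n x) (h_conv : WeightConvergence v w)
    (h_decay : WeightDecay β κ γ v) :
    ∃ (m : ℕ) (B : ℝ), ∀ᶠ n in atTop, ∀ x : S, v n x ^ m ≤ B * (1 + (x : ℝ) ^ 2)⁻¹ := by
  obtain ⟨σ, hσ, R, hR1, hR⟩ := h_decay.exists_le_rpow hκ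
  have hσ0 : 0 < σ := lt_of_le_of_lt (by positivity) hσ
  obtain ⟨B, hB0, hB⟩ := h_conv.eventually_le (isCompact_abs_le hS R)
  -- With `mσ ≥ 2` the `m`-th power decays at least like `|x|⁻²`.
  obtain ⟨m, hm⟩ := exists_nat_ge (2 / σ)
  rw [div_le_iff₀ hσ0] at hm
  refine ⟨m, B ^ m * (1 + R ^ 2) + 2, ?_⟩
  filter_upwards [hR, hB] with n hn hnB x
  rw [← div_eq_mul_inv, le_div_iff₀ (by positivity)]
  rcases le_total |(x : ℝ)| R with hx | hx
  · have h1 : (x : ℝ) ^ 2 ≤ R ^ 2 := sq_le_sq' (by linarith [neg_abs_le (x : ℝ)])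
      ((le_abs_self _).trans hx)
    calc v n x ^ m * (1 + (x : ℝ) ^ 2) ≤ B ^ m * (1 + R ^ 2) := by
          gcongr
          · exact hv_nonneg n x
          · exact hnB x hx
      _ ≤ _ := by linarith
  · have hx1 : 1 ≤ |(x : ℝ)| := hR1.trans hx
    have hx0 : 0 < |(x : ℝ)| := by linarith
    have h2 : v n x ^ m ≤ (|(x : ℝ)| ^ 2)⁻¹ := by
      calc v n x ^ m ≤ (|(x : ℝ)| ^ (-σ)) ^ m := by
            gcongr
            · exact hv_nonneg n x
            · exact hn x hx
        _ = |(x : ℝ)| ^ (-(m * σ)) := by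
            rw [← Real.rpow_mul_natCast hx0.le]
            congr 1
            ring
        _ ≤ |(x : ℝ)| ^ (-2 : ℝ) := by gcongr
        _ = (|(x : ℝ)| ^ 2)⁻¹ := by rw [Real.rpow_neg hx0.le]; norm_cast
    have h3 : 1 + (x : ℝ) ^ 2 ≤ 2 * |(x : ℝ)| ^ 2 := by
      rw [sq_abs]
      have : 1 ≤ |(x : ℝ)| ^ 2 := one_le_pow₀ hx1
      rw [sq_abs] at this
      linarith
    calc v n x ^ m * (1 + (x : ℝ) ^ 2) ≤ (|(x : ℝ)| ^ 2)⁻¹ * (2 * |(x : ℝ)| ^ 2) := by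
          gcongr
      _ = 2 := by field_simp
      _ ≤ _ := by
          have : 0 ≤ B ^ m * (1 + R ^ 2) := by positivity
          linarith

theorem WeightConvergence.tendsto_prod_nhdsWithin (h : WeightConvergence v w) {K : Set S}
    (hK : IsCompact K) {x : S} (hx : x ∈ K) :
    Tendsto (fun q : ℕ × S => v q.1 q.2) (atTop ×ˢ 𝓝[K] x) (𝓝 (w x)) := by
  have h1 := (h.tendsto K hK).tendstoLocallyUniformlyOn
  rw [tendstoLocallyUniformlyOn_iff_forall_tendsto] at h1
  have h2 := h1 x hx
  have h3 : Tendsto (fun q : ℕ × S => w q.2) (atTop ×ˢ 𝓝[K] x) (𝓝 (w x)) :=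
    (h.continuous.tendsto x).comp ((tendsto_snd).mono_right nhdsWithin_le_nhds)
  exact h3.congr_uniformity h2

theorem WeightConvergence.tendsto_apply (h : WeightConvergence v w) (x : S) :
    Tendsto (fun n => v n x) atTop (𝓝 (w x)) :=
  (h.tendsto {x} isCompact_singleton).tendsto_at rfl

/-- Uniform one-sided convergence of powers of the weights, including the growth bound. -/
theorem eventually_growthBound_mul_le (hβ : 0 < β) (h_conv : WeightConvergence v w) {a : ℝ}
    (ha : 0 < a) {s : ℕ → ℝ} (hs : Tendsto s atTop (𝓝 a))
    (hdec : ∀ η > 0, ∃ K : Set S, IsCompact K ∧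
      ∀ᶠ n in atTop, ∀ x ∉ K, growthBound β γ x * v n x ^ s n ≤ η) {η : ℝ} (hη : 0 < η) :
    ∀ᶠ n in atTop, ∀ x : S,
      growthBound β γ x * v n x ^ s n ≤ growthBound β γ x * w x ^ a + η := by
  obtain ⟨K, hK, hKη⟩ := hdec η hη
  have hunif : TendstoUniformlyOn (fun n x => growthBound β γ x * v n x ^ s n)
      (fun x => growthBound β γ x * w x ^ a) atTop K := by
    rw [← tendstoLocallyUniformlyOn_iff_tendstoUniformlyOn_of_compact hK,
      tendstoLocallyUniformlyOn_iff_forall_tendsto]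
    intro x hx
    have h2 : Tendsto (fun q : ℕ × S => q.2) (atTop ×ˢ 𝓝[K] x) (𝓝 x) :=
      tendsto_snd.mono_right nhdsWithin_le_nhds
    have hρ := (continuous_growthBound (β := β) (γ := γ)).continuousAt.tendsto.comp h2
    have hw : Tendsto (fun q : ℕ × S => w q.2) (atTop ×ˢ 𝓝[K] x) (𝓝 (w x)) :=
      (h_conv.continuous.tendsto x).comp h2
    have h3 := hρ.mul (hw.rpow_const (p := a) (Or.inr ha.le))
    -- The exponents `s n` vary with `n`. Joint continuity of the real power holds at `(w x, a)`
    -- even where `w x = 0`, because `a > 0`.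
    have h4 := hρ.mul ((h_conv.tendsto_prod_nhdsWithin hK hx).rpow (hs.comp tendsto_fst)
      (Or.inr ha))
    refine (h3.prodMk h4).mono_right ?_
    rw [← nhds_prod_eq]
    exact nhds_le_uniformity _
  filter_upwards [hKη, Metric.tendstoUniformlyOn_iff.1 hunif η hη] with n h1 h2 x
  by_cases hx : x ∈ K
  · have := h2 x hx
    rw [Real.dist_eq, abs_lt] at this
    linarith
  · have : 0 ≤ growthBound β γ x * w x ^ a :=
      mul_nonneg (growthBound_pos hβ x).le (Real.rpow_nonneg (h_conv.nonneg x) _)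
    linarith [h1 x hx]

theorem exists_growthBound_mul_rpow_le (h_conv : WeightConvergence v w) {a : ℝ} (ha : 0 < a)
    (hdec : ∀ η > 0, ∃ K : Set S, IsCompact K ∧
      ∀ᶠ n in atTop, ∀ x ∉ K, growthBound β γ x * v n x ^ a ≤ η) {η : ℝ} (hη : 0 < η) :
    ∃ K : Set S, IsCompact K ∧ ∀ x ∉ K, growthBound β γ x * w x ^ a ≤ η := by
  obtain ⟨K, hK, hKη⟩ := hdec η hη
  refine ⟨K, hK, fun x hx => ?_⟩
  exact le_of_tendsto (((h_conv.tendsto_apply x).rpow_const (Or.inr ha.le)).const_mul _)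
    (hKη.mono fun n hn => hn x hx)

theorem exists_forall_growthBound_mul_rpow_le (h_conv : WeightConvergence v w) {a : ℝ}
    (ha : 0 < a) (hdec : ∀ η > 0, ∃ K : Set S, IsCompact K ∧
      ∀ᶠ n in atTop, ∀ x ∉ K, growthBound β γ x * v n x ^ a ≤ η) :
    ∃ B : ℝ, 0 ≤ B ∧ ∀ x : S, growthBound β γ x * w x ^ a ≤ B := by
  obtain ⟨K, hK, hK1⟩ := exists_growthBound_mul_rpow_le h_conv ha hdec one_pos
  have hcont : Continuous fun x : S => growthBound β γ x * w x ^ a :=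
    continuous_growthBound.mul (h_conv.continuous.rpow_const fun _ => Or.inr ha.le)
  obtain ⟨B, hB⟩ := (hK.image hcont).bddAbove
  refine ⟨max 1 B, by positivity, fun x => ?_⟩
  by_cases hx : x ∈ K
  · exact (hB (mem_image_of_mem _ hx)).trans (le_max_right _ _)
  · exact (hK1 x hx).trans (le_max_left _ _)

theorem interactionKernel_le (hβ : 0 < β) (hw : ∀ x, 0 ≤ w x) (a : ℝ) (x y : S) :
    interactionKernel β a γ w (x, y) ≤
      (growthBound β γ x * w x ^ a) * (growthBound β γ y * w y ^ a) := by
  rw [interactionKernel, Real.mul_rpow (hw x) (hw y), mul_mul_mul_comm]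
  exact mul_le_mul_of_nonneg_right (abs_sub_rpow_le hβ x y)
    (mul_nonneg (Real.rpow_nonneg (hw x) _) (Real.rpow_nonneg (hw y) _))

theorem continuous_interactionKernel (hβ : 0 < β) (hw : Continuous w) {a : ℝ} (ha : 0 < a) :
    Continuous (interactionKernel β a γ w) := by
  refine Continuous.mul ?_ ?_
  · exact Continuous.rpow_const (by fun_prop) fun _ => Or.inr hβ.le
  · exact Continuous.rpow_const (by fun_prop) fun _ => Or.inr ha.le

/-- `G(x,y)` is at most a product of one-point functions that are bounded and small off compact
sets, so smallness in one variable suffices whatever the other one is. -/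
theorem exists_vanishingKernel (hβ : 0 < β) (h_conv : WeightConvergence v w) {a : ℝ} (ha : 0 < a)
    (hdec : ∀ η > 0, ∃ K : Set S, IsCompact K ∧
      ∀ᶠ n in atTop, ∀ x ∉ K, growthBound β γ x * v n x ^ a ≤ η) :
    ∃ C : ℝ, VanishingKernel (interactionKernel β a γ w) C := by
  obtain ⟨B, hB0, hB⟩ := exists_forall_growthBound_mul_rpow_le h_conv ha hdec
  have hn : ∀ x : S, 0 ≤ growthBound β γ x * w x ^ a := fun x =>
    mul_nonneg (growthBound_pos hβ x).le (Real.rpow_nonneg (h_conv.nonneg x) _)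
  refine ⟨Real.log (B * B + 1), continuous_interactionKernel hβ h_conv.continuous ha, fun z => ?_,
    fun z => ?_, fun x y => ?_, fun x => ?_, fun s hs => ?_⟩
  · exact mul_nonneg (Real.rpow_nonneg (abs_nonneg _) _)
      (Real.rpow_nonneg (mul_nonneg (h_conv.nonneg _) (h_conv.nonneg _)) _)
  · rw [Real.exp_log (by positivity)]
    have := (interactionKernel_le (γ := γ) hβ h_conv.nonneg a z.1 z.2).trans
      (mul_le_mul (hB _) (hB _) (hn _) hB0)
    linarith
  · simp only [interactionKernel]
    rw [abs_sub_comm, mul_comm (w x)]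
  · simp [interactionKernel, Real.zero_rpow hβ.ne']
  · obtain ⟨K, hK, hKs⟩ := exists_growthBound_mul_rpow_le h_conv ha hdec
      (show 0 < s / (B + 1) by positivity)
    refine ⟨K, hK, fun x hx y => (interactionKernel_le hβ h_conv.nonneg a x y).trans ?_⟩
    calc (growthBound β γ x * w x ^ a) * (growthBound β γ y * w y ^ a)
        ≤ (s / (B + 1)) * (B + 1) :=
          mul_le_mul (hKs x hx) ((hB y).trans (by linarith)) (hn y) (by positivity)
      _ = s := by field_simp

/-- The difference factor equals `θ * ρx * ρy` with `0 ≤ θ ≤ 1`. Multiplying the two one-point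
comparisons produces an error of at most `2Bη' + η'²`, which `θ` does not enlarge; without the
growth bounds inside, the error would be multiplied by an unbounded factor. -/
theorem pair_factor_le (hβ : 0 < β) (hw : ∀ x, 0 ≤ w x) {a B η η' : ℝ} (hη'0 : 0 ≤ η')
    (hη' : 2 * B * η' + η' ^ 2 ≤ η)
    (hB : ∀ x : S, growthBound β γ x * w x ^ a ≤ B) {t : S → ℝ} (ht0 : ∀ x, 0 ≤ t x)
    (ht : ∀ x : S, growthBound β γ x * t x ≤ growthBound β γ x * w x ^ a + η') (x y : S) :
    |(x : ℝ) ^ γ - (y : ℝ) ^ γ| ^ β * (t x * t y) ≤ interactionKernel β a γ w (x, y) + η := by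
  set N := |(x : ℝ) ^ γ - (y : ℝ) ^ γ| ^ β
  set ρx := growthBound β γ x
  set ρy := growthBound β γ y
  have hρx : 0 < ρx := growthBound_pos hβ x
  have hρy : 0 < ρy := growthBound_pos hβ y
  have hN : N ≤ ρx * ρy := abs_sub_rpow_le hβ x y
  have hN0 : 0 ≤ N := Real.rpow_nonneg (abs_nonneg _) _
  have hwx : 0 ≤ w x ^ a := Real.rpow_nonneg (hw x) _
  have hwy : 0 ≤ w y ^ a := Real.rpow_nonneg (hw y) _
  set θ := N / (ρx * ρy)
  have hθ0 : 0 ≤ θ := by positivity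
  have hθ1 : θ ≤ 1 := (div_le_one (by positivity)).2 hN
  have hNθ : N = θ * (ρx * ρy) := by simp only [θ]; field_simp
  have h1 : (ρx * t x) * (ρy * t y) ≤ (ρx * w x ^ a + η') * (ρy * w y ^ a + η') :=
    mul_le_mul (ht x) (ht y) (mul_nonneg hρy.le (ht0 y)) (by positivity)
  have h2 : (ρx * w x ^ a + η') * (ρy * w y ^ a + η') ≤
      (ρx * w x ^ a) * (ρy * w y ^ a) + η := by
    have h3 := mul_le_mul_of_nonneg_right (hB x) hη'0
    have h4 := mul_le_mul_of_nonneg_right (hB y) hη'0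
    nlinarith
  have hη0 : 0 ≤ η := by
    have : 0 ≤ B := (by positivity : 0 ≤ ρx * w x ^ a).trans (hB x)
    exact le_trans (by positivity) hη'
  calc N * (t x * t y) = θ * ((ρx * t x) * (ρy * t y)) := by rw [hNθ]; ring
    _ ≤ θ * ((ρx * w x ^ a) * (ρy * w y ^ a) + η) :=
        mul_le_mul_of_nonneg_left (h1.trans h2) hθ0
    _ = N * (w x ^ a * w y ^ a) + θ * η := by rw [hNθ]; ring
    _ ≤ N * (w x ^ a * w y ^ a) + η := by
        have := mul_le_mul_of_nonneg_right hθ1 hη0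
        linarith
    _ = interactionKernel β a γ w (x, y) + η := by
        rw [interactionKernel, Real.mul_rpow (hw x) (hw y)]

theorem tendsto_sub_div_sub_one {p : ℕ → ℕ} (hκ : 0 < κ)
    (hp : Tendsto (fun n => (p n : ℝ) / (n : ℝ)) atTop (𝓝 κ)) (m : ℕ) :
    Tendsto (fun n : ℕ => ((n : ℝ) - m) / ((p n : ℝ) - 1)) atTop (𝓝 (1 / κ)) := by
  have h0 : ∀ c : ℝ, Tendsto (fun n : ℕ => c / (n : ℝ)) atTop (𝓝 0) := fun c =>
    tendsto_const_nhds.div_atTop tendsto_natCast_atTop_atTop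
  have h1 := (tendsto_const_nhds (x := (1 : ℝ))).sub (h0 m)
  have h2 := hp.sub (h0 1)
  have h3 := h1.div h2 (by simpa using hκ.ne')
  simp only [sub_zero] at h3
  refine h3.congr' ?_
  filter_upwards [eventually_gt_atTop 0] with n hn
  have hn' : (n : ℝ) ≠ 0 := by positivity
  simp only [Pi.div_apply]
  rw [one_sub_div hn', ← sub_div, div_div_div_cancel_right₀ hn']

theorem tendsto_natCast_atTop_of_div {p : ℕ → ℕ} (hκ : 0 < κ)
    (hp : Tendsto (fun n => (p n : ℝ) / (n : ℝ)) atTop (𝓝 κ)) : Tendsto p atTop atTop := by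
  rw [← tendsto_natCast_atTop_iff (R := ℝ)]
  refine (hp.pos_mul_atTop hκ tendsto_natCast_atTop_atTop).congr' ?_
  filter_upwards [eventually_gt_atTop 0] with n hn
  field_simp

/-- The density of the ensemble is dominated by a product of integrable functions and of pair
factors `G + η`. -/
theorem eventually_ensembleDensity_le (hS : IsClosed S) (hβ : 0 < β) (hκ : 0 < κ) {p : ℕ → ℕ}
    (hp : Tendsto (fun n => (p n : ℝ) / (n : ℝ)) atTop (𝓝 κ)) (hv_nonneg : ∀ n x, 0 ≤ v n x)
    (h_conv : WeightConvergence v w) (h_decay : WeightDecay β κ γ v) :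
    ∃ B : ℝ, 0 ≤ B ∧ ∀ η > 0, ∀ᶠ n in atTop, ∀ x : Fin (p n) → S,
      ensembleDensity β γ n (p n) (v n) x ≤ (∏ j, B * (1 + (x j : ℝ) ^ 2)⁻¹) *
        ∏ i, ∏ j ∈ Finset.Ioi i, (interactionKernel β (1 / κ) γ w (x i, x j) + η) := by
  -- These `m` powers pay for integrability; the remaining `n - m` are spread over the `k - 1` pairs
  -- of each point, and `(n - m)/(k - 1)` still tends to `1/κ`.
  obtain ⟨m, B, hmB⟩ := exists_pow_le_div hS hβ hκ hv_nonneg h_conv h_decay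
  obtain ⟨a₀, ha₀, haκ, hdec⟩ := h_decay.exists_growthBound_mul_le hS hβ hκ hv_nonneg
  have hκ' : 0 < 1 / κ := by positivity
  obtain ⟨B', hB'0, hB'⟩ := exists_forall_growthBound_mul_rpow_le h_conv hκ'
    (hdec _ haκ _ tendsto_const_nhds)
  refine ⟨max B 0, le_max_right _ _, fun η hη => ?_⟩
  obtain ⟨η', hη'0, hη'⟩ : ∃ η' > 0, 2 * B' * η' + η' ^ 2 ≤ η := by
    -- As `η' ≤ 1`, one has `2B'η' + η'² ≤ (2B' + 1)η' ≤ η`.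
    refine ⟨min 1 (η / (2 * B' + 1)), by positivity, ?_⟩
    have h1 := min_le_left 1 (η / (2 * B' + 1))
    have h2 := min_le_right 1 (η / (2 * B' + 1))
    have h3 : 0 < min 1 (η / (2 * B' + 1)) := by positivity
    set t := min 1 (η / (2 * B' + 1))
    rw [le_div_iff₀ (by positivity)] at h2
    nlinarith
  have hs := tendsto_sub_div_sub_one hκ hp m
  filter_upwards [hmB, eventually_growthBound_mul_le hβ h_conv hκ' hs (hdec _ haκ _ hs) hη'0,
    (tendsto_natCast_atTop_of_div hκ hp).eventually_ge_atTop 2, eventually_ge_atTop m]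
    with n h1 h2 h3 h4
  set k := p n
  set s := ((n : ℝ) - m) / ((k : ℝ) - 1)
  intro x
  have hk1 : (0 : ℝ) < (k : ℝ) - 1 := by
    have : (2 : ℝ) ≤ k := by exact_mod_cast h3
    linarith
  have hpow : ∀ y : S, v n y ^ n = v n y ^ m * (v n y ^ s) ^ (k - 1) := fun y => by
    have hsk : s * ((k - 1 : ℕ) : ℝ) = ((n - m : ℕ) : ℝ) := by
      rw [Nat.cast_sub h4, Nat.cast_sub (by omega), Nat.cast_one]
      simp only [s]
      field_simp
    rw [← Real.rpow_mul_natCast (hv_nonneg n y), hsk, Real.rpow_natCast, ← pow_add,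
      Nat.add_sub_cancel' h4]
  have hfac : ensembleDensity β γ n k (v n) x = (∏ j, v n (x j) ^ m) *
      ∏ i, ∏ j ∈ Finset.Ioi i,
        (|(x i : ℝ) ^ γ - (x j : ℝ) ^ γ| ^ β * (v n (x i) ^ s * v n (x j) ^ s)) := by
    simp only [ensembleDensity, hpow, Finset.prod_mul_distrib (f := fun j => v n (x j) ^ m)]
    rw [← prod_prod_Ioi_mul fun j => v n (x j) ^ s]
    simp only [Finset.prod_mul_distrib]
    ring
  have h1' : ∀ y : S, v n y ^ m ≤ max B 0 * (1 + (y : ℝ) ^ 2)⁻¹ := fun y =>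
    (h1 y).trans (mul_le_mul_of_nonneg_right (le_max_left _ _) (by positivity))
  rw [hfac]
  refine mul_le_mul ?_ ?_ ?_ ?_
  · exact Finset.prod_le_prod (fun j _ => pow_nonneg (hv_nonneg n _) _) fun j _ => h1' _
  · refine Finset.prod_le_prod (fun i _ => Finset.prod_nonneg fun j _ => ?_) fun i _ =>
      Finset.prod_le_prod (fun j _ => ?_) fun j _ => ?_
    · exact mul_nonneg (Real.rpow_nonneg (abs_nonneg _) _) (mul_nonneg
        (Real.rpow_nonneg (hv_nonneg n _) _) (Real.rpow_nonneg (hv_nonneg n _) _))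
    · exact mul_nonneg (Real.rpow_nonneg (abs_nonneg _) _) (mul_nonneg
        (Real.rpow_nonneg (hv_nonneg n _) _) (Real.rpow_nonneg (hv_nonneg n _) _))
    · exact pair_factor_le hβ h_conv.nonneg hη'0.le hη' hB'
        (t := fun y => v n y ^ s) (fun y => Real.rpow_nonneg (hv_nonneg n y) _) h2 _ _
  · exact Finset.prod_nonneg fun i _ => Finset.prod_nonneg fun j _ =>
      mul_nonneg (Real.rpow_nonneg (abs_nonneg _) _) (mul_nonneg
        (Real.rpow_nonneg (hv_nonneg n _) _) (Real.rpow_nonneg (hv_nonneg n _) _))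
  · exact Finset.prod_nonneg fun j _ => (pow_nonneg (hv_nonneg n _) m).trans (h1' _)

end Weights

/-! ### Logarithmic integrals -/

section LogIntegral

theorem lintegral_ofReal_neg_log_abs_ne_top :
    ∫⁻ v : ℝ, ENNReal.ofReal (-Real.log |v|) ≠ ⊤ := by
  have h1 : ∀ v : ℝ, ENNReal.ofReal (-Real.log |v|) ≤
      (Icc (-1 : ℝ) 1).indicator (fun v => ENNReal.ofReal |Real.log v|) v := fun v => by
    by_cases hv : v ∈ Icc (-1 : ℝ) 1
    · rw [indicator_of_mem hv, Real.log_abs]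
      exact ENNReal.ofReal_le_ofReal (neg_le_abs _)
    · rw [indicator_of_notMem hv, nonpos_iff_eq_zero, ENNReal.ofReal_eq_zero, neg_nonpos]
      refine Real.log_nonneg (le_of_lt ?_)
      by_contra! h
      exact hv (abs_le.1 h)
  have h2 : IntegrableOn Real.log (Icc (-1) 1) := by
    rw [integrableOn_Icc_iff_integrableOn_Ioc,
      ← intervalIntegrable_iff_integrableOn_Ioc_of_le (by norm_num)]
    exact intervalIntegral.intervalIntegrable_log'
  refine ne_top_of_le_ne_top ?_ (lintegral_mono h1)
  rw [lintegral_indicator measurableSet_Icc]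
  have h3 := h2.2
  simp only [hasFiniteIntegral_iff_norm, Real.norm_eq_abs] at h3
  exact h3.ne

theorem lintegral_ofReal_neg_log_abs_sub (c : ℝ) :
    ∫⁻ v : ℝ, ENNReal.ofReal (-Real.log |c - v|) = ∫⁻ v : ℝ, ENNReal.ofReal (-Real.log |v|) :=
  lintegral_sub_left_eq_self (μ := volume) (fun v : ℝ => ENNReal.ofReal (-Real.log |v|)) c

/-- Averaging `log |z| - log |z + ε(s - t)|` over `t ∈ [0,1]`. -/
theorem lintegral_log_sub_log_le {z ε s θ β δ : ℝ} (hz : z ≠ 0) (hε : 0 < ε)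
    (hs : s ∈ Icc (0 : ℝ) 1) (hθ : 0 < θ) (hθ1 : θ < 1) (hβ : 0 < β) :
    ∫⁻ t in Icc (0 : ℝ) 1, ENNReal.ofReal (δ + β * (Real.log |z| - Real.log |z + ε * (s - t)|)) ≤
      ENNReal.ofReal (δ - β * Real.log (1 - θ)) + {z : ℝ | |z| < ε / θ}.indicator
        (fun _ => ENNReal.ofReal (δ - β * Real.log θ) +
          ENNReal.ofReal β * ∫⁻ v : ℝ, ENNReal.ofReal (-Real.log |v|)) z := by
  have hvol : volume (Icc (0 : ℝ) 1) = 1 := by simp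
  have hz0 : 0 < |z| := abs_pos.2 hz
  -- Close to the singularity, rescaling by `ε` leaves a translate of `-log |v|`, with integral
  -- bounded independently of `ε`. Far from it, the shift is at most `ε ≤ θ|z|` and changes the
  -- logarithm by at most `-log (1 - θ)`.
  by_cases hzε : |z| < ε / θ
  · rw [indicator_of_mem (show z ∈ {z : ℝ | |z| < ε / θ} from hzε)]
    refine le_trans ?_ le_add_self
    have h1 : ∀ t : ℝ, z + ε * (s - t) ≠ 0 →
        ENNReal.ofReal (δ + β * (Real.log |z| - Real.log |z + ε * (s - t)|)) ≤
        ENNReal.ofReal (δ - β * Real.log θ) +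
          ENNReal.ofReal β * ENNReal.ofReal (-Real.log |(z / ε + s) - t|) := fun t ht => by
      rw [← ENNReal.ofReal_mul hβ.le]
      refine le_trans (ENNReal.ofReal_le_ofReal ?_) ENNReal.ofReal_add_le
      have e1 : z + ε * (s - t) = ε * ((z / ε + s) - t) := by field_simp; ring
      have h0 : (z / ε + s) - t ≠ 0 := fun h => ht (by rw [e1, h, mul_zero])
      have e2 : Real.log |z + ε * (s - t)| = Real.log ε + Real.log |(z / ε + s) - t| := by
        rw [e1, abs_mul, abs_of_pos hε, Real.log_mul hε.ne' (abs_pos.2 h0).ne']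
      have e3 : Real.log |z| ≤ Real.log ε - Real.log θ := by
        rw [← Real.log_div hε.ne' hθ.ne']
        exact Real.log_le_log hz0 hzε.le
      rw [e2]
      nlinarith
    have hae : ∀ᵐ t ∂volume.restrict (Icc (0 : ℝ) 1), z + ε * (s - t) ≠ 0 := by
      refine ae_restrict_of_ae ?_
      have : ∀ᵐ t : ℝ, t ≠ z / ε + s := by simp [ae_iff]
      filter_upwards [this] with t ht h
      apply ht
      field_simp
      linarith
    calc _ ≤ ∫⁻ t in Icc (0 : ℝ) 1, (ENNReal.ofReal (δ - β * Real.log θ) +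
          ENNReal.ofReal β * ENNReal.ofReal (-Real.log |(z / ε + s) - t|)) :=
          lintegral_mono_ae (hae.mono fun t ht => h1 t ht)
      _ = ENNReal.ofReal (δ - β * Real.log θ) + ENNReal.ofReal β *
          ∫⁻ t in Icc (0 : ℝ) 1, ENNReal.ofReal (-Real.log |(z / ε + s) - t|) := by
          rw [lintegral_add_left measurable_const, setLIntegral_const, hvol, mul_one,
            lintegral_const_mul _ (by fun_prop)]
      _ ≤ _ := by
          rw [← lintegral_ofReal_neg_log_abs_sub (z / ε + s)]
          exact add_le_add le_rfl (mul_le_mul_right (setLIntegral_le_lintegral _ _) _)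
  · refine le_trans ?_ le_self_add
    have h1 : ∀ t ∈ Icc (0 : ℝ) 1,
        ENNReal.ofReal (δ + β * (Real.log |z| - Real.log |z + ε * (s - t)|)) ≤
          ENNReal.ofReal (δ - β * Real.log (1 - θ)) := fun t ht => by
      refine ENNReal.ofReal_le_ofReal ?_
      rw [not_lt, div_le_iff₀ hθ] at hzε
      have h2 : |ε * (s - t)| ≤ ε := by
        rw [abs_mul, abs_of_pos hε]
        refine mul_le_of_le_one_right hε.le (abs_le.2 ⟨?_, ?_⟩) <;>
          linarith [hs.1, hs.2, ht.1, ht.2]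
      have h3 : |z| * (1 - θ) ≤ |z + ε * (s - t)| := by
        have h4 : |z| - |ε * (s - t)| ≤ |z + ε * (s - t)| := by
          have := abs_sub_abs_le_abs_sub z (-(ε * (s - t)))
          rwa [abs_neg, sub_neg_eq_add] at this
        nlinarith
      have h4 := Real.log_le_log (mul_pos hz0 (by linarith)) h3
      rw [Real.log_mul hz0.ne' (by linarith)] at h4
      nlinarith
    calc _ ≤ ∫⁻ _t in Icc (0 : ℝ) 1, ENNReal.ofReal (δ - β * Real.log (1 - θ)) :=
          setLIntegral_mono' measurableSet_Icc h1
      _ = _ := by rw [setLIntegral_const, hvol, mul_one]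

end LogIntegral

/-! ### Consequences of finite energy -/

section FiniteEnergy

variable {X : Type*} [TopologicalSpace X] [MeasurableSpace X] [BorelSpace X] {G : X × X → ℝ}
  {C : ℝ}

theorem VanishingKernel.ae_pos [SecondCountableTopology X] (hG : VanishingKernel G C)
    {μ : ProbabilityMeasure X} (hμ : kernelEnergy G C μ ≠ ⊤) :
    ∀ᵐ z ∂(μ : Measure X).prod (μ : Measure X), 0 < G z := by
  filter_upwards [ae_lt_top (measurable_gapLog hG.continuous.measurable) hμ] with z hz
  refine lt_of_le_of_ne (hG.nonneg z) fun h => ?_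
  rw [gapLog_of_eq_zero hG.nonneg h.symm] at hz
  exact lt_irrefl _ hz

/-- An atom would charge a point of the diagonal, where the interaction is infinite. Hence finite
exceptional sets can be discarded. -/
theorem VanishingKernel.measure_singleton_eq_zero [SecondCountableTopology X]
    (hG : VanishingKernel G C)
    {μ : ProbabilityMeasure X} (hμ : kernelEnergy G C μ ≠ ⊤) (x : X) :
    (μ : Measure X) {x} = 0 := by
  have h1 : (μ : Measure X).prod (μ : Measure X) ({x} ×ˢ {x}) = 0 := by
    refine measure_mono_null ?_ (ae_iff.1 (hG.ae_pos hμ))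
    rintro ⟨a, b⟩ ⟨ha, hb⟩
    simp only [mem_singleton_iff] at ha hb
    subst ha hb
    simp [hG.diag]
  rw [Measure.prod_prod] at h1
  exact mul_self_eq_zero.1 h1

end FiniteEnergy

/-! ### Conditioning on compact sets -/

section Conditioning

variable {X : Type*} [TopologicalSpace X] [MeasurableSpace X] [BorelSpace X] {G : X × X → ℝ}
  {C : ℝ}

/-- Conditioning on `A n` changes integrals of bounded functions by a vanishing amount, and since
the interaction is nonnegative the energy is at most `μ(A n)⁻²` times the original one. -/
theorem exists_mem_nhds_of_tendsto_measure_one {μ : ProbabilityMeasure X}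
    (hμ : kernelEnergy G C μ ≠ ⊤) {A : ℕ → Set X} (hA : ∀ n, MeasurableSet (A n))
    (hlim : Tendsto (fun n => (μ : Measure X) (A n)) atTop (𝓝 1))
    {O : Set (ProbabilityMeasure X)} (hO : O ∈ 𝓝 μ) {δ : ℝ≥0∞} (hδ : δ ≠ 0) :
    ∃ n, ∃ ν ∈ O, (ν : Measure X) (A n)ᶜ = 0 ∧ kernelEnergy G C ν ≤ kernelEnergy G C μ + δ := by
  -- The default value `μ` occurs for finitely many `n` only.
  let ν : ℕ → ProbabilityMeasure X := fun n =>
    if h : (μ : Measure X) (A n) ≠ 0 then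
      ⟨ProbabilityTheory.cond (μ : Measure X) (A n), ProbabilityTheory.cond_isProbabilityMeasure h⟩
    else μ
  have hev : ∀ᶠ n in atTop, (μ : Measure X) (A n) ≠ 0 :=
    hlim.eventually_ne one_ne_zero
  have hν : ∀ n, (μ : Measure X) (A n) ≠ 0 → (ν n : Measure X) =
      ((μ : Measure X) (A n))⁻¹ • (μ : Measure X).restrict (A n) := fun n hn => by
    have h : ν n = ⟨ProbabilityTheory.cond (μ : Measure X) (A n),
        ProbabilityTheory.cond_isProbabilityMeasure hn⟩ := dif_pos hn
    rw [h]
    rfl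
  have hlimr : Tendsto (fun n => (μ : Measure X).real (A n)) atTop (𝓝 1) := by
    exact (ENNReal.tendsto_toReal ENNReal.one_ne_top).comp hlim
  have hconv : Tendsto ν atTop (𝓝 μ) := by
    refine ProbabilityMeasure.tendsto_iff_forall_integral_tendsto.2 fun f => ?_
    have hf : Integrable f (μ : Measure X) := f.integrable _
    have h1 : Tendsto (fun n => ∫ x in (A n)ᶜ, f x ∂(μ : Measure X)) atTop (𝓝 0) := by
      refine squeeze_zero_norm (a := fun n => ‖f‖ * (1 - (μ : Measure X).real (A n)))
        (fun n => ?_) (by simpa using (hlimr.const_sub 1).const_mul ‖f‖)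
      have := norm_setIntegral_le_of_norm_le_const (μ := (μ : Measure X)) (s := (A n)ᶜ) (f := f)
        (measure_lt_top _ _) (fun x _ => f.norm_coe_le_norm x)
      rwa [probReal_compl_eq_one_sub (hA n)] at this
    have h2 : Tendsto (fun n => ((μ : Measure X).real (A n))⁻¹ *
        (∫ x, f x ∂(μ : Measure X) - ∫ x in (A n)ᶜ, f x ∂(μ : Measure X))) atTop
        (𝓝 (∫ x, f x ∂(μ : Measure X))) := by
      simpa using (hlimr.inv₀ one_ne_zero).mul (tendsto_const_nhds.sub h1)
    refine h2.congr' (hev.mono fun n hn => ?_)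
    simp only [hν n hn]
    rw [integral_smul_measure, ← integral_add_compl (hA n) hf, add_sub_cancel_right,
      ENNReal.toReal_inv, smul_eq_mul]
    rfl
  have hen : ∀ n, (μ : Measure X) (A n) ≠ 0 → kernelEnergy G C (ν n) ≤
      ((μ : Measure X) (A n))⁻¹ * (((μ : Measure X) (A n))⁻¹ * kernelEnergy G C μ) := fun n hn => by
    rw [kernelEnergy, hν n hn, Measure.prod_smul_left, Measure.prod_smul_right,
      lintegral_smul_measure, lintegral_smul_measure, smul_eq_mul, smul_eq_mul,
      Measure.prod_restrict]
    gcongr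
    exact setLIntegral_le_lintegral _ _
  have hlim2 : Tendsto (fun n => ((μ : Measure X) (A n))⁻¹ * (((μ : Measure X) (A n))⁻¹ *
      kernelEnergy G C μ)) atTop (𝓝 (kernelEnergy G C μ)) := by
    have hinv : Tendsto (fun n => ((μ : Measure X) (A n))⁻¹) atTop (𝓝 1) := by
      simpa using hlim.inv
    have h1 := ENNReal.Tendsto.mul_const hinv (Or.inr hμ)
    have h2 := ENNReal.Tendsto.mul hinv (Or.inl one_ne_zero) h1 (Or.inr ENNReal.one_ne_top)
    simpa using h2
  obtain ⟨n, hn0, hnO, hnE⟩ := (hev.and ((hconv.eventually hO).and (hlim2.eventually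
    (Iio_mem_nhds (ENNReal.lt_add_right hμ hδ))))).exists
  refine ⟨n, ν n, hnO, ?_, (hen n hn0).trans (le_of_lt hnE)⟩
  rw [hν n hn0, Measure.smul_apply, Measure.restrict_apply (hA n).compl]
  simp

end Conditioning

/-! ### Smoothing of measures on a set of reals -/

section Smoothing

/-- The uniform distribution on `[0, 1]`. -/
noncomputable def uniformUnit : Measure ℝ := volume.restrict (Icc 0 1)

instance : IsProbabilityMeasure uniformUnit :=
  ⟨by simp [uniformUnit]⟩

theorem ae_uniformUnit_mem : ∀ᵐ s ∂uniformUnit, s ∈ Icc (0 : ℝ) 1 :=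
  ae_restrict_mem measurableSet_Icc

variable {S : Set ℝ} {f : ℝ → S}

/-- The law of `f (X + ε U)`, where `X` has law `μ` and `U` is uniform on `[0, 1]`. Here
`f : ℝ → S` is meant to be a measurable retraction. -/
noncomputable def smoothedMeasure (hf : Measurable f) (ε : ℝ) (μ : ProbabilityMeasure S) :
    ProbabilityMeasure S :=
  ⟨((μ : Measure S).prod uniformUnit).map fun q => f (q.1 + ε * q.2),
    Measure.isProbabilityMeasure_map (by fun_prop)⟩

theorem coe_smoothedMeasure (hf : Measurable f) (ε : ℝ) (μ : ProbabilityMeasure S) :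
    (smoothedMeasure hf ε μ : Measure S) =
      ((μ : Measure S).prod uniformUnit).map fun q => f (q.1 + ε * q.2) :=
  rfl

theorem coe_retraction (hfS : ∀ x : S, f x = x) {y : ℝ} (hy : y ∈ S) : (f y : ℝ) = y := by
  rw [show f y = ⟨y, hy⟩ from hfS ⟨y, hy⟩]

theorem add_mul_mem_cthickening {A : Set ℝ} {r ε s x : ℝ} (hx : x ∈ A) (hε : 0 ≤ ε) (hεr : ε ≤ r)
    (hs : s ∈ Icc (0 : ℝ) 1) : x + ε * s ∈ Metric.cthickening r A := by
  refine Metric.mem_cthickening_of_dist_le _ x r A hx ?_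
  rw [Real.dist_eq, add_sub_cancel_left, abs_of_nonneg (mul_nonneg hε hs.1)]
  exact (mul_le_of_le_one_right hε hs.2).trans hεr

variable {A : Set ℝ} {r : ℝ} {μ : ProbabilityMeasure S}

theorem smoothedMeasure_compl_eq_zero (hf : Measurable f) (hfS : ∀ x : S, f x = x)
    (hA : Metric.cthickening r A ⊆ S) (hμ : ∀ᵐ x : S ∂(μ : Measure S), (x : ℝ) ∈ A)
    {ε : ℝ} (hε : 0 ≤ ε) (hεr : ε ≤ r) :
    (smoothedMeasure hf ε μ : Measure S) ((↑) ⁻¹' Metric.cthickening r A)ᶜ = 0 := by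
  have hm : MeasurableSet ((↑) ⁻¹' Metric.cthickening r A : Set S)ᶜ :=
    (Metric.isClosed_cthickening.preimage continuous_subtype_val).measurableSet.compl
  rw [coe_smoothedMeasure, Measure.map_apply (by fun_prop) hm]
  have h1 : ∀ᵐ q ∂(μ : Measure S).prod uniformUnit, (q.1 : ℝ) ∈ A :=
    Measure.quasiMeasurePreserving_fst.ae (p := fun x : S => (x : ℝ) ∈ A) hμ
  have h2 : ∀ᵐ q ∂(μ : Measure S).prod uniformUnit, q.2 ∈ Icc (0 : ℝ) 1 :=
    Measure.quasiMeasurePreserving_snd.ae ae_uniformUnit_mem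
  refine measure_mono_null ?_ (ae_iff.1 (h1.and h2))
  intro q hq hq'
  have := add_mul_mem_cthickening hq'.1 hε hεr hq'.2
  apply hq
  simp only [mem_preimage]
  rwa [coe_retraction hfS (hA this)]

/-- For a fixed starting point, the shifts leading into `E` form a set of measure at most `ε⁻¹ |E|`,
by scaling and translation. The thickening condition keeps the shifted point in `S`, where `f` is
the identity. -/
theorem smoothedMeasure_le (hS : MeasurableSet S) (hf : Measurable f) (hfS : ∀ x : S, f x = x)
    (hA : Metric.cthickening r A ⊆ S) (hμ : ∀ᵐ x : S ∂(μ : Measure S), (x : ℝ) ∈ A)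
    {ε : ℝ} (hε : 0 < ε) (hεr : ε ≤ r) :
    (smoothedMeasure hf ε μ : Measure S) ≤
      (ε⁻¹).toNNReal • Measure.comap ((↑) : S → ℝ) volume := by
  refine Measure.le_iff.2 fun E hE => ?_
  have hE' : MeasurableSet ((↑) '' E : Set ℝ) := hS.subtype_image hE
  have hpre : MeasurableSet ((fun q : S × ℝ => f (q.1 + ε * q.2)) ⁻¹' E) :=
    (show Measurable fun q : S × ℝ => f (q.1 + ε * q.2) by fun_prop) hE
  rw [coe_smoothedMeasure, Measure.map_apply (by fun_prop) hE, Measure.prod_apply hpre]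
  have hb : ∀ᵐ x ∂(μ : Measure S),
      uniformUnit (Prod.mk x ⁻¹' ((fun q : S × ℝ => f (q.1 + ε * q.2)) ⁻¹' E)) ≤
        ENNReal.ofReal ε⁻¹ * volume ((↑) '' E : Set ℝ) := by
    filter_upwards [hμ] with x hx
    rw [uniformUnit, Measure.restrict_apply (measurable_prodMk_left hpre)]
    calc volume (Prod.mk x ⁻¹' ((fun q : S × ℝ => f (q.1 + ε * q.2)) ⁻¹' E) ∩ Icc 0 1)
        ≤ volume ((fun s : ℝ => ε * s) ⁻¹' ((fun y : ℝ => (x : ℝ) + y) ⁻¹' ((↑) '' E))) := by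
          refine measure_mono fun s hs => ?_
          have h1 := add_mul_mem_cthickening hx hε.le hεr hs.2
          exact ⟨_, hs.1, coe_retraction hfS (hA h1)⟩
      _ = ENNReal.ofReal ε⁻¹ * volume ((↑) '' E : Set ℝ) := by
          rw [Real.volume_preimage_mul_left hε.ne', measure_preimage_add,
            abs_of_pos (inv_pos.2 hε)]
  refine (lintegral_mono_ae hb).trans ?_
  rw [lintegral_const, measure_univ, mul_one, Measure.smul_apply,
    comap_subtype_coe_apply hS, ENNReal.smul_def, smul_eq_mul]
  rfl

theorem tendsto_smoothedMeasure (hf : Measurable f) (hfS : ∀ x : S, f x = x) (hr : 0 < r)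
    (hA : Metric.cthickening r A ⊆ S) (hμ : ∀ᵐ x : S ∂(μ : Measure S), (x : ℝ) ∈ A) :
    Tendsto (fun ε => smoothedMeasure hf ε μ) (𝓝[>] 0) (𝓝 μ) := by
  refine ProbabilityMeasure.tendsto_iff_forall_integral_tendsto.2 fun φ => ?_
  have h1 : ∀ᵐ q ∂(μ : Measure S).prod uniformUnit, (q.1 : ℝ) ∈ A :=
    Measure.quasiMeasurePreserving_fst.ae (p := fun x : S => (x : ℝ) ∈ A) hμ
  have h2 : ∀ᵐ q ∂(μ : Measure S).prod uniformUnit, q.2 ∈ Icc (0 : ℝ) 1 :=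
    Measure.quasiMeasurePreserving_snd.ae ae_uniformUnit_mem
  have e1 : ∀ ε, ∫ x, φ x ∂(smoothedMeasure hf ε μ : Measure S) =
      ∫ q, φ (f (q.1 + ε * q.2)) ∂(μ : Measure S).prod uniformUnit := fun ε => by
    rw [coe_smoothedMeasure, integral_map (by fun_prop)
      φ.continuous.aestronglyMeasurable]
  have e2 : ∫ x, φ x ∂(μ : Measure S) = ∫ q, φ q.1 ∂(μ : Measure S).prod uniformUnit := by
    rw [integral_fun_fst (f := φ)]
    simp
  simp only [e1]
  rw [e2]
  refine tendsto_integral_filter_of_dominated_convergence (fun _ => ‖φ‖) ?_ ?_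
    (integrable_const _) ?_
  · refine Eventually.of_forall fun ε => ?_
    exact (φ.continuous.measurable.comp (by fun_prop)).aestronglyMeasurable
  · exact Eventually.of_forall fun ε => ae_of_all _ fun q => φ.norm_coe_le_norm _
  · filter_upwards [h1, h2] with q hq1 hq2
    refine (φ.continuous.tendsto _).comp ?_
    rw [tendsto_subtype_rng]
    have hlim : Tendsto (fun ε : ℝ => (q.1 : ℝ) + ε * q.2) (𝓝[>] 0) (𝓝 (q.1 : ℝ)) := by
      have : Tendsto (fun ε : ℝ => (q.1 : ℝ) + ε * q.2) (𝓝 0) (𝓝 ((q.1 : ℝ) + 0 * q.2)) :=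
        (Continuous.tendsto (by fun_prop) 0)
      rw [zero_mul, add_zero] at this
      exact this.mono_left nhdsWithin_le_nhds
    refine hlim.congr' ?_
    filter_upwards [Ioc_mem_nhdsGT hr] with ε hε
    exact (coe_retraction hfS (hA (add_mul_mem_cthickening hq1 hε.1.le hε.2 hq2))).symm

end Smoothing

/-! ### Energy of smoothed measures -/

section SmoothingEnergy

variable {S : Set ℝ} {f : ℝ → S} {A : Set ℝ} {r : ℝ} {μ : ProbabilityMeasure S} {G : S × S → ℝ}
  {C β : ℝ} {g : S × S → ℝ}

theorem log_kernel_eq {K : Set S}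
    (hfac : ∀ z, G z = |(z.1 : ℝ) - z.2| ^ β * g z) (hgpos : ∀ z ∈ K ×ˢ K, 0 < g z)
    {z : S × S} (hz : z ∈ K ×ˢ K) (hne : (z.1 : ℝ) ≠ z.2) :
    0 < G z ∧ Real.log (G z) = β * Real.log |(z.1 : ℝ) - z.2| + Real.log (g z) := by
  have h1 : 0 < |(z.1 : ℝ) - z.2| := abs_pos.2 (sub_ne_zero.2 hne)
  have h2 : 0 < |(z.1 : ℝ) - z.2| ^ β := Real.rpow_pos_of_pos h1 _
  rw [hfac]
  refine ⟨mul_pos h2 (hgpos z hz), ?_⟩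
  rw [Real.log_mul h2.ne' (hgpos z hz).ne', Real.log_rpow h1]

/-- Bounded densities on compact sets where the smooth factor is positive have finite energy. -/
theorem kernelEnergy_ne_top_of_le (hS : MeasurableSet S) (hG : VanishingKernel G C) (hβ : 0 < β)
    (hfac : ∀ z, G z = |(z.1 : ℝ) - z.2| ^ β * g z) (hg : Continuous g) {K : Set S}
    (hK : IsCompact K) (hgpos : ∀ z ∈ K ×ˢ K, 0 < g z) (hμK : (μ : Measure S) Kᶜ = 0) {M : ℝ≥0}
    (hμM : (μ : Measure S) ≤ M • Measure.comap ((↑) : S → ℝ) volume) :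
    kernelEnergy G C μ ≠ ⊤ := by
  have hlog : ContinuousOn (fun z => Real.log (g z)) (K ×ˢ K) :=
    hg.continuousOn.log fun z hz => (hgpos z hz).ne'
  obtain ⟨R, hR⟩ := (hK.prod hK).exists_bound_of_continuousOn hlog
  set c := ∫⁻ v : ℝ, ENNReal.ofReal (-Real.log |v|)
  have hc : c ≠ ⊤ := lintegral_ofReal_neg_log_abs_ne_top
  have hsing : ∀ x : S, ∀ᵐ y : S ∂(μ : Measure S), (x : ℝ) ≠ y := fun x => by
    refine ae_iff.2 (le_antisymm ((Measure.le_iff'.1 hμM _).trans (le_of_eq ?_)) zero_le)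
    rw [Measure.smul_apply, comap_subtype_coe_apply hS]
    have : volume ((↑) '' {y : S | ¬ (x : ℝ) ≠ y} : Set ℝ) = 0 := by
      refine measure_mono_null (t := {(x : ℝ)}) ?_ (by simp)
      rintro _ ⟨y, hy, rfl⟩
      simpa using (not_not.1 hy).symm
    rw [this, smul_zero]
  have hKae : ∀ᵐ x ∂(μ : Measure S), x ∈ K := hμK
  -- The potential of a density bounded by `M` is bounded uniformly in `x`, because the integral of
  -- the positive part of `-log |x - y|` over the line does not depend on `x`.
  have hinner : ∀ x ∈ K, ∫⁻ y, gapLog G C (x, y) ∂(μ : Measure S) ≤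
      ENNReal.ofReal (C + R) + M * (ENNReal.ofReal β * c) := fun x hx => by
    calc ∫⁻ y, gapLog G C (x, y) ∂(μ : Measure S)
        ≤ ∫⁻ y, (ENNReal.ofReal (C + R) +
          ENNReal.ofReal β * ENNReal.ofReal (-Real.log |(x : ℝ) - y|)) ∂(μ : Measure S) := by
          refine lintegral_mono_ae ?_
          filter_upwards [hKae, hsing x] with y hy hxy
          obtain ⟨h1, h2⟩ := log_kernel_eq hfac hgpos (z := (x, y)) ⟨hx, hy⟩ hxy
          rw [gapLog_of_pos hG.nonneg h1, h2, ← ENNReal.ofReal_mul hβ.le]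
          refine le_trans (ENNReal.ofReal_le_ofReal ?_) ENNReal.ofReal_add_le
          have := neg_le_of_abs_le (hR (x, y) ⟨hx, hy⟩)
          linarith
      _ = ENNReal.ofReal (C + R) + ENNReal.ofReal β *
          ∫⁻ y : S, ENNReal.ofReal (-Real.log |(x : ℝ) - y|) ∂(μ : Measure S) := by
          rw [lintegral_add_left measurable_const, lintegral_const, measure_univ, mul_one,
            lintegral_const_mul _ (by fun_prop)]
      _ ≤ ENNReal.ofReal (C + R) + ENNReal.ofReal β * (M * c) := by
          gcongr
          calc ∫⁻ y : S, ENNReal.ofReal (-Real.log |(x : ℝ) - y|) ∂(μ : Measure S)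
              ≤ ∫⁻ y : S, ENNReal.ofReal (-Real.log |(x : ℝ) - y|)
                ∂(M • Measure.comap ((↑) : S → ℝ) volume) := lintegral_mono' hμM le_rfl
            _ = M * ∫⁻ y in S, ENNReal.ofReal (-Real.log |(x : ℝ) - y|) := by
                rw [lintegral_smul_measure, lintegral_subtype_comap hS
                  fun y : ℝ => ENNReal.ofReal (-Real.log |(x : ℝ) - y|)]
                rfl
            _ ≤ M * c := by
                refine mul_le_mul_right ?_ _
                exact (setLIntegral_le_lintegral _ _).trans_eq
                  (lintegral_ofReal_neg_log_abs_sub _)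
      _ = _ := by ring
  rw [kernelEnergy, lintegral_prod _ (measurable_gapLog hG.continuous.measurable).aemeasurable]
  refine ne_top_of_le_ne_top (b := ENNReal.ofReal (C + R) + M * (ENNReal.ofReal β * c)) ?_ ?_
  · finiteness
  · refine (lintegral_mono_ae (hKae.mono hinner)).trans_eq ?_
    rw [lintegral_const, measure_univ, mul_one]

/-- Smoothing at small scales increases the energy by little. -/
theorem eventually_kernelEnergy_smoothedMeasure_le (hG : VanishingKernel G C) (hβ : 0 < β)
    (hfac : ∀ z, G z = |(z.1 : ℝ) - z.2| ^ β * g z) (hg : Continuous g)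
    (hf : Measurable f) (hfS : ∀ x : S, f x = x) (hr : 0 < r)
    (hA : Metric.cthickening r A ⊆ S) {K : Set S} (hK : IsCompact K)
    (hAK : ∀ x : S, (x : ℝ) ∈ Metric.cthickening r A → x ∈ K)
    (hgpos : ∀ z ∈ K ×ˢ K, 0 < g z) (hμ : ∀ᵐ x : S ∂(μ : Measure S), (x : ℝ) ∈ A)
    (hμE : kernelEnergy G C μ ≠ ⊤) {δ : ℝ≥0∞} (hδ : δ ≠ 0) :
    ∀ᶠ ε in 𝓝[>] (0 : ℝ),
      kernelEnergy G C (smoothedMeasure hf ε μ) ≤ kernelEnergy G C μ + δ := by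
  have hlog : ContinuousOn (fun z => Real.log (g z)) (K ×ˢ K) :=
    hg.continuousOn.log fun z hz => (hgpos z hz).ne'
  have hunif := (hK.prod hK).uniformContinuousOn_of_continuous hlog
  -- `δ'` bounds the oscillation of `log g` on nearby pairs, and `-β log (1 - θ)` is the loss for
  -- pairs at distance at least `ε/θ`. Both are fixed before `ε`.
  obtain ⟨θ, δ', hθ0, hθ1, hδ'0, hθδ⟩ : ∃ θ δ' : ℝ, 0 < θ ∧ θ < 1 ∧ 0 < δ' ∧
      ENNReal.ofReal (δ' - β * Real.log (1 - θ)) < δ := by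
    have hlim : Tendsto (fun t : ℝ => ENNReal.ofReal (t - β * Real.log (1 - t))) (𝓝[>] 0)
        (𝓝 0) := by
      have h1 : ContinuousAt (fun t : ℝ => t - β * Real.log (1 - t)) 0 := by
        refine continuousAt_id.sub (continuousAt_const.mul (ContinuousAt.log ?_ (by simp)))
        fun_prop
      have h2 := (ENNReal.tendsto_ofReal h1.tendsto).mono_left
        (nhdsWithin_le_nhds (s := Ioi 0))
      simpa using h2
    obtain ⟨t, ht, ht0⟩ := ((hlim.eventually (Iio_mem_nhds (pos_iff_ne_zero.2 hδ))).and
      (Ioo_mem_nhdsGT one_pos)).exists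
    exact ⟨t, t, ht0.1, ht0.2, ht0.1, ht⟩
  obtain ⟨τ, hτ0, hτ⟩ := Metric.uniformContinuousOn_iff.1 hunif δ' hδ'0
  set c := ∫⁻ v : ℝ, ENNReal.ofReal (-Real.log |v|)
  have hc : c ≠ ⊤ := lintegral_ofReal_neg_log_abs_ne_top
  -- The loss for pairs closer than `ε/θ`: possibly large, but finite and independent of `ε`.
  set cθ : ℝ≥0∞ := ENNReal.ofReal (δ' - β * Real.log θ) + ENNReal.ofReal β * c
  have hcθ : cθ ≠ ⊤ := by finiteness
  set μ2 := (μ : Measure S).prod (μ : Measure S)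
  let Δ : ℝ → Set (S × S) := fun ε => {z | |(z.1 : ℝ) - z.2| < ε / θ}
  have hΔm : ∀ ε, MeasurableSet (Δ ε) := fun ε =>
    measurableSet_lt (by fun_prop) measurable_const
  -- The near-diagonal sets shrink to the diagonal, which is null by finiteness of the energy.
  have hΔ : Tendsto (fun ε => cθ * μ2 (Δ ε)) (𝓝[>] 0) (𝓝 0) := by
    have h1 := tendsto_measure_biInter_gt (μ := μ2) (s := Δ) (a := 0)
      (fun ε _ => (hΔm ε).nullMeasurableSet)
      (fun i j _ hij z hz => lt_of_lt_of_le hz (div_le_div_of_nonneg_right hij hθ0.le))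
      ⟨1, one_pos, measure_ne_top _ _⟩
    have h2 : μ2 (⋂ ε > 0, Δ ε) = 0 := by
      refine measure_mono_null (fun z hz => ?_) (ae_iff.1 (hG.ae_pos hμE))
      have hz' : |(z.1 : ℝ) - z.2| = 0 := by
        refine le_antisymm (le_of_forall_pos_lt_add fun ε hε => ?_) (abs_nonneg _)
        have := mem_iInter₂.1 hz (ε * θ) (by positivity)
        simpa [Δ, mul_div_cancel_right₀ _ hθ0.ne'] using this
      have hz2 : z.1 = z.2 := Subtype.ext (sub_eq_zero.1 (abs_eq_zero.1 hz'))
      obtain ⟨a, b⟩ := z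
      simp only at hz2
      subst hz2
      simp [hG.diag]
    rw [h2] at h1
    simpa using ENNReal.Tendsto.const_mul h1 (Or.inr hcθ)
  have hbound : ∀ ε, 0 < ε → ε ≤ r → ε < τ → kernelEnergy G C (smoothedMeasure hf ε μ) ≤
      kernelEnergy G C μ + (ENNReal.ofReal (δ' - β * Real.log (1 - θ)) + cθ * μ2 (Δ ε)) := by
    intro ε hε hεr hετ
    have hmem : ∀ x : S, (x : ℝ) ∈ A → ∀ s ∈ Icc (0 : ℝ) 1,
        f (x + ε * s) ∈ K ∧ (f (x + ε * s) : ℝ) = x + ε * s ∧ dist (f (x + ε * s)) x < τ := by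
      intro x hx s hs
      have h1 := add_mul_mem_cthickening hx hε.le hεr hs
      have h2 := coe_retraction hfS (hA h1)
      refine ⟨hAK _ (by rwa [h2]), h2, ?_⟩
      rw [Subtype.dist_eq, h2, Real.dist_eq, add_sub_cancel_left,
        abs_of_nonneg (mul_nonneg hε.le hs.1)]
      exact (mul_le_of_le_one_right hε.le hs.2).trans_lt hετ
    have hmem0 : ∀ x : S, (x : ℝ) ∈ A → x ∈ K := fun x hx =>
      hAK x (Metric.self_subset_cthickening A hx)
    have hgm : Measurable (gapLog G C) := measurable_gapLog hG.continuous.measurable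
    -- Averaging over the second shift alone already removes the singularity, uniformly in the first
    -- shift `s`.
    have hinner : ∀ x y : S, (x : ℝ) ∈ A → (y : ℝ) ∈ A → (x : ℝ) ≠ y → ∀ s ∈ Icc (0 : ℝ) 1,
        ∫⁻ t, gapLog G C (f (x + ε * s), f (y + ε * t)) ∂uniformUnit ≤
          gapLog G C (x, y) + (ENNReal.ofReal (δ' - β * Real.log (1 - θ)) +
            (Δ ε).indicator (fun _ => cθ) (x, y)) := by
      intro x y hx hy hxy s hs
      have hne : ∀ᵐ t ∂uniformUnit, (x : ℝ) + ε * s ≠ y + ε * t := by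
        refine ae_restrict_of_ae ?_
        have : ∀ᵐ t : ℝ, t ≠ ((x : ℝ) + ε * s - y) / ε := by simp [ae_iff]
        filter_upwards [this] with t ht h
        apply ht
        field_simp
        linarith
      calc ∫⁻ t, gapLog G C (f (x + ε * s), f (y + ε * t)) ∂uniformUnit
          ≤ ∫⁻ t, (gapLog G C (x, y) + ENNReal.ofReal (δ' + β * (Real.log |(x : ℝ) - y| -
              Real.log |((x : ℝ) - y) + ε * (s - t)|))) ∂uniformUnit := by
            refine lintegral_mono_ae ?_
            filter_upwards [hne, ae_uniformUnit_mem] with t ht ht01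
            obtain ⟨hx1, hx2, hx3⟩ := hmem x hx s hs
            obtain ⟨hy1, hy2, hy3⟩ := hmem y hy t ht01
            have hzK : (x, y) ∈ K ×ˢ K := ⟨hmem0 x hx, hmem0 y hy⟩
            have hzK' : (f (x + ε * s), f (y + ε * t)) ∈ K ×ˢ K := ⟨hx1, hy1⟩
            obtain ⟨a1, a2⟩ := log_kernel_eq hfac hgpos hzK hxy
            obtain ⟨b1, b2⟩ := log_kernel_eq hfac hgpos hzK'
              (by simp only [hx2, hy2]; exact ht)
            rw [gapLog_of_pos hG.nonneg a1, gapLog_of_pos hG.nonneg b1, a2, b2]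
            refine le_trans (ENNReal.ofReal_le_ofReal ?_) ENNReal.ofReal_add_le
            have h3 := hτ _ hzK' _ hzK (max_lt hx3 hy3)
            rw [Real.dist_eq, abs_lt] at h3
            simp only [hx2, hy2]
            rw [show (x : ℝ) + ε * s - (y + ε * t) = (x - y) + ε * (s - t) by ring]
            linarith [h3.1]
        _ = gapLog G C (x, y) + ∫⁻ t in Icc (0 : ℝ) 1, ENNReal.ofReal (δ' + β *
              (Real.log |(x : ℝ) - y| - Real.log |((x : ℝ) - y) + ε * (s - t)|)) := by
            rw [lintegral_add_left measurable_const, lintegral_const, measure_univ, mul_one]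
            rfl
        _ ≤ _ := by
            refine add_le_add le_rfl ?_
            exact lintegral_log_sub_log_le (sub_ne_zero.2 hxy) hε hs hθ0 hθ1 hβ
    have hT : Measurable fun q : S × ℝ => f (q.1 + ε * q.2) := by fun_prop
    have hgT : ∀ a : S, Measurable fun q : S × ℝ => gapLog G C (a, f (q.1 + ε * q.2)) := fun a =>
      hgm.comp (measurable_const.prodMk hT)
    have hga : ∀ a : S, Measurable fun y => gapLog G C (a, y) := fun a =>
      hgm.comp measurable_prodMk_left
    have e1 : kernelEnergy G C (smoothedMeasure hf ε μ) =
        ∫⁻ p, ∫⁻ y, ∫⁻ t, gapLog G C (f (p.1 + ε * p.2), f (y + ε * t))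
          ∂uniformUnit ∂(μ : Measure S) ∂((μ : Measure S).prod uniformUnit) := by
      rw [kernelEnergy, lintegral_prod _ hgm.aemeasurable, coe_smoothedMeasure,
        lintegral_map hgm.lintegral_prod_right' hT]
      refine lintegral_congr fun p => ?_
      rw [lintegral_map (hga _) hT,
        lintegral_prod _ (hgT _).aemeasurable]
    set Ψ : S × S → ℝ≥0∞ := fun z => gapLog G C z +
      (ENNReal.ofReal (δ' - β * Real.log (1 - θ)) + (Δ ε).indicator (fun _ => cθ) z) with hΨ
    have hΨm : Measurable Ψ :=
      hgm.add ((measurable_const.indicator (hΔm ε)).const_add _)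
    have hsing : ∀ x : S, ∀ᵐ y : S ∂(μ : Measure S), (x : ℝ) ≠ y := fun x => by
      refine ae_iff.2 (measure_mono_null (fun y hy => ?_) (hG.measure_singleton_eq_zero hμE x))
      exact (Subtype.ext (not_not.1 hy)).symm
    have h1 : ∀ᵐ q ∂(μ : Measure S).prod uniformUnit, (q.1 : ℝ) ∈ A :=
      Measure.quasiMeasurePreserving_fst.ae (p := fun x : S => (x : ℝ) ∈ A) hμ
    have h2 : ∀ᵐ q ∂(μ : Measure S).prod uniformUnit, q.2 ∈ Icc (0 : ℝ) 1 :=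
      Measure.quasiMeasurePreserving_snd.ae ae_uniformUnit_mem
    calc kernelEnergy G C (smoothedMeasure hf ε μ)
        ≤ ∫⁻ p, ∫⁻ y, Ψ (p.1, y) ∂(μ : Measure S) ∂((μ : Measure S).prod uniformUnit) := by
          rw [e1]
          refine lintegral_mono_ae ?_
          filter_upwards [h1, h2] with p hp1 hp2
          refine lintegral_mono_ae ?_
          filter_upwards [hμ, hsing p.1] with y hy hxy
          exact hinner p.1 y hp1 hy hxy p.2 hp2
      _ = ∫⁻ x, ∫⁻ y, Ψ (x, y) ∂(μ : Measure S) ∂(μ : Measure S) := by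
          have hm : Measurable fun x : S => ∫⁻ y, Ψ (x, y) ∂(μ : Measure S) :=
            hΨm.lintegral_prod_right'
          have hm' : Measurable fun p : S × ℝ => ∫⁻ y, Ψ (p.1, y) ∂(μ : Measure S) :=
            hm.comp measurable_fst
          rw [lintegral_prod _ hm'.aemeasurable]
          simp
      _ = ∫⁻ z, Ψ z ∂μ2 := (lintegral_prod _ hΨm.aemeasurable).symm
      _ = _ := by
          rw [lintegral_add_left hgm, lintegral_add_left measurable_const,
            lintegral_indicator (hΔm ε), lintegral_const, setLIntegral_const, measure_univ,
            mul_one]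
          rfl
  have hlim : Tendsto (fun ε => ENNReal.ofReal (δ' - β * Real.log (1 - θ)) + cθ * μ2 (Δ ε))
      (𝓝[>] 0) (𝓝 (ENNReal.ofReal (δ' - β * Real.log (1 - θ)))) := by
    simpa using tendsto_const_nhds.add hΔ
  filter_upwards [hlim.eventually (Iio_mem_nhds hθδ), Ioc_mem_nhdsGT hr, Ioo_mem_nhdsGT hτ0]
    with ε h1 h2 h3
  exact (hbound ε h2.1 h2.2 h3.2).trans (add_le_add le_rfl (le_of_lt h1))

end SmoothingEnergy

/-! ### Approximation by tame measures -/

/-- A probability measure with bounded density and compact support away from the zeros of `w`. -/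
def IsTame {S : Set ℝ} (w : S → ℝ) (ν : ProbabilityMeasure S) : Prop :=
  ∃ K : Set S, IsCompact K ∧ (∀ x ∈ K, w x ≠ 0) ∧ (ν : Measure S) Kᶜ = 0 ∧
    ∃ M : ℝ≥0, (ν : Measure S) ≤ M • Measure.comap ((↑) : S → ℝ) volume

section Factor

variable {S : Set ℝ} {β a C : ℝ} {γ : ℕ} {w : S → ℝ}

/-- The part of the interaction kernel that does not vanish on the diagonal. -/
noncomputable def kernelFactor (β a : ℝ) (γ : ℕ) (w : S → ℝ) (z : S × S) : ℝ :=
  |∑ i ∈ Finset.range γ, (z.1 : ℝ) ^ i * (z.2 : ℝ) ^ (γ - 1 - i)| ^ β * (w z.1 * w z.2) ^ a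

theorem interactionKernel_eq_mul_kernelFactor (z : S × S) :
    interactionKernel β a γ w z = |(z.1 : ℝ) - z.2| ^ β * kernelFactor β a γ w z := by
  rw [interactionKernel, kernelFactor, ← geom_sum₂_mul, abs_mul,
    Real.mul_rpow (abs_nonneg _) (abs_nonneg _)]
  ring

theorem continuous_kernelFactor (hβ : 0 < β) (ha : 0 < a) (hw : Continuous w) :
    Continuous (kernelFactor β a γ w) := by
  refine Continuous.mul ?_ ?_
  · exact Continuous.rpow_const (by fun_prop) fun _ => Or.inr hβ.le
  · exact Continuous.rpow_const (by fun_prop) fun _ => Or.inr ha.le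

theorem pow_injective_of_even_subset (hγ : 0 < γ) (hγS : Even γ → S ⊆ Ici 0) {x y : ℝ} (hx : x ∈ S)
    (hy : y ∈ S) (h : x ^ γ = y ^ γ) : x = y := by
  rcases Nat.even_or_odd γ with he | ho
  · exact (pow_left_inj₀ (hγS he hx) (hγS he hy) hγ.ne').1 h
  · exact ho.strictMono_pow.injective h

/-- If the geometric sum vanished, then `x^γ = y^γ`, hence `x = y` by injectivity of the power on
`S`. The sum would then be `γ x^(γ-1)`, which is nonzero away from the origin; this is why the
origin is removed from the regular points. -/
theorem kernelFactor_pos (hγ : 0 < γ) (hγS : Even γ → S ⊆ Ici 0)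
    (hw : ∀ x, 0 ≤ w x) {z : S × S} (h1 : (z.1 : ℝ) ≠ 0) (hw1 : w z.1 ≠ 0) (hw2 : w z.2 ≠ 0) :
    0 < kernelFactor β a γ w z := by
  refine mul_pos (Real.rpow_pos_of_pos (abs_pos.2 ?_) _) (Real.rpow_pos_of_pos (mul_pos
    ((hw _).lt_of_ne' hw1) ((hw _).lt_of_ne' hw2)) _)
  intro h0
  have h2 := geom_sum₂_mul (z.1 : ℝ) (z.2 : ℝ) γ
  rw [h0, zero_mul] at h2
  have h3 : (z.1 : ℝ) = z.2 :=
    pow_injective_of_even_subset hγ hγS z.1.2 z.2.2 (sub_eq_zero.1 h2.symm)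
  rw [← h3, geom_sum₂_self] at h0
  rcases mul_eq_zero.1 h0 with h | h
  · exact hγ.ne' (by exact_mod_cast h)
  · exact pow_ne_zero _ h1 h

end Factor

section Approximation

variable {S : Set ℝ} {w : S → ℝ}

/-- The interior of `S` without the zeros of `w` and without the origin. -/
def regularPoints (w : S → ℝ) : Set ℝ :=
  interior S \ ((↑) '' {x | w x = 0} ∪ {0})

theorem isOpen_regularPoints (hw : {x | w x = 0}.Finite) : IsOpen (regularPoints w) :=
  isOpen_interior.sdiff ((hw.image _).union (finite_singleton 0)).isClosed

theorem regularPoints_subset : regularPoints w ⊆ S :=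
  sdiff_subset.trans interior_subset

theorem ne_zero_of_mem_regularPoints {x : S} (hx : (x : ℝ) ∈ regularPoints w) :
    w x ≠ 0 ∧ (x : ℝ) ≠ 0 :=
  ⟨fun h => hx.2 (Or.inl ⟨x, h, rfl⟩), fun h => hx.2 (Or.inr h)⟩

theorem mem_interior_of_lt_of_lt (hS : S.OrdConnected) {a x b : ℝ} (ha : a ∈ S) (hb : b ∈ S)
    (hax : a < x) (hxb : x < b) : x ∈ interior S :=
  mem_interior_iff_mem_nhds.2 (mem_of_superset (Icc_mem_nhds hax hxb) (hS.out ha hb))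

theorem regularPoints_nonempty (hS : S.OrdConnected) (hS' : S.Nontrivial)
    (hw : {x | w x = 0}.Finite) : (regularPoints w).Nonempty := by
  obtain ⟨a, ha, b, hb, hab⟩ := hS'.exists_lt
  have h1 : (Ioo a b).Infinite := Ioo_infinite hab
  obtain ⟨x, hx, hx'⟩ := (h1.sdiff ((hw.image _).union (finite_singleton 0))).nonempty
  exact ⟨x, mem_interior_of_lt_of_lt hS ha hb hx.1 hx.2, hx'⟩

/-- The exceptions are at most two endpoints, the zeros of `w` and the origin. -/
theorem finite_compl_regularPoints (hS : S.OrdConnected) (hw : {x | w x = 0}.Finite) :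
    {x : S | (x : ℝ) ∉ regularPoints w}.Finite := by
  have h1 : {x : S | ∀ y ∈ S, (x : ℝ) ≤ y}.Subsingleton := fun x hx y hy =>
    Subtype.ext (le_antisymm (hx y y.2) (hy x x.2))
  have h2 : {x : S | ∀ y ∈ S, y ≤ (x : ℝ)}.Subsingleton := fun x hx y hy =>
    Subtype.ext (le_antisymm (hy x x.2) (hx y y.2))
  have h3 : {x : S | (x : ℝ) = 0}.Subsingleton := fun x hx y hy =>
    Subtype.ext (hx.trans (Eq.symm hy))
  refine ((h1.finite.union h2.finite).union (hw.union h3.finite)).subset fun x hx => ?_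
  by_contra hcon
  simp only [mem_union, mem_ofPred_eq, not_or, not_forall, not_le] at hcon
  obtain ⟨⟨⟨a, ha, hax⟩, ⟨b, hb, hxb⟩⟩, hwx, hx0⟩ := hcon
  refine hx ⟨mem_interior_of_lt_of_lt hS ha hb hax hxb, ?_⟩
  rintro (⟨y, hy, hyx⟩ | h)
  · exact hwx (by rw [← Subtype.ext hyx]; exact hy)
  · exact hx0 h

theorem exists_measurable_retraction [Nonempty S] (hS : MeasurableSet S) :
    ∃ f : ℝ → S, Measurable f ∧ ∀ x : S, f x = x := by
  obtain ⟨f, hf, hfS⟩ := (MeasurableEmbedding.subtype_coe hS).exists_measurable_extend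
    (measurable_id (α := S)) fun _ => ‹Nonempty S›
  exact ⟨f, hf, fun x => congrFun hfS x⟩

variable {β a C : ℝ} {γ : ℕ}

/-- Smoothing a point mass at a regular point gives a uniform law on a short interval. It shows that
the energy is not identically infinite. -/
theorem exists_isTame [Nonempty S] (hS : IsClosed S) (hSo : S.OrdConnected) (hS' : S.Nontrivial)
    (hβ : 0 < β) (ha : 0 < a) (hγ : 0 < γ) (hγS : Even γ → S ⊆ Ici 0) (hwc : Continuous w)
    (hw0 : ∀ x, 0 ≤ w x) (hwf : {x | w x = 0}.Finite)
    (hG : VanishingKernel (interactionKernel β a γ w) C) :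
    ∃ ν : ProbabilityMeasure S, IsTame w ν ∧
      kernelEnergy (interactionKernel β a γ w) C ν ≠ ⊤ := by
  obtain ⟨x₀, hx₀⟩ := regularPoints_nonempty hSo hS' hwf
  obtain ⟨r, hr, hrU⟩ := (isCompact_singleton (x := x₀)).exists_cthickening_subset_open
    (isOpen_regularPoints hwf) (singleton_subset_iff.2 hx₀)
  have hrS : Metric.cthickening r {x₀} ⊆ S := hrU.trans regularPoints_subset
  obtain ⟨f, hf, hfS⟩ := exists_measurable_retraction hS.measurableSet
  have hK : IsCompact ((↑) ⁻¹' Metric.cthickening r {x₀} : Set S) :=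
    hS.isClosedEmbedding_subtypeVal.isCompact_preimage isCompact_singleton.cthickening
  have hKU : ∀ x ∈ ((↑) ⁻¹' Metric.cthickening r {x₀} : Set S), w x ≠ 0 ∧ (x : ℝ) ≠ 0 :=
    fun x hx => ne_zero_of_mem_regularPoints (hrU hx)
  let μ : ProbabilityMeasure S := ⟨Measure.dirac ⟨x₀, regularPoints_subset hx₀⟩, inferInstance⟩
  have hμ : ∀ᵐ x : S ∂(μ : Measure S), (x : ℝ) ∈ ({x₀} : Set ℝ) := by
    change ∀ᵐ x : S ∂(Measure.dirac _), _
    rw [ae_dirac_iff]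
    · rfl
    · exact (measurableSet_singleton x₀).preimage measurable_subtype_coe
  have h1 := smoothedMeasure_compl_eq_zero hf hfS hrS hμ hr.le le_rfl
  have h2 := smoothedMeasure_le hS.measurableSet hf hfS hrS hμ hr le_rfl
  refine ⟨smoothedMeasure hf r μ, ⟨_, hK, fun x hx => (hKU x hx).1, h1, _, h2⟩, ?_⟩
  exact kernelEnergy_ne_top_of_le hS.measurableSet hG hβ interactionKernel_eq_mul_kernelFactor
    (continuous_kernelFactor hβ ha hwc) hK (fun z hz => kernelFactor_pos hγ hγS hw0
      (hKU _ hz.1).2 (hKU _ hz.1).1 (hKU _ hz.2).1) h1 h2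

/-- Tame measures are dense, in the weak topology and in energy. -/
theorem exists_isTame_mem [Nonempty S] (hS : IsClosed S) (hSo : S.OrdConnected)
    (hβ : 0 < β) (ha : 0 < a) (hγ : 0 < γ) (hγS : Even γ → S ⊆ Ici 0) (hwc : Continuous w)
    (hw0 : ∀ x, 0 ≤ w x) (hwf : {x | w x = 0}.Finite)
    (hG : VanishingKernel (interactionKernel β a γ w) C) {μ : ProbabilityMeasure S}
    (hμ : kernelEnergy (interactionKernel β a γ w) C μ ≠ ⊤) {O : Set (ProbabilityMeasure S)}
    (hO : IsOpen O) (hμO : μ ∈ O) {δ : ℝ≥0∞} (hδ : δ ≠ 0) (hδ' : δ ≠ ⊤) :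
    ∃ ν ∈ O, IsTame w ν ∧ kernelEnergy (interactionKernel β a γ w) C ν ≤
      kernelEnergy (interactionKernel β a γ w) C μ + δ := by
  set G := interactionKernel β a γ w
  have hδ2 : δ / 2 ≠ 0 := (ENNReal.half_pos hδ).ne'
  have hU := isOpen_regularPoints hwf
  -- The irregular points are finite in number and `μ` has no atoms.
  have hμU : (μ : Measure S).map (↑) (regularPoints w) = 1 := by
    rw [Measure.map_apply measurable_subtype_coe hU.measurableSet,
      ← prob_compl_eq_zero_iff (hU.measurableSet.preimage measurable_subtype_coe)]
    have hfin := finite_compl_regularPoints hSo hwf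
    refine measure_mono_null (t := ⋃ x ∈ {x : S | (x : ℝ) ∉ regularPoints w}, {x})
      (fun x hx => by simpa using hx) ?_
    exact (measure_biUnion_null_iff hfin.countable).2 fun x _ =>
      hG.measure_singleton_eq_zero hμ x
  obtain ⟨u, -, hu, hu1⟩ := exists_seq_strictMono_tendsto' (zero_lt_one (α := ℝ≥0∞))
  have hex : ∀ n, ∃ A ⊆ regularPoints w, IsCompact A ∧ u n < (μ : Measure S).map (↑) A := fun n =>
    hU.exists_lt_isCompact (by rw [hμU]; exact (hu n).2)
  choose A hAU hAc hAu using hex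
  have hAm : ∀ n, MeasurableSet ((↑) ⁻¹' A n : Set S) := fun n =>
    (hAc n).measurableSet.preimage measurable_subtype_coe
  have hlim : Tendsto (fun n => (μ : Measure S) ((↑) ⁻¹' A n)) atTop (𝓝 1) := by
    refine tendsto_of_tendsto_of_tendsto_of_le_of_le hu1 tendsto_const_nhds (fun n => ?_)
      fun n => prob_le_one
    have := (hAu n).le
    rwa [Measure.map_apply measurable_subtype_coe (hAc n).measurableSet] at this
  obtain ⟨n, ν, hνO, hνA, hνE⟩ :=
    exists_mem_nhds_of_tendsto_measure_one hμ hAm hlim (hO.mem_nhds hμO) hδ2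
  have hνE' : kernelEnergy G C ν ≠ ⊤ := ne_top_of_le_ne_top
    (ENNReal.add_ne_top.2 ⟨hμ, ne_top_of_le_ne_top hδ' ENNReal.half_le_self⟩) hνE
  -- A compact set of regular points leaves room for shifts up to `r`. Half of `δ` was spent on
  -- conditioning, the other half goes to smoothing.
  obtain ⟨r, hr, hrU⟩ := (hAc n).exists_cthickening_subset_open hU (hAU n)
  have hrS : Metric.cthickening r (A n) ⊆ S := hrU.trans regularPoints_subset
  obtain ⟨f, hf, hfS⟩ := exists_measurable_retraction hS.measurableSet
  have hK : IsCompact ((↑) ⁻¹' Metric.cthickening r (A n) : Set S) :=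
    hS.isClosedEmbedding_subtypeVal.isCompact_preimage (hAc n).cthickening
  have hKU : ∀ x ∈ ((↑) ⁻¹' Metric.cthickening r (A n) : Set S), w x ≠ 0 ∧ (x : ℝ) ≠ 0 :=
    fun x hx => ne_zero_of_mem_regularPoints (hrU hx)
  have hνae : ∀ᵐ x : S ∂(ν : Measure S), (x : ℝ) ∈ A n := hνA
  have h1 := eventually_kernelEnergy_smoothedMeasure_le hG hβ
    interactionKernel_eq_mul_kernelFactor (continuous_kernelFactor hβ ha hwc) hf hfS hr hrS hK
    (fun x hx => hx) (fun z hz => kernelFactor_pos hγ hγS hw0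
      (hKU _ hz.1).2 (hKU _ hz.1).1 (hKU _ hz.2).1) hνae hνE' hδ2
  have h2 := (tendsto_smoothedMeasure hf hfS hr hrS hνae).eventually (hO.mem_nhds hνO)
  obtain ⟨ε, hε1, hε2, hε3⟩ := (h1.and (h2.and (Ioc_mem_nhdsGT hr))).exists
  refine ⟨smoothedMeasure hf ε ν, hε2, ⟨_, hK, fun x hx => (hKU x hx).1,
    smoothedMeasure_compl_eq_zero hf hfS hrS hνae hε3.1.le hε3.2, _,
    smoothedMeasure_le hS.measurableSet hf hfS hrS hνae hε3.1 hε3.2⟩, hε1.trans ?_⟩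
  calc kernelEnergy G C ν + δ / 2 ≤ kernelEnergy G C μ + δ / 2 + δ / 2 := by gcongr
    _ = kernelEnergy G C μ + δ := by rw [add_assoc, ENNReal.add_halves]

end Approximation

/-! ### Lower bound for the ensemble -/

theorem sigmaFinite_comap_subtype_coe {S : Set ℝ} (hS : MeasurableSet S) :
    SigmaFinite (Measure.comap ((↑) : S → ℝ) volume) := by
  refine SigmaFinite.of_map _ measurable_subtype_coe.aemeasurable ?_
  rw [map_comap_subtype_coe hS]
  infer_instance

section LowerBound

variable {S : Set ℝ} {β κ C : ℝ} {γ : ℕ} {v : ℕ → S → ℝ} {w : S → ℝ}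

theorem integrable_const_sub_log_kernel {X : Type*} [TopologicalSpace X] [MeasurableSpace X]
    [BorelSpace X] [SecondCountableTopology X] {G : X × X → ℝ} (hG : VanishingKernel G C)
    {μ : ProbabilityMeasure X} (hμ : kernelEnergy G C μ ≠ ⊤) :
    Integrable (fun z => Real.log (G z)) ((μ : Measure X).prod (μ : Measure X)) ∧
      (kernelEnergy G C μ).toReal =
        C - ∫ z, Real.log (G z) ∂((μ : Measure X).prod (μ : Measure X)) := by
  have hpos := hG.ae_pos hμ
  have hnn : ∀ᵐ z ∂((μ : Measure X).prod (μ : Measure X)), 0 ≤ C - Real.log (G z) := by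
    filter_upwards [hpos] with z hz
    rw [sub_nonneg, Real.log_le_iff_le_exp hz]
    linarith [hG.add_one_le z]
  have hm : Measurable fun z => C - Real.log (G z) := by
    have := hG.continuous.measurable
    fun_prop
  have heq : kernelEnergy G C μ =
      ∫⁻ z, ENNReal.ofReal (C - Real.log (G z)) ∂((μ : Measure X).prod (μ : Measure X)) :=
    lintegral_congr_ae (hpos.mono fun z hz => gapLog_of_pos hG.nonneg hz)
  have hi : Integrable (fun z => C - Real.log (G z))
      ((μ : Measure X).prod (μ : Measure X)) := by
    refine ⟨hm.aestronglyMeasurable, ?_⟩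
    rw [hasFiniteIntegral_iff_ofReal hnn, ← heq]
    exact hμ.lt_top
  have hi2 : Integrable (fun z => Real.log (G z)) ((μ : Measure X).prod (μ : Measure X)) := by
    refine ((integrable_const C).sub hi).congr (ae_of_all _ fun z => ?_)
    simp
  refine ⟨hi2, ?_⟩
  rw [heq, ← integral_eq_lintegral_of_nonneg_ae hnn hm.aestronglyMeasurable,
    integral_sub (integrable_const C) hi2]
  simp

/-- The gap between the upper bound and the mean of the log-density is `O(n²)`, just like the
tolerated error, so the exceptional event only needs probability below a constant. The alternative
for `k` is what remains of integrality; it gives `|k(k-1)/2| ≤ k²`. -/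
theorem deviation_bound {k n κ c₁ c₂ ℓ L δ : ℝ} (hk : k = 0 ∨ 1 ≤ k) (hn : 1 ≤ n)
    (hkn : k ≤ (κ + 1) * n) (hc₁ : 0 ≤ c₁) (hL : |L| ≤ c₂) :
    1 + (k ^ 2 * c₁ + k * (n * c₂)) - (k * (k - 1) / 2 * ℓ + k * (n * L)) + n ^ 2 * (δ / 2) ≤
      n ^ 2 * (1 + (κ + 1) ^ 2 * (c₁ + |ℓ|) + 2 * (κ + 1) * c₂ + δ / 2) := by
  have hk0 : 0 ≤ k := hk.elim (fun h => h.ge) fun h => by linarith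
  have hn0 : 0 ≤ n := by linarith
  have hc₂ : 0 ≤ c₂ := (abs_nonneg L).trans hL
  have hk2 : k ^ 2 ≤ (κ + 1) ^ 2 * n ^ 2 := by
    rw [← mul_pow]
    exact pow_le_pow_left₀ hk0 hkn 2
  have hkn2 : k * n ≤ (κ + 1) * n ^ 2 := by
    rw [pow_two, ← mul_assoc]
    exact mul_le_mul_of_nonneg_right hkn hn0
  have h1 : -(k * (k - 1) / 2 * ℓ) ≤ k ^ 2 * |ℓ| := by
    refine (neg_le_abs _).trans ?_
    rw [abs_mul]
    refine mul_le_mul_of_nonneg_right ?_ (abs_nonneg _)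
    rw [abs_le]
    rcases hk with rfl | h
    · norm_num
    · constructor <;> nlinarith
  have h2 : -(k * (n * L)) ≤ k * n * c₂ := by
    rw [← mul_assoc, ← mul_neg]
    exact mul_le_mul_of_nonneg_left ((neg_le_abs L).trans hL) (mul_nonneg hk0 hn0)
  have h3 := mul_le_mul_of_nonneg_right hk2 (abs_nonneg ℓ)
  have h4 := mul_le_mul_of_nonneg_right hkn2 hc₂
  have h5 := mul_le_mul_of_nonneg_right hk2 hc₁
  have h6 : 1 ≤ n ^ 2 := one_le_pow₀ hn
  linarith

/-- Under `ν^k` the mean log-density is `k(k-1)/2 * ℓ + k n ∫ log vₙ dν`. Divided by `n²` it tends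
to `κ²ℓ/2 + κ ∫ log w dν`, minus the energy of `ν`. The support of `ν` avoids the zeros of `w`, so
the logarithms of the weights converge uniformly there. -/
theorem eventually_ofReal_exp_le_unnormalizedEnsemble [Nonempty S] (hS : IsClosed S) (hβ : 0 < β)
    (hκ : 0 < κ) {p : ℕ → ℕ} (hp : Tendsto (fun n => (p n : ℝ) / (n : ℝ)) atTop (𝓝 κ))
    (hv_cont : ∀ n, Continuous (v n)) (hv_nonneg : ∀ n x, 0 ≤ v n x)
    (h_conv : WeightConvergence v w)
    (hG : VanishingKernel (interactionKernel β (1 / κ) γ w) C) {ν : ProbabilityMeasure S}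
    (hν : IsTame w ν) (hνE : kernelEnergy (interactionKernel β (1 / κ) γ w) C ν ≠ ⊤)
    {O : Set (ProbabilityMeasure S)} (hO : IsOpen O) (hνO : ν ∈ O) {δ : ℝ} (hδ : 0 < δ) :
    ∀ᶠ n : ℕ in atTop, ENNReal.ofReal (Real.exp ((n : ℝ) ^ 2 * (-(κ ^ 2 / 2 *
      ((kernelEnergy (interactionKernel β (1 / κ) γ w) C ν).toReal - C)) - δ))) ≤
      unnormalizedEnsemble β γ n (p n) (v n) (empiricalMeasure ⁻¹' O) := by
  have := sigmaFinite_comap_subtype_coe hS.measurableSet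
  obtain ⟨K, hK, hKw, hνK, M, hνM⟩ := hν
  obtain ⟨hGi, hGE⟩ := integrable_const_sub_log_kernel hG hνE
  have hGpos := hG.ae_pos hνE
  set ν2 := (ν : Measure S).prod (ν : Measure S)
  have hwc := h_conv.continuous
  have hKae : ∀ᵐ x ∂(ν : Measure S), x ∈ K := hνK
  have hKae2 : ∀ᵐ z ∂ν2, z.1 ∈ K ∧ z.2 ∈ K :=
    (Measure.quasiMeasurePreserving_fst.ae hKae).and
      (Measure.quasiMeasurePreserving_snd.ae hKae)
  have hwpos : ∀ x ∈ K, 0 < w x := fun x hx => (h_conv.nonneg x).lt_of_ne' (hKw x hx)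
  obtain ⟨cw, hcw⟩ := hK.exists_bound_of_continuousOn
    (hwc.continuousOn.log fun x hx => hKw x hx)
  have hlw : Integrable (fun x => Real.log (w x)) (ν : Measure S) :=
    Integrable.of_bound (Real.measurable_log.comp hwc.measurable).aestronglyMeasurable cw
      (hKae.mono fun x hx => hcw x hx)
  set a : S × S → ℝ := fun z => |(z.1 : ℝ) ^ γ - (z.2 : ℝ) ^ γ| ^ β with ha_def
  have ha_cont : Continuous a := Continuous.rpow_const (by fun_prop) fun _ => Or.inr hβ.le
  have ha0 : ∀ z, 0 ≤ a z := fun z => Real.rpow_nonneg (abs_nonneg _) _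
  -- `log w` is bounded on the support, so the logarithm of the bare difference factor inherits
  -- integrability from `log G`.
  have hloga : ∀ᵐ z ∂ν2, 0 < a z ∧ Real.log (a z) =
      Real.log (interactionKernel β (1 / κ) γ w z) -
        1 / κ * (Real.log (w z.1) + Real.log (w z.2)) := by
    filter_upwards [hGpos, hKae2] with z hz hzK
    have h1 := hwpos _ hzK.1
    have h2 := hwpos _ hzK.2
    have h3 : 0 < (w z.1 * w z.2) ^ (1 / κ) := Real.rpow_pos_of_pos (mul_pos h1 h2) _
    have h4 : 0 < a z := (ha0 z).lt_of_ne' fun h => by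
      have : interactionKernel β (1 / κ) γ w z = a z * (w z.1 * w z.2) ^ (1 / κ) := rfl
      rw [this, h, zero_mul] at hz
      exact lt_irrefl _ hz
    refine ⟨h4, ?_⟩
    rw [show interactionKernel β (1 / κ) γ w z = a z * (w z.1 * w z.2) ^ (1 / κ) from rfl,
      Real.log_mul h4.ne' h3.ne', Real.log_rpow (mul_pos h1 h2), Real.log_mul h1.ne' h2.ne']
    ring
  have hlw1 : Integrable (fun z : S × S => Real.log (w z.1)) ν2 := hlw.comp_fst _
  have hlw2 : Integrable (fun z : S × S => Real.log (w z.2)) ν2 := hlw.comp_snd _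
  have hlw12 : Integrable (fun z : S × S => 1 / κ * (Real.log (w z.1) + Real.log (w z.2))) ν2 :=
    (hlw1.add hlw2).const_mul _
  have ha_int : Integrable (fun z => Real.log (a z)) ν2 :=
    (hGi.sub hlw12).congr (hloga.mono fun z hz => hz.2.symm)
  set ℓ := ∫ z, Real.log (a z) ∂ν2
  set Lw := ∫ x, Real.log (w x) ∂(ν : Measure S)
  have hℓ : ℓ = ∫ z, Real.log (interactionKernel β (1 / κ) γ w z) ∂ν2 - 2 / κ * Lw := by
    simp only [ℓ]
    rw [integral_congr_ae (hloga.mono fun z hz => hz.2), integral_sub hGi hlw12,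
      integral_const_mul, integral_add hlw1 hlw2,
      integral_fun_fst (f := fun x => Real.log (w x)),
      integral_fun_snd (f := fun x => Real.log (w x))]
    simp only [probReal_univ, one_smul, Lw]
    ring
  have hEℓ : -(κ ^ 2 / 2 * ((kernelEnergy (interactionKernel β (1 / κ) γ w) C ν).toReal - C)) =
      κ * κ / 2 * ℓ + κ * Lw := by
    rw [hGE, hℓ]
    field_simp
    ring
  rw [hEℓ]
  obtain ⟨B, hB⟩ := ((hK.prod hK).image ha_cont).bddAbove
  -- The maximum with `1` makes `c₁ ≥ 0`, so that the sum over pairs can be bounded by `k² c₁`.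
  set c₁ := Real.log (max 1 B)
  have hc₁ : 0 ≤ c₁ := Real.log_nonneg (le_max_left _ _)
  have ha_le : ∀ᵐ z ∂ν2, 0 < a z ∧ Real.log (a z) ≤ c₁ := by
    filter_upwards [hloga, hKae2] with z hz hzK
    exact ⟨hz.1, Real.log_le_log hz.1
      ((hB (mem_image_of_mem a (show z ∈ K ×ˢ K from hzK))).trans (le_max_right _ _))⟩
  set c₂ := |cw| + 1
  have hlogunif := h_conv.tendsto_log K hK (disjoint_left.2 hKw)
  have hv_ev : ∀ᶠ n in atTop, ∀ x ∈ K, 0 < v n x ∧ |Real.log (v n x)| ≤ c₂ := by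
    filter_upwards [Metric.tendstoUniformlyOn_iff.1 hlogunif 1 one_pos, h_conv.zeros_subset]
      with n h1 h2 x hx
    refine ⟨(hv_nonneg n x).lt_of_ne' fun h => hKw x hx (h2 h), ?_⟩
    have h3 := h1 x hx
    have h4 := hcw x hx
    rw [Real.dist_eq, abs_sub_lt_iff] at h3
    rw [Real.norm_eq_abs, abs_le] at h4
    have := le_abs_self cw
    rw [abs_le]
    constructor <;> simp only [c₂] <;> linarith [h4.1, h4.2, h3.1, h3.2]
  have hv_meas : ∀ n, AEStronglyMeasurable (fun x => Real.log (v n x)) (ν : Measure S) := fun n =>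
    (Real.measurable_log.comp (hv_cont n).measurable).aestronglyMeasurable
  have hLv : Tendsto (fun n => ∫ x, Real.log (v n x) ∂(ν : Measure S)) atTop (𝓝 Lw) := by
    refine tendsto_integral_filter_of_dominated_convergence (fun _ => c₂)
      (Eventually.of_forall hv_meas) ?_ (integrable_const _) ?_
    · filter_upwards [hv_ev] with n hn
      exact hKae.mono fun x hx => (hn x hx).2
    · exact hKae.mono fun x hx => hlogunif.tendsto_at hx
  -- Positive, so that `M' ^ k` is the exponential of `k log M'`.
  set M' : ℝ≥0 := M + 1
  have hM' : (ν : Measure S) ≤ M' • Measure.comap ((↑) : S → ℝ) volume := by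
    refine hνM.trans (Measure.le_iff.2 fun s _ => ?_)
    simp only [Measure.smul_apply, ENNReal.smul_def, smul_eq_mul]
    gcongr
    exact le_self_add
  have hM'0 : (0 : ℝ) < M' := by positivity
  have hpn : Tendsto (fun n : ℕ => 1 / (n : ℝ)) atTop (𝓝 0) := tendsto_one_div_atTop_nhds_zero_nat
  have hmean : Tendsto (fun n : ℕ => ((p n : ℝ) / n) * ((p n : ℝ) / n - 1 / n) / 2 * ℓ +
      ((p n : ℝ) / n) * (∫ x, Real.log (v n x) ∂(ν : Measure S)) - δ / 2 -
        ((p n : ℝ) / n) * (1 / n) * Real.log M') atTop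
      (𝓝 (κ * (κ - 0) / 2 * ℓ + κ * Lw - δ / 2 - κ * 0 * Real.log M')) :=
    (((((hp.mul (hp.sub hpn)).div_const 2).mul_const ℓ).add (hp.mul hLv)).sub_const _).sub
      ((hp.mul hpn).mul_const _)
  have hkn : ∀ᶠ n : ℕ in atTop, (p n : ℝ) / n < κ + 1 := hp.eventually (Iio_mem_nhds (by linarith))
  have hAm : ∀ k, MeasurableSet ((empiricalMeasure : (Fin k → S) → ProbabilityMeasure S) ⁻¹' O) :=
    fun k => (hO.preimage continuous_empiricalMeasure).measurableSet
  have hLLN := (tendsto_measure_preimage_empiricalMeasure_compl ν (hO.mem_nhds hνO)).comp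
    (tendsto_natCast_atTop_of_div hκ hp)
  have hLLN' := (ENNReal.tendsto_toReal ENNReal.zero_ne_top).comp hLLN
  set R := 1 + (κ + 1) ^ 2 * (c₁ + |ℓ|) + 2 * (κ + 1) * c₂ + δ / 2
  have hR0 : 0 < R := by positivity
  have hP : ∀ᶠ n in atTop, (Measure.pi fun _ : Fin (p n) => (ν : Measure S)).real
      (empiricalMeasure ⁻¹' O)ᶜ < δ / 2 / R :=
    hLLN'.eventually (Iio_mem_nhds (by rw [ENNReal.toReal_zero]; positivity))
  -- Half of `δ` is the loss from localizing to `O`; the other half absorbs the convergence of the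
  -- mean and the term `k log M' / n²`.
  filter_upwards [hv_ev, hmean.eventually (Ioi_mem_nhds (show κ * κ / 2 * ℓ + κ * Lw - δ <
    κ * (κ - 0) / 2 * ℓ + κ * Lw - δ / 2 - κ * 0 * Real.log M' by
      rw [sub_zero, mul_zero, zero_mul]; linarith)), hkn, hP, eventually_gt_atTop 0]
    with n hn1 hn2 hn3 hn4 hn0
  set k := p n
  have hnpos : (0 : ℝ) < n := by exact_mod_cast hn0
  have hn1' : (1 : ℝ) ≤ n := by exact_mod_cast hn0
  set Lv := ∫ x, Real.log (v n x) ∂(ν : Measure S)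
  have hlv : Integrable (fun x => Real.log (v n x)) (ν : Measure S) :=
    Integrable.of_bound (hv_meas n) c₂ (hKae.mono fun x hx => (hn1 x hx).2)
  have hLvc : |Lv| ≤ c₂ := by
    have := norm_integral_le_of_norm_le_const (μ := (ν : Measure S))
      (f := fun x => Real.log (v n x)) (hKae.mono fun x hx => (hn1 x hx).2)
    simpa using this
  have hlvn : ∀ x, Real.log (v n x ^ n) = n * Real.log (v n x) := fun x => Real.log_pow _ _
  set m : ℝ := k * (k - 1) / 2 * ℓ + k * (n * Lv) with hm
  have key := ofReal_exp_le_withDensity_pi (k := k) hM' ha_int hc₁ ha_le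
    (b := fun x => v n x ^ n) (c₂ := n * c₂) (δ := n ^ 2 * (δ / 2)) (m := m)
    (by simp only [hlvn]; exact hlv.const_mul _)
    (hKae.mono fun x hx => ⟨pow_pos (hn1 x hx).1 _, by
      rw [hlvn]
      exact mul_le_mul_of_nonneg_left ((le_abs_self _).trans (hn1 x hx).2) hnpos.le⟩)
    (hAm k) (by simp only [hlvn, integral_const_mul, hm, Lv]; rfl) ?_
  · have hMk : (M' : ℝ≥0∞) ^ k = ENNReal.ofReal (Real.exp (k * Real.log M')) := by
      rw [mul_comm, Real.exp_mul, Real.exp_log hM'0, Real.rpow_natCast,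
        ENNReal.ofReal_pow hM'0.le, ENNReal.ofReal_coe_nnreal]
    rw [hMk] at key
    have h5 : ENNReal.ofReal (Real.exp (m - n ^ 2 * (δ / 2) - k * Real.log M')) ≤
        unnormalizedEnsemble β γ n k (v n) (empiricalMeasure ⁻¹' O) := by
      rw [Real.exp_sub, ENNReal.ofReal_div_of_pos (Real.exp_pos _)]
      exact ENNReal.div_le_of_le_mul' key
    refine le_trans (ENNReal.ofReal_le_ofReal (Real.exp_le_exp.2 ?_)) h5
    have h6 := mul_le_mul_of_nonneg_left (le_of_lt hn2) (sq_nonneg (n : ℝ))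
    refine h6.trans (le_of_eq ?_)
    rw [hm]
    field_simp
  · have hkn' : (k : ℝ) ≤ (κ + 1) * n := ((div_lt_iff₀ hnpos).1 hn3).le
    have hk : (k : ℝ) = 0 ∨ 1 ≤ (k : ℝ) := by
      rcases Nat.eq_zero_or_pos k with h | h
      · exact Or.inl (by exact_mod_cast h)
      · exact Or.inr (by exact_mod_cast h)
    have hle := deviation_bound hk hn1' hkn' hc₁ hLvc (ℓ := ℓ) (δ := δ)
    calc _ ≤ n ^ 2 * R * (δ / 2 / R) :=
          mul_le_mul hle hn4.le measureReal_nonneg (by positivity)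
      _ = n ^ 2 * (δ / 2) := by field_simp

end LowerBound

/-! ### Extended integrals -/

section EIntegral

variable {α : Type*} [MeasurableSpace α] {μ : Measure α}

theorem eintegral_congr_ae {f g : α → EReal} (h : f =ᵐ[μ] g) : eintegral μ f = eintegral μ g := by
  have h1 : ∫⁻ a, (f a).toENNReal ∂μ = ∫⁻ a, (g a).toENNReal ∂μ :=
    lintegral_congr_ae (h.mono fun a ha => by simp only [ha])
  have h2 : ∫⁻ a, (-f a).toENNReal ∂μ = ∫⁻ a, (-g a).toENNReal ∂μ :=
    lintegral_congr_ae (h.mono fun a ha => by simp only [ha])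
  rw [eintegral, eintegral, h1, h2]

/-- Positive and negative parts in `q = (q - g) + g`, arranged without any subtraction of parts, so
that `q = ∞` is allowed and the identity can be integrated. -/
theorem toENNReal_sub_add_eq (q : ℝ≥0∞) (g : ℝ) :
    q + (ENNReal.ofReal (-g) + (-((q : EReal) - (g : EReal))).toENNReal) =
      ((q : EReal) - (g : EReal)).toENNReal + ENNReal.ofReal g := by
  induction q with
  | top => simp
  | coe q =>
    have h1 : (((q : ℝ≥0∞) : EReal) - (g : EReal)) = (((q : ℝ) - g : ℝ) : EReal) := by
      push_cast
      rfl
    rw [h1, ← EReal.coe_neg, EReal.toENNReal_of_ne_top (EReal.coe_ne_top _),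
      EReal.toENNReal_of_ne_top (EReal.coe_ne_top _), EReal.toReal_coe, EReal.toReal_coe,
      ← ENNReal.toReal_eq_toReal_iff' (by simp) (by simp), ENNReal.toReal_add (by simp) (by simp),
      ENNReal.toReal_add (by simp) (by simp), ENNReal.toReal_add (by simp) (by simp)]
    simp only [ENNReal.toReal_ofReal', ENNReal.coe_toReal]
    grind

theorem lintegral_neg_sub_ne_top {q : α → ℝ≥0∞} {g : α → ℝ} (hg : Integrable g μ) :
    ∫⁻ a, (-((q a : EReal) - (g a : EReal))).toENNReal ∂μ ≠ ⊤ := by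
  have h1 : ∫⁻ a, ENNReal.ofReal (g a) ∂μ ≠ ⊤ := hg.lintegral_lt_top.ne
  refine ne_top_of_le_ne_top h1 (lintegral_mono fun a => ?_)
  have h2 : ENNReal.ofReal (g a) = (g a : EReal).toENNReal := by
    rw [EReal.toENNReal_of_ne_top (EReal.coe_ne_top _), EReal.toReal_coe]
  rw [h2]
  refine EReal.toENNReal_le_toENNReal ?_
  rw [EReal.neg_sub (Or.inr (EReal.coe_ne_bot _)) (Or.inr (EReal.coe_ne_top _)), add_comm,
    ← sub_eq_add_neg]
  simpa using EReal.sub_le_sub (le_refl (g a : EReal)) (EReal.coe_ennreal_nonneg (q a))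

/-- The extended integral of `q - g`, for `q ≥ 0` measurable and `g` integrable. -/
theorem eintegral_eq_lintegral_sub_integral {f : α → EReal} {q : α → ℝ≥0∞} {g : α → ℝ}
    (hq : AEMeasurable q μ) (hg : Integrable g μ) (hf : ∀ᵐ a ∂μ, f a = (q a : EReal) - g a) :
    eintegral μ f = ((∫⁻ a, q a ∂μ : ℝ≥0∞) : EReal) - ((∫ a, g a ∂μ : ℝ) : EReal) := by
  rw [eintegral_congr_ae hf, eintegral]
  set P := ∫⁻ a, ((q a : EReal) - (g a : EReal)).toENNReal ∂μ with hP
  set N := ∫⁻ a, (-((q a : EReal) - (g a : EReal))).toENNReal ∂μ with hN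
  have hNtop : N ≠ ⊤ := lintegral_neg_sub_ne_top hg
  set G₁ := ∫⁻ a, ENNReal.ofReal (g a) ∂μ with hG₁
  set G₂ := ∫⁻ a, ENNReal.ofReal (-g a) ∂μ with hG₂
  have hG₁top : G₁ ≠ ⊤ := hg.lintegral_lt_top.ne
  have hG₂top : G₂ ≠ ⊤ := hg.neg.lintegral_lt_top.ne
  have hsum : ∫⁻ a, q a ∂μ + (G₂ + N) = P + G₁ := by
    have hgm := hg.aemeasurable
    rw [hG₂, hN, hP, hG₁, ← lintegral_add_left' (by fun_prop), ← lintegral_add_left' hq,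
      ← lintegral_add_right' _ (by fun_prop)]
    exact lintegral_congr fun a => toENNReal_sub_add_eq (q a) (g a)
  rw [integral_eq_lintegral_pos_part_sub_lintegral_neg_part hg]
  -- All terms of `hsum` except `∫ q` and `P` are finite, so these two are infinite together.
  by_cases hQ : ∫⁻ a, q a ∂μ = ⊤
  · have hPtop : P = ⊤ := by
      rw [hQ, top_add] at hsum
      by_contra h
      exact ENNReal.add_ne_top.2 ⟨h, hG₁top⟩ hsum.symm
    rw [hQ, hPtop]
    rw [← EReal.coe_ennreal_toReal hNtop, EReal.coe_ennreal_top, EReal.top_sub_coe,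
      EReal.top_sub_coe]
  · have hPtop : P ≠ ⊤ := fun h => by
      rw [h, top_add] at hsum
      exact ENNReal.add_ne_top.2 ⟨hQ, ENNReal.add_ne_top.2 ⟨hG₂top, hNtop⟩⟩ hsum
    have h1 := congrArg ENNReal.toReal hsum
    rw [ENNReal.toReal_add hQ (ENNReal.add_ne_top.2 ⟨hG₂top, hNtop⟩),
      ENNReal.toReal_add hG₂top hNtop, ENNReal.toReal_add hPtop hG₁top] at h1
    rw [← EReal.coe_ennreal_toReal hPtop, ← EReal.coe_ennreal_toReal hNtop,
      ← EReal.coe_ennreal_toReal hQ,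
      ← EReal.coe_sub, ← EReal.coe_sub]
    congr 1
    linarith

end EIntegral

/-! ### The energy functional as a kernel energy -/

theorem logE_of_pos {t : ℝ} (ht : 0 < t) : logE t = (Real.log t : EReal) := by
  rw [logE, ENNReal.log_pos_real (by simpa using ht) ENNReal.ofReal_ne_top,
    ENNReal.toReal_ofReal ht.le]

theorem logE_zero : logE 0 = ⊥ := by simp [logE]

theorem measurable_logE : Measurable logE :=
  ENNReal.measurable_log.comp ENNReal.measurable_ofReal

theorem VanishingKernel.coe_gapLog {X : Type*} [TopologicalSpace X] {G : X × X → ℝ} {C : ℝ}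
    (hG : VanishingKernel G C) {z : X × X} (hz : 0 < G z) :
    ((gapLog G C z : ℝ≥0∞) : EReal) = ((C - Real.log (G z) : ℝ) : EReal) := by
  have h1 : 0 ≤ C - Real.log (G z) := by
    rw [sub_nonneg, Real.log_le_iff_le_exp hz]
    linarith [hG.add_one_le z]
  rw [gapLog_of_pos hG.nonneg hz, EReal.coe_ennreal_ofReal, max_eq_left h1]

section Energy

variable {S : Set ℝ} {β κ C : ℝ} {γ : ℕ} {w : S → ℝ}

theorem log_interactionKernel {x y : S} (hD : 0 < |(x : ℝ) ^ γ - (y : ℝ) ^ γ|) (hx : 0 < w x)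
    (hy : 0 < w y) (a : ℝ) :
    Real.log (interactionKernel β a γ w (x, y)) =
      β * Real.log |(x : ℝ) ^ γ - (y : ℝ) ^ γ| + a * (Real.log (w x) + Real.log (w y)) := by
  simp only [interactionKernel]
  rw [Real.log_mul (Real.rpow_pos_of_pos hD _).ne'
    (Real.rpow_pos_of_pos (mul_pos hx hy) _).ne', Real.log_rpow hD, Real.log_rpow (mul_pos hx hy),
    Real.log_mul hx.ne' hy.ne']

theorem interactionKernel_pos {x y : S} (hD : 0 < |(x : ℝ) ^ γ - (y : ℝ) ^ γ|) (hx : 0 < w x)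
    (hy : 0 < w y) (a : ℝ) : 0 < interactionKernel β a γ w (x, y) :=
  mul_pos (Real.rpow_pos_of_pos hD _) (Real.rpow_pos_of_pos (mul_pos hx hy) _)

/-- Taking logarithms, `F = (κ²/2)(C - log G) - (κ²/2) C`. Both sides are infinite exactly where `G`
vanishes. -/
theorem pairEnergy_eq (hβ : 0 < β) (hκ : 0 < κ) (hw0 : ∀ x, 0 ≤ w x)
    (hG : VanishingKernel (interactionKernel β (1 / κ) γ w) C) (x y : S) :
    pairEnergy β κ γ w x y =
      ((ENNReal.ofReal (κ ^ 2 / 2) * gapLog (interactionKernel β (1 / κ) γ w) C (x, y) : ℝ≥0∞) :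
        EReal) - ((κ ^ 2 / 2 * C : ℝ) : EReal) := by
  have hκ2 : 0 < κ ^ 2 / 2 := by positivity
  have hβκ : 0 < β / 2 * κ ^ 2 := by positivity
  have hκ' : 0 < κ / 2 := by positivity
  rw [EReal.coe_ennreal_mul, EReal.coe_ennreal_ofReal, max_eq_left hκ2.le]
  by_cases hpos : 0 < |(x : ℝ) ^ γ - (y : ℝ) ^ γ| ∧ 0 < w x ∧ 0 < w y
  · obtain ⟨hD, hx, hy⟩ := hpos
    rw [hG.coe_gapLog (interactionKernel_pos hD hx hy _), log_interactionKernel hD hx hy, pairEnergy,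
      logE_of_pos hD, logE_of_pos hx, logE_of_pos hy]
    norm_cast
    field_simp
    ring
  · have hG0 : interactionKernel β (1 / κ) γ w (x, y) = 0 := by
      simp only [interactionKernel]
      by_cases hD : 0 < |(x : ℝ) ^ γ - (y : ℝ) ^ γ|
      · have : w x * w y = 0 := by
          by_contra h
          have hx : w x ≠ 0 := left_ne_zero_of_mul h
          have hy : w y ≠ 0 := right_ne_zero_of_mul h
          exact hpos ⟨hD, (hw0 x).lt_of_ne' hx, (hw0 y).lt_of_ne' hy⟩
        rw [this, Real.zero_rpow (by positivity), mul_zero]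
      · rw [le_antisymm (not_lt.1 hD) (abs_nonneg _), Real.zero_rpow hβ.ne', zero_mul]
    rw [gapLog_of_eq_zero hG.nonneg hG0, EReal.coe_ennreal_top, EReal.coe_mul_top_of_pos hκ2,
      EReal.top_sub_coe, pairEnergy]
    have htop : ∀ t : ℝ, 0 ≤ t → t = 0 ∨ 0 < t ∧ logE t = (Real.log t : EReal) := fun t ht =>
      ht.eq_or_lt.imp Eq.symm fun h => ⟨h, logE_of_pos h⟩
    have hbot : (⊤ : EReal) - ⊥ = ⊤ := rfl
    rcases htop _ (abs_nonneg ((x : ℝ) ^ γ - (y : ℝ) ^ γ)) with hD | ⟨hD0, hD⟩ <;>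
    rcases htop _ (hw0 x) with hx | ⟨hx0, hx⟩ <;> rcases htop _ (hw0 y) with hy | ⟨hy0, hy⟩ <;>
    first
    | exact (hpos ⟨by assumption, by assumption, by assumption⟩).elim
    | simp only [hD, hx, hy, logE_zero, EReal.neg_bot, EReal.coe_mul_top_of_pos hβκ,
        EReal.coe_mul_bot_of_pos hκ', EReal.bot_add, EReal.add_bot, EReal.sub_bot,
        EReal.top_sub_coe, ← EReal.coe_add, ← EReal.coe_neg, ← EReal.coe_mul, ne_eq,
        EReal.coe_ne_bot, not_false_eq_true, hbot]

theorem lintegral_neg_pairEnergy_ne_top (hβ : 0 < β) (hκ : 0 < κ) (hw0 : ∀ x, 0 ≤ w x)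
    (hG : VanishingKernel (interactionKernel β (1 / κ) γ w) C) (μ : ProbabilityMeasure S) :
    ∫⁻ z, (-pairEnergy β κ γ w z.1 z.2).toENNReal ∂((μ : Measure S).prod (μ : Measure S)) ≠ ⊤ := by
  simp only [pairEnergy_eq hβ hκ hw0 hG]
  exact lintegral_neg_sub_ne_top (integrable_const _)

theorem energy_eq (hβ : 0 < β) (hκ : 0 < κ) (hw0 : ∀ x, 0 ≤ w x)
    (hG : VanishingKernel (interactionKernel β (1 / κ) γ w) C) (μ : ProbabilityMeasure S) :
    energy β κ γ w μ =
      ((κ ^ 2 / 2 : ℝ) : EReal) * (kernelEnergy (interactionKernel β (1 / κ) γ w) C μ : EReal) -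
        ((κ ^ 2 / 2 * C : ℝ) : EReal) := by
  have hm := measurable_gapLog (C := C) hG.continuous.measurable
  rw [energy, eintegral_eq_lintegral_sub_integral
    (q := fun z => ENNReal.ofReal (κ ^ 2 / 2) * gapLog (interactionKernel β (1 / κ) γ w) C z)
    (g := fun _ => κ ^ 2 / 2 * C) (by fun_prop) (integrable_const _)
    (ae_of_all _ fun z => pairEnergy_eq hβ hκ hw0 hG z.1 z.2), lintegral_const_mul _ hm,
    EReal.coe_ennreal_mul, EReal.coe_ennreal_ofReal, max_eq_left (by positivity)]
  simp [kernelEnergy]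

theorem lintegral_neg_logE_eq_top {μ : Measure S}
    (h : eintegral μ (fun x => logE (w x)) = ⊥) : ∫⁻ x, (-logE (w x)).toENNReal ∂μ = ⊤ := by
  by_contra hN
  rw [eintegral, ← EReal.coe_ennreal_toReal hN, sub_eq_add_neg, ← EReal.coe_neg,
    EReal.add_eq_bot_iff] at h
  rcases h with h | h
  · exact EReal.coe_ennreal_ne_bot _ h
  · exact EReal.coe_ne_bot _ h

/-- A bounded weight has `log w` bounded above, so the negative part is the only obstruction to
integrability. -/
theorem integrable_log_of_eintegral_ne_bot (hwm : Measurable w) (hw0 : ∀ x, 0 ≤ w x) {M : ℝ}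
    (hM : ∀ x, w x ≤ M) {μ : Measure S} [IsFiniteMeasure μ]
    (h : eintegral μ (fun x => logE (w x)) ≠ ⊥) :
    (∀ᵐ x ∂μ, 0 < w x) ∧ Integrable (fun x => Real.log (w x)) μ ∧
      eintegral μ (fun x => logE (w x)) = ((∫ x, Real.log (w x) ∂μ : ℝ) : EReal) := by
  have hN : ∫⁻ x, (-logE (w x)).toENNReal ∂μ ≠ ⊤ := by
    intro hN
    rw [eintegral, hN, EReal.coe_ennreal_top, EReal.sub_top] at h
    exact h rfl
  have hpos : ∀ᵐ x ∂μ, 0 < w x := by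
    filter_upwards [ae_lt_top ((measurable_logE.comp hwm).neg.ereal_toENNReal) hN] with x hx
    refine (hw0 x).lt_of_ne' fun h0 => ?_
    simp [h0, logE_zero] at hx
  have hM' : ∀ᵐ x ∂μ, Real.log (w x) ≤ Real.log M :=
    hpos.mono fun x hx => Real.log_le_log hx (hM x)
  have hlm : Measurable fun x => Real.log (w x) := Real.measurable_log.comp hwm
  have hint : Integrable (fun x => Real.log M - Real.log (w x)) μ := by
    rw [← lintegral_ofReal_ne_top_iff_integrable (hlm.const_sub _).aestronglyMeasurable
      (hM'.mono fun x hx => sub_nonneg.2 hx)]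
    refine ne_top_of_le_ne_top (b := ∫⁻ x, (ENNReal.ofReal (Real.log M) +
      (-logE (w x)).toENNReal) ∂μ) ?_ (lintegral_mono_ae (hpos.mono fun x hx => ?_))
    · rw [lintegral_add_left measurable_const, lintegral_const]
      exact ENNReal.add_ne_top.2 ⟨ENNReal.mul_ne_top ENNReal.ofReal_ne_top (measure_ne_top _ _), hN⟩
    · rw [logE_of_pos hx, ← EReal.coe_neg, EReal.toENNReal_of_ne_top (EReal.coe_ne_top _),
        EReal.toReal_coe, sub_eq_add_neg]
      exact ENNReal.ofReal_add_le
  have hlog : Integrable (fun x => Real.log (w x)) μ := by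
    refine ((integrable_const (Real.log M)).sub hint).congr (ae_of_all _ fun x => ?_)
    simp
  refine ⟨hpos, hlog, ?_⟩
  rw [eintegral_eq_lintegral_sub_integral (q := fun _ => 0) (g := fun x => -Real.log (w x))
    (by fun_prop) hlog.neg (hpos.mono fun x hx => by simp [logE_of_pos hx])]
  simp [integral_neg]

/-- Write `-log |x^γ - y^γ|` as `(C - log G)/β` minus the function `(C - (log w(x) + log
w(y))/κ)/β`. The first is nonnegative, the second integrable, so the splitting holds even when the
logarithmic energy is infinite. -/
theorem energy_eq_sub (hβ : 0 < β) (hκ : 0 < κ) (hwc : Continuous w) (hw0 : ∀ x, 0 ≤ w x)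
    {M : ℝ} (hM : ∀ x, w x ≤ M) (hG : VanishingKernel (interactionKernel β (1 / κ) γ w) C)
    (μ : ProbabilityMeasure S) (h : eintegral (μ : Measure S) (fun x => logE (w x)) ≠ ⊥) :
    energy β κ γ w μ =
        ((β / 2 * κ ^ 2 : ℝ) : EReal) *
            eintegral ((μ : Measure S).prod (μ : Measure S))
              (fun z => -logE |(z.1 : ℝ) ^ γ - (z.2 : ℝ) ^ γ|)
          - (κ : EReal) * eintegral (μ : Measure S) (fun x => logE (w x)) := by
  obtain ⟨hpos, hlog, hL⟩ := integrable_log_of_eintegral_ne_bot hwc.measurable hw0 hM h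
  have hm := measurable_gapLog (C := C) hG.continuous.measurable
  have h1 : Integrable (fun z : S × S => Real.log (w z.1))
    ((μ : Measure S).prod (μ : Measure S)) := hlog.comp_fst _
  have h2 : Integrable (fun z : S × S => Real.log (w z.2))
    ((μ : Measure S).prod (μ : Measure S)) := hlog.comp_snd _
  have hg : Integrable (fun z : S × S => 1 / β * (C - 1 / κ * (Real.log (w z.1) +
      Real.log (w z.2)))) ((μ : Measure S).prod (μ : Measure S)) :=
    ((integrable_const C).sub ((h1.add h2).const_mul (1 / κ))).const_mul (1 / β)
  have hgi : ∫ z : S × S, 1 / β * (C - 1 / κ * (Real.log (w z.1) + Real.log (w z.2)))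
      ∂((μ : Measure S).prod (μ : Measure S)) =
      1 / β * (C - 2 / κ * ∫ x, Real.log (w x) ∂(μ : Measure S)) := by
    have h3 : Integrable (fun z : S × S => 1 / κ * (Real.log (w z.1) + Real.log (w z.2)))
      ((μ : Measure S).prod (μ : Measure S)) := (h1.add h2).const_mul (1 / κ)
    rw [integral_const_mul, integral_sub (integrable_const C) h3, integral_const_mul,
      integral_add h1 h2, integral_fun_fst (fun x => Real.log (w x)),
      integral_fun_snd (fun x => Real.log (w x))]
    simp only [integral_const, probReal_univ, smul_eq_mul, one_mul]
    ring
  rw [hL, energy_eq hβ hκ hw0 hG, eintegral_eq_lintegral_sub_integral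
    (q := fun z => ENNReal.ofReal (1 / β) * gapLog (interactionKernel β (1 / κ) γ w) C z)
    (by fun_prop) hg ?_, hgi, lintegral_const_mul _ hm, EReal.coe_ennreal_mul,
    EReal.coe_ennreal_ofReal, max_eq_left (by positivity : 0 ≤ 1 / β)]
  · change _ = ((β / 2 * κ ^ 2 : ℝ) : EReal) * (((1 / β : ℝ) : EReal) *
      (kernelEnergy (interactionKernel β (1 / κ) γ w) C μ : EReal) - _) - _
    by_cases hE : kernelEnergy (interactionKernel β (1 / κ) γ w) C μ = ⊤
    · rw [hE, EReal.coe_ennreal_top, EReal.coe_mul_top_of_pos (by positivity),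
        EReal.coe_mul_top_of_pos (by positivity), EReal.top_sub_coe, EReal.top_sub_coe,
        EReal.coe_mul_top_of_pos (by positivity), ← EReal.coe_mul, EReal.top_sub_coe]
    · rw [← EReal.coe_ennreal_toReal hE]
      norm_cast
      field_simp
      ring
  · filter_upwards [Measure.quasiMeasurePreserving_fst.ae hpos,
      Measure.quasiMeasurePreserving_snd.ae hpos] with z hz1 hz2
    rw [EReal.coe_ennreal_mul, EReal.coe_ennreal_ofReal, max_eq_left (by positivity : 0 ≤ 1 / β)]
    rcases (abs_nonneg ((z.1 : ℝ) ^ γ - (z.2 : ℝ) ^ γ)).eq_or_lt with hD | hD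
    · have hG0 : interactionKernel β (1 / κ) γ w z = 0 := by
        simp only [interactionKernel]
        rw [← hD, Real.zero_rpow hβ.ne', zero_mul]
      rw [← hD, logE_zero, EReal.neg_bot, gapLog_of_eq_zero hG.nonneg hG0, EReal.coe_ennreal_top,
        EReal.coe_mul_top_of_pos (by positivity), EReal.top_sub_coe]
    · rw [logE_of_pos hD, hG.coe_gapLog (interactionKernel_pos hD hz1 hz2 _),
        log_interactionKernel hD hz1 hz2]
      norm_cast
      field_simp
      ring

/-- From `G ≤ R w(x)^d` one gets `-d log w(x) ≤ (C - log G) + (log R - C)`. A divergent integral of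
`log w` therefore cannot be offset by the attraction between distant points. -/
theorem kernelEnergy_eq_top_of_lintegral_neg_logE (hwc : Continuous w) (hw0 : ∀ x, 0 ≤ w x)
    (hG : VanishingKernel (interactionKernel β (1 / κ) γ w) C) (hκ : 0 < κ) {d R : ℝ} (hd : 0 < d)
    (hR : 0 < R) (hGR : ∀ x y, interactionKernel β (1 / κ) γ w (x, y) ≤ R * w x ^ d)
    (μ : ProbabilityMeasure S) (h : ∫⁻ x, (-logE (w x)).toENNReal ∂(μ : Measure S) = ⊤) :
    kernelEnergy (interactionKernel β (1 / κ) γ w) C μ = ⊤ := by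
  have hlm : Measurable fun x => (-logE (w x)).toENNReal :=
    (measurable_logE.comp hwc.measurable).neg.ereal_toENNReal
  have hpt : ∀ z : S × S, ENNReal.ofReal d * (-logE (w z.1)).toENNReal ≤
      gapLog (interactionKernel β (1 / κ) γ w) C z + ENNReal.ofReal (Real.log R - C) := by
    rintro ⟨x, y⟩
    rcases (hG.nonneg (x, y)).eq_or_lt with h0 | h0
    · rw [gapLog_of_eq_zero hG.nonneg h0.symm, top_add]
      exact le_top
    · have hx : 0 < w x := by
        refine (hw0 x).lt_of_ne' fun hx => ?_
        simp only [interactionKernel, hx, zero_mul] at h0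
        rw [Real.zero_rpow (by positivity), mul_zero] at h0
        exact lt_irrefl _ h0
      have h1 := Real.log_le_log h0 (hGR x y)
      rw [Real.log_mul hR.ne' (Real.rpow_pos_of_pos hx _).ne', Real.log_rpow hx] at h1
      rw [gapLog_of_pos hG.nonneg h0, logE_of_pos hx, ← EReal.coe_neg,
        EReal.toENNReal_of_ne_top (EReal.coe_ne_top _), EReal.toReal_coe, ← ENNReal.ofReal_mul hd.le]
      refine le_trans (ENNReal.ofReal_le_ofReal ?_) ENNReal.ofReal_add_le
      linarith
  have h2 := lintegral_mono (μ := (μ : Measure S).prod (μ : Measure S)) hpt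
  have h3 : Measurable fun z : S × S => (-logE (w z.1)).toENNReal := hlm.comp measurable_fst
  rw [lintegral_add_right _ measurable_const, lintegral_const_mul _ h3,
    lintegral_const, measure_univ, mul_one,
    (measurePreserving_fst (μ := (μ : Measure S)) (ν := (μ : Measure S))).lintegral_comp hlm, h,
    ENNReal.mul_top (by simpa using hd), top_le_iff] at h2
  exact (ENNReal.add_eq_top.1 h2).resolve_right ENNReal.ofReal_ne_top

theorem energy_eq_top (hβ : 0 < β) (hκ : 0 < κ) (hwc : Continuous w) (hw0 : ∀ x, 0 ≤ w x)
    (hG : VanishingKernel (interactionKernel β (1 / κ) γ w) C) {d R : ℝ} (hd : 0 < d)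
    (hR : 0 < R) (hGR : ∀ x y, interactionKernel β (1 / κ) γ w (x, y) ≤ R * w x ^ d)
    (μ : ProbabilityMeasure S) (h : eintegral (μ : Measure S) (fun x => logE (w x)) = ⊥) :
    energy β κ γ w μ = ⊤ := by
  rw [energy_eq hβ hκ hw0 hG, kernelEnergy_eq_top_of_lintegral_neg_logE hwc hw0 hG hκ hd hR hGR μ
    (lintegral_neg_logE_eq_top h), EReal.coe_ennreal_top, EReal.coe_mul_top_of_pos (by positivity),
    EReal.top_sub_coe]

end Energy

/-! ### Large deviation principles from exponential bounds -/

section ExponentialBounds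

theorem inv_sq_mul_log_ofReal_exp {n : ℕ} (hn : n ≠ 0) (y : ℝ) :
    ((((n : ℝ) ^ 2)⁻¹ : ℝ) : EReal) * ENNReal.log (ENNReal.ofReal (Real.exp ((n : ℝ) ^ 2 * y))) =
      (y : EReal) := by
  have hn' : (n : ℝ) ≠ 0 := by exact_mod_cast hn
  rw [ENNReal.log_pos_real (by simpa using Real.exp_pos _) ENNReal.ofReal_ne_top,
    ENNReal.toReal_ofReal (Real.exp_pos _).le, Real.log_exp, ← EReal.coe_mul, inv_mul_cancel_left₀]
  positivity

variable {X : Type*} {M : ℕ → ℝ≥0∞} {E : X → EReal} {A : Set X}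

theorem limsup_log_le_neg_iInf
    (h : ∀ r : ℝ, (∀ μ ∈ A, (r : EReal) < E μ) → ∀ δ > 0, ∀ᶠ n : ℕ in atTop,
      M n ≤ ENNReal.ofReal (Real.exp ((n : ℝ) ^ 2 * (-r + δ)))) :
    limsup (fun n : ℕ => ((((n : ℝ) ^ 2)⁻¹ : ℝ) : EReal) * ENNReal.log (M n)) atTop ≤
      -(⨅ μ ∈ A, E μ) := by
  refine EReal.le_of_forall_lt_iff_le.1 fun y hy => ?_
  rw [EReal.neg_lt_comm] at hy
  obtain ⟨r, hr1, hr2⟩ := EReal.lt_iff_exists_real_btwn.1 hy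
  have hr : -y < r := by exact_mod_cast hr1
  refine limsup_le_of_le (by isBoundedDefault) ?_
  -- The slack `y + r` is positive since `-y < r`, and turns the exponent `-r + δ` into `y`.
  filter_upwards [h r (fun μ hμ => hr2.trans_le (iInf₂_le μ hμ)) (y + r) (by linarith),
    eventually_ne_atTop 0] with n hn hn0
  rw [← inv_sq_mul_log_ofReal_exp hn0 y]
  refine mul_le_mul_of_nonneg_left (ENNReal.log_monotone ?_)
    (EReal.coe_nonneg.2 (by positivity))
  rwa [neg_add_eq_sub, add_sub_cancel_right] at hn

theorem neg_iInf_le_liminf_log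
    (h : ∀ r : ℝ, ∀ μ ∈ A, E μ < r → ∀ᶠ n : ℕ in atTop,
      ENNReal.ofReal (Real.exp ((n : ℝ) ^ 2 * (-r))) ≤ M n) :
    -(⨅ μ ∈ A, E μ) ≤
      liminf (fun n : ℕ => ((((n : ℝ) ^ 2)⁻¹ : ℝ) : EReal) * ENNReal.log (M n)) atTop := by
  refine EReal.ge_of_forall_gt_iff_ge.1 fun y hy => ?_
  rw [EReal.lt_neg_comm] at hy
  obtain ⟨μ, hμA, hμ⟩ := by simpa only [iInf_lt_iff] using hy
  refine le_liminf_of_le (by isBoundedDefault) ?_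
  filter_upwards [h (-y) μ hμA (by exact_mod_cast hμ), eventually_ne_atTop 0] with n hn hn0
  rw [← inv_sq_mul_log_ofReal_exp hn0 y]
  rw [neg_neg] at hn
  exact mul_le_mul_of_nonneg_left (ENNReal.log_monotone hn) (EReal.coe_nonneg.2 (by positivity))

end ExponentialBounds

theorem EReal.coe_lt_add_coe_iff {x : EReal} {r c : ℝ} :
    (r : EReal) < x + c ↔ ((r - c : ℝ) : EReal) < x := by
  induction x with
  | bot => simp
  | top => simpa using EReal.coe_lt_top (r - c)
  | coe x => norm_cast; exact sub_lt_iff_lt_add.symm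

theorem EReal.add_coe_lt_coe_iff {x : EReal} {r c : ℝ} :
    x + c < (r : EReal) ↔ x < ((r - c : ℝ) : EReal) := by
  induction x with
  | bot => simpa using EReal.bot_lt_coe (r - c)
  | top => simp
  | coe x => norm_cast; exact lt_sub_iff_add_lt.symm

/-- Exponential bounds, at speed `n²`, for unnormalized measures of closed and open sets, with an
energy `E` that is bounded below, not identically infinite, and has compact sublevel sets. -/
structure HasEnergyBounds {X : Type*} [TopologicalSpace X] (M : ℕ → Set X → ℝ≥0∞)
    (E : X → EReal) : Prop where
  upper : ∀ A, IsClosed A → ∀ r : ℝ, (∀ μ ∈ A, (r : EReal) < E μ) → ∀ δ > 0, ∀ᶠ n : ℕ in atTop,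
    M n A ≤ ENNReal.ofReal (Real.exp ((n : ℝ) ^ 2 * (-r + δ)))
  lower : ∀ O, IsOpen O → ∀ r : ℝ, ∀ μ ∈ O, E μ < r → ∀ᶠ n : ℕ in atTop,
    ENNReal.ofReal (Real.exp ((n : ℝ) ^ 2 * (-r))) ≤ M n O
  isClosed_le : ∀ r : ℝ, IsClosed {μ | E μ ≤ r}
  isCompact_le : ∀ r : ℝ, IsCompact {μ | E μ ≤ r}
  bddBelow : ∃ b : ℝ, ∀ μ, (b : EReal) ≤ E μ
  ne_top : ∃ μ, E μ ≠ ⊤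

/-! ### Normalization: from energy bounds to the large deviation principle. -/

namespace HasEnergyBounds

variable {X : Type*} [TopologicalSpace X] {M : ℕ → Set X → ℝ≥0∞} {E : X → EReal}

theorem exists_iInf_eq (h : HasEnergyBounds M E) : ∃ c : ℝ, ⨅ μ, E μ = ((-c : ℝ) : EReal) := by
  obtain ⟨b, hb⟩ := h.bddBelow
  obtain ⟨μ, hμ⟩ := h.ne_top
  have h1 : ⨅ μ, E μ ≠ ⊤ := ne_top_of_le_ne_top hμ (iInf_le _ _)
  have h2 : ⨅ μ, E μ ≠ ⊥ := fun h2 => by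
    have := le_iInf hb
    rw [h2, le_bot_iff] at this
    exact EReal.coe_ne_bot _ this
  exact ⟨-(⨅ μ, E μ).toReal, by rw [neg_neg, EReal.coe_toReal h1 h2]⟩

theorem eventually_univ_le (h : HasEnergyBounds M E) {c : ℝ}
    (hc : ⨅ μ, E μ = ((-c : ℝ) : EReal)) {δ : ℝ} (hδ : 0 < δ) :
    ∀ᶠ n : ℕ in atTop, M n univ ≤ ENNReal.ofReal (Real.exp ((n : ℝ) ^ 2 * (c + δ))) := by
  have h1 : ∀ μ ∈ (univ : Set X), ((-c - δ / 2 : ℝ) : EReal) < E μ := fun μ _ => by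
    refine lt_of_lt_of_le ?_ (hc ▸ iInf_le E μ)
    exact_mod_cast (by linarith : -c - δ / 2 < -c)
  filter_upwards [h.upper univ isClosed_univ _ h1 (δ / 2) (by linarith)] with n hn
  convert hn using 4
  ring

theorem eventually_le_univ (h : HasEnergyBounds M E) {c : ℝ}
    (hc : ⨅ μ, E μ = ((-c : ℝ) : EReal)) {δ : ℝ} (hδ : 0 < δ) :
    ∀ᶠ n : ℕ in atTop, ENNReal.ofReal (Real.exp ((n : ℝ) ^ 2 * (c - δ))) ≤ M n univ := by
  have h1 : ⨅ μ, E μ < ((-c + δ : ℝ) : EReal) := by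
    rw [hc]
    exact_mod_cast (by linarith : -c < -c + δ)
  obtain ⟨μ, hμ⟩ := iInf_lt_iff.1 h1
  filter_upwards [h.lower univ isOpen_univ _ μ (mem_univ _) hμ] with n hn
  convert hn using 5
  ring

theorem eventually_univ_ne (h : HasEnergyBounds M E) :
    ∀ᶠ n : ℕ in atTop, M n univ ≠ 0 ∧ M n univ ≠ ⊤ := by
  obtain ⟨c, hc⟩ := h.exists_iInf_eq
  filter_upwards [h.eventually_univ_le hc one_pos, h.eventually_le_univ hc one_pos] with n h1 h2
  refine ⟨(lt_of_lt_of_le ?_ h2).ne', ne_top_of_le_ne_top ENNReal.ofReal_ne_top h1⟩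
  simpa using Real.exp_pos _

theorem tendsto_log_univ (h : HasEnergyBounds M E) {c : ℝ}
    (hc : ⨅ μ, E μ = ((-c : ℝ) : EReal)) :
    Tendsto (fun n : ℕ => ((((n : ℝ) ^ 2)⁻¹ : ℝ) : EReal) * ENNReal.log (M n univ)) atTop
      (𝓝 (c : EReal)) := by
  have hc' : -(⨅ μ ∈ (univ : Set X), E μ) = (c : EReal) := by
    rw [iInf_univ, hc, ← EReal.coe_neg, neg_neg]
  refine tendsto_of_le_liminf_of_limsup_le ?_ ?_ (by isBoundedDefault) (by isBoundedDefault)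
  · rw [← hc']
    exact neg_iInf_le_liminf_log (h.lower univ isOpen_univ)
  · rw [← hc']
    exact limsup_log_le_neg_iInf (h.upper univ isClosed_univ)

theorem isGoodRateFunction (h : HasEnergyBounds M E) {c : ℝ}
    (hc : ⨅ μ, E μ = ((-c : ℝ) : EReal)) : IsGoodRateFunction fun μ => E μ + (c : EReal) where
  nonneg μ := by
    have h1 : ((-c : ℝ) : EReal) ≤ E μ := hc ▸ iInf_le E μ
    calc (0 : EReal) = ((-c : ℝ) : EReal) + (c : EReal) := by norm_cast; simp
      _ ≤ _ := add_le_add_left h1 _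
  lowerSemicontinuous μ y hy := by
    obtain ⟨r, hr1, hr2⟩ := EReal.lt_iff_exists_real_btwn.1 hy
    have hU : IsOpen {ρ | E ρ ≤ ((r - c : ℝ) : EReal)}ᶜ := (h.isClosed_le _).isOpen_compl
    filter_upwards [hU.mem_nhds (show μ ∈ {ρ | E ρ ≤ ((r - c : ℝ) : EReal)}ᶜ from
      not_le.2 (EReal.coe_lt_add_coe_iff.1 hr2))] with ρ hρ
    exact hr1.trans (EReal.coe_lt_add_coe_iff.2 (not_le.1 hρ))
  isCompact_level L _ := by
    convert h.isCompact_le (L - c) using 2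
    ext μ
    rw [← not_lt, EReal.coe_lt_add_coe_iff, not_lt]

theorem satisfiesLDP (h : HasEnergyBounds M E) {c : ℝ} (hc : ⨅ μ, E μ = ((-c : ℝ) : EReal))
    {ν : ℕ → @Measure X (borel X)}
    (hν : ∀ n A, MeasurableSet[borel X] A → ν n A = (M n univ)⁻¹ * M n A) :
    SatisfiesLDP ν (fun n => (n : ℝ) ^ 2) fun μ => E μ + (c : EReal) where
  goodRate := h.isGoodRateFunction hc
  lower G hG := by
    refine neg_iInf_le_liminf_log fun r μ hμ hr => ?_
    rw [EReal.add_coe_lt_coe_iff] at hr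
    obtain ⟨s, hs1, hs2⟩ := EReal.lt_iff_exists_real_btwn.1 hr
    have hs : s < r - c := by exact_mod_cast hs2
    -- The slack `r - c - s` in the total mass makes the exponents add up to `-r`.
    filter_upwards [h.lower G hG s μ hμ hs1,
      h.eventually_univ_le hc (show 0 < r - c - s by linarith)] with n h1 h2
    rw [hν n G (MeasurableSpace.measurableSet_generateFrom hG)]
    calc ENNReal.ofReal (Real.exp ((n : ℝ) ^ 2 * -r))
        = (ENNReal.ofReal (Real.exp ((n : ℝ) ^ 2 * (c + (r - c - s)))))⁻¹ *
            ENNReal.ofReal (Real.exp ((n : ℝ) ^ 2 * -s)) := by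
          rw [← ENNReal.ofReal_inv_of_pos (Real.exp_pos _), ← Real.exp_neg,
            ← ENNReal.ofReal_mul (Real.exp_pos _).le, ← Real.exp_add]
          ring_nf
      _ ≤ _ := mul_le_mul' (ENNReal.inv_le_inv.2 h2) h1
  upper A hA := by
    refine limsup_log_le_neg_iInf fun r hr δ hδ => ?_
    simp only [EReal.coe_lt_add_coe_iff] at hr
    filter_upwards [h.upper A hA (r - c) hr (δ / 2) (by linarith),
      h.eventually_le_univ hc (show 0 < δ / 2 by linarith)] with n h1 h2
    have hAm : MeasurableSet[borel X] A := by
      rw [← @MeasurableSet.compl_iff X A (borel X)]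
      exact MeasurableSpace.measurableSet_generateFrom hA.isOpen_compl
    rw [hν n A hAm]
    calc (M n univ)⁻¹ * M n A
        ≤ (ENNReal.ofReal (Real.exp ((n : ℝ) ^ 2 * (c - δ / 2))))⁻¹ *
            ENNReal.ofReal (Real.exp ((n : ℝ) ^ 2 * (-(r - c) + δ / 2))) :=
          mul_le_mul' (ENNReal.inv_le_inv.2 h2) h1
      _ = _ := by
          rw [← ENNReal.ofReal_inv_of_pos (Real.exp_pos _), ← Real.exp_neg,
            ← ENNReal.ofReal_mul (Real.exp_pos _).le, ← Real.exp_add]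
          ring_nf

end HasEnergyBounds

/-! ### Energy bounds for the ensemble -/

section Bounds

variable {S : Set ℝ} {β κ C : ℝ} {γ : ℕ} {v : ℕ → S → ℝ} {w : S → ℝ}

theorem energy_eq_coe (hβ : 0 < β) (hκ : 0 < κ) (hw0 : ∀ x, 0 ≤ w x)
    (hG : VanishingKernel (interactionKernel β (1 / κ) γ w) C) {μ : ProbabilityMeasure S}
    (hμ : kernelEnergy (interactionKernel β (1 / κ) γ w) C μ ≠ ⊤) :
    energy β κ γ w μ = ((κ ^ 2 / 2 *
      ((kernelEnergy (interactionKernel β (1 / κ) γ w) C μ).toReal - C) : ℝ) : EReal) := by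
  rw [energy_eq hβ hκ hw0 hG, ← EReal.coe_ennreal_toReal hμ, ← EReal.coe_mul, ← EReal.coe_sub,
    mul_sub]

theorem energy_eq_top_of_kernelEnergy (hβ : 0 < β) (hκ : 0 < κ) (hw0 : ∀ x, 0 ≤ w x)
    (hG : VanishingKernel (interactionKernel β (1 / κ) γ w) C) {μ : ProbabilityMeasure S}
    (hμ : kernelEnergy (interactionKernel β (1 / κ) γ w) C μ = ⊤) : energy β κ γ w μ = ⊤ := by
  rw [energy_eq hβ hκ hw0 hG, hμ, EReal.coe_ennreal_top, EReal.coe_mul_top_of_pos (by positivity),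
    EReal.top_sub_coe]

theorem kernelEnergy_ne_top_of_energy_lt (hβ : 0 < β) (hκ : 0 < κ) (hw0 : ∀ x, 0 ≤ w x)
    (hG : VanishingKernel (interactionKernel β (1 / κ) γ w) C) {μ : ProbabilityMeasure S} {r : EReal}
    (hμ : energy β κ γ w μ < r) : kernelEnergy (interactionKernel β (1 / κ) γ w) C μ ≠ ⊤ :=
  fun h => by
    rw [energy_eq_top_of_kernelEnergy hβ hκ hw0 hG h] at hμ
    exact not_top_lt hμ

/-- The affine relation between the two energies. The sign condition is needed because
`ENNReal.ofReal` truncates; below it the level set is empty. -/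
theorem energy_le_coe_iff (hβ : 0 < β) (hκ : 0 < κ) (hw0 : ∀ x, 0 ≤ w x)
    (hG : VanishingKernel (interactionKernel β (1 / κ) γ w) C) {μ : ProbabilityMeasure S} {r : ℝ}
    (hr : 0 ≤ C + 2 * r / κ ^ 2) : energy β κ γ w μ ≤ (r : EReal) ↔
      kernelEnergy (interactionKernel β (1 / κ) γ w) C μ ≤ ENNReal.ofReal (C + 2 * r / κ ^ 2) := by
  by_cases h : kernelEnergy (interactionKernel β (1 / κ) γ w) C μ = ⊤
  · rw [energy_eq_top_of_kernelEnergy hβ hκ hw0 hG h, h]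
    simp
  · rw [energy_eq_coe hβ hκ hw0 hG h, EReal.coe_le_coe_iff, ENNReal.le_ofReal_iff_toReal_le h hr,
      ← sub_le_iff_le_add', le_div_iff₀ (by positivity)]
    constructor <;> intro h1 <;> linarith

theorem neg_le_energy (hβ : 0 < β) (hκ : 0 < κ) (hw0 : ∀ x, 0 ≤ w x)
    (hG : VanishingKernel (interactionKernel β (1 / κ) γ w) C) (μ : ProbabilityMeasure S) :
    ((-(κ ^ 2 / 2 * C) : ℝ) : EReal) ≤ energy β κ γ w μ := by
  by_cases h : kernelEnergy (interactionKernel β (1 / κ) γ w) C μ = ⊤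
  · rw [energy_eq_top_of_kernelEnergy hβ hκ hw0 hG h]
    exact le_top
  · rw [energy_eq_coe hβ hκ hw0 hG h, EReal.coe_le_coe_iff, mul_sub]
    have : 0 ≤ κ ^ 2 / 2 * (kernelEnergy (interactionKernel β (1 / κ) γ w) C μ).toReal := by
      positivity
    linarith

theorem setOf_energy_le_eq_empty (hβ : 0 < β) (hκ : 0 < κ) (hw0 : ∀ x, 0 ≤ w x)
    (hG : VanishingKernel (interactionKernel β (1 / κ) γ w) C) {r : ℝ}
    (hr : C + 2 * r / κ ^ 2 < 0) : {μ | energy β κ γ w μ ≤ (r : EReal)} = ∅ := by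
  refine eq_empty_of_forall_notMem fun μ hμ => ?_
  have h1 : -(κ ^ 2 / 2 * C) ≤ r :=
    EReal.coe_le_coe_iff.1 ((neg_le_energy hβ hκ hw0 hG μ).trans hμ)
  have h2 : C + 2 * r / κ ^ 2 = 2 / κ ^ 2 * (κ ^ 2 / 2 * C + r) := by field_simp
  rw [h2] at hr
  have : 0 ≤ 2 / κ ^ 2 * (κ ^ 2 / 2 * C + r) := mul_nonneg (by positivity) (by linarith)
  linarith

theorem neg_le_regularizedEnergy {X : Type*} [TopologicalSpace X] [MeasurableSpace X]
    [BorelSpace X] [SecondCountableTopology X] {G : X × X → ℝ} (hG : VanishingKernel G C) {η : ℝ}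
    (hη : 0 < η) (hη1 : η ≤ 1) (μ : ProbabilityMeasure X) : -C ≤ regularizedEnergy G η μ := by
  rw [regularizedEnergy]
  calc -C = ∫ _z : X × X, -C ∂((μ : Measure X).prod (μ : Measure X)) := by simp
    _ ≤ _ := integral_mono (integrable_const _) (hG.integrable_log_add hη hη1 _).neg fun z =>
        neg_le_neg (hG.log_add_le hη hη1 z)

theorem tendsto_exponent {p : ℕ → ℕ} (hp : Tendsto (fun n => (p n : ℝ) / (n : ℝ)) atTop (𝓝 κ))
    (c t ℓ : ℝ) :
    Tendsto (fun n : ℕ => (p n * c - ((p n : ℝ) ^ 2 * t + p n * ℓ) / 2) / (n : ℝ) ^ 2) atTop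
      (𝓝 (-(κ ^ 2 * t / 2))) := by
  have h1 : Tendsto (fun n : ℕ => (p n : ℝ) / n * (1 / n)) atTop (𝓝 (κ * 0)) :=
    hp.mul tendsto_one_div_atTop_nhds_zero_nat
  have h2 := ((h1.mul_const (c - ℓ / 2))).sub ((hp.pow 2).mul_const (t / 2))
  convert h2 using 2 with n
  · rcases eq_or_ne n 0 with rfl | hn
    · simp
    · have : (n : ℝ) ≠ 0 := by exact_mod_cast hn
      field_simp
      ring
  · ring

/-- One fixed scale `η` is chosen with regularized energy at least `2r/κ²` throughout `A`. The bound
obtained is `J^k exp(-(k²·2r/κ² + k log η)/2)`, where all terms linear in `k` disappear at speed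
`n²`. -/
theorem eventually_unnormalizedEnsemble_le [Nonempty S] (hS : IsClosed S) (hβ : 0 < β)
    (hκ : 0 < κ) {p : ℕ → ℕ} (hp : Tendsto (fun n => (p n : ℝ) / (n : ℝ)) atTop (𝓝 κ))
    (hv_nonneg : ∀ n x, 0 ≤ v n x) (h_conv : WeightConvergence v w)
    (h_decay : WeightDecay β κ γ v) (hG : VanishingKernel (interactionKernel β (1 / κ) γ w) C)
    {A : Set (ProbabilityMeasure S)} (hA : IsClosed A) {r : ℝ}
    (hr : ∀ μ ∈ A, (r : EReal) < energy β κ γ w μ) {δ : ℝ} (hδ : 0 < δ) :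
    ∀ᶠ n : ℕ in atTop, unnormalizedEnsemble β γ n (p n) (v n) (empiricalMeasure ⁻¹' A) ≤
      ENNReal.ofReal (Real.exp ((n : ℝ) ^ 2 * (-r + δ))) := by
  have := sigmaFinite_comap_subtype_coe hS.measurableSet
  have := hS.isClosedEmbedding_subtypeVal.polishSpace
  obtain ⟨m, hm⟩ : ∃ m : ℕ, ∀ μ ∈ A, 2 * r / κ ^ 2 ≤
      regularizedEnergy (interactionKernel β (1 / κ) γ w) (1 / ((m : ℝ) + 1)) μ := by
    -- For a negative threshold every scale works, since regularized energies are at least `-C`.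
    rcases le_or_gt 0 (C + 2 * r / κ ^ 2) with h | h
    · obtain ⟨m, hm⟩ := hG.exists_regularizedEnergy_ge hA h fun μ hμ => by
        rw [← not_le, ← energy_le_coe_iff hβ hκ h_conv.nonneg hG h, not_le]
        exact hr μ hμ
      exact ⟨m, fun μ hμ => by linarith [hm μ hμ]⟩
    · refine ⟨0, fun μ _ => ?_⟩
      have := neg_le_regularizedEnergy hG (Nat.one_div_pos_of_nat (n := 0))
        (VanishingKernel.one_div_succ_le_one 0) μ
      linarith
  have hη : (0 : ℝ) < 1 / ((m : ℝ) + 1) := Nat.one_div_pos_of_nat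
  obtain ⟨B, hB0, hB⟩ := eventually_ensembleDensity_le hS hβ hκ hp hv_nonneg h_conv h_decay
  have hint : Integrable (fun x : S => B * (1 + (x : ℝ) ^ 2)⁻¹)
      (Measure.comap ((↑) : S → ℝ) volume) := by
    refine Integrable.const_mul ?_ B
    exact (MeasurableEmbedding.subtype_coe hS.measurableSet).integrableOn_range_iff_comap.1
      integrable_inv_one_add_sq.integrableOn
  have hn : ∀ x : S, 0 ≤ B * (1 + (x : ℝ) ^ 2)⁻¹ := fun x => by positivity
  set J := ∫ x : S, B * (1 + (x : ℝ) ^ 2)⁻¹ ∂Measure.comap ((↑) : S → ℝ) volume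
  have hJ : 0 ≤ J := integral_nonneg hn
  have hlim := tendsto_exponent hp (Real.log (J + 1)) (2 * r / κ ^ 2)
    (Real.log (1 / ((m : ℝ) + 1)))
  have hrt : -(κ ^ 2 * (2 * r / κ ^ 2) / 2) = -r := by field_simp
  rw [hrt] at hlim
  filter_upwards [hB _ hη, hlim.eventually (ge_mem_nhds (show -r < -r + δ by linarith)),
    (tendsto_natCast_atTop_of_div hκ hp).eventually_ge_atTop 1, eventually_ne_atTop 0]
    with n h1 h2 h3 hn0
  refine (lintegral_preimage_empiricalMeasure_le hG hη (VanishingKernel.one_div_succ_le_one m)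
    (by omega) hA hm _ hint hn h1).trans (ENNReal.ofReal_le_ofReal ?_)
  have hn0' : (0 : ℝ) < (n : ℝ) ^ 2 := by positivity
  rw [div_le_iff₀ hn0'] at h2
  calc J ^ p n * Real.exp (-((p n : ℝ) ^ 2 * (2 * r / κ ^ 2) +
        p n * Real.log (1 / ((m : ℝ) + 1))) / 2)
      ≤ Real.exp (p n * Real.log (J + 1)) * Real.exp (-((p n : ℝ) ^ 2 * (2 * r / κ ^ 2) +
        p n * Real.log (1 / ((m : ℝ) + 1))) / 2) := by
        refine mul_le_mul_of_nonneg_right ?_ (Real.exp_pos _).le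
        rw [Real.exp_nat_mul, Real.exp_log (by linarith)]
        exact pow_le_pow_left₀ hJ (by linarith) _
    _ ≤ _ := by
        rw [← Real.exp_add, Real.exp_le_exp]
        linarith

theorem hasEnergyBounds_unnormalizedEnsemble [Nonempty S] (hS : IsClosed S)
    (hSo : S.OrdConnected) (hS' : S.Nontrivial) (hβ : 0 < β) (hκ : 0 < κ) (hγ : 0 < γ)
    (hγS : Even γ → S ⊆ Ici 0) {p : ℕ → ℕ}
    (hp : Tendsto (fun n => (p n : ℝ) / (n : ℝ)) atTop (𝓝 κ)) (hv_cont : ∀ n, Continuous (v n))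
    (hv_nonneg : ∀ n x, 0 ≤ v n x) (h_conv : WeightConvergence v w)
    (h_decay : WeightDecay β κ γ v) (hG : VanishingKernel (interactionKernel β (1 / κ) γ w) C) :
    HasEnergyBounds
      (fun n A => unnormalizedEnsemble β γ n (p n) (v n)
        (empiricalMeasure ⁻¹' A : Set (Fin (p n) → S)))
      (energy β κ γ w) where
  upper A hA r hr δ hδ :=
    eventually_unnormalizedEnsemble_le hS hβ hκ hp hv_nonneg h_conv h_decay hG hA hr hδ
  lower O hO r μ hμO hμ := by
    have hw0 := h_conv.nonneg
    have hE := kernelEnergy_ne_top_of_energy_lt hβ hκ hw0 hG hμ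
    rw [energy_eq_coe hβ hκ hw0 hG hE, EReal.coe_lt_coe_iff] at hμ
    set e := (kernelEnergy (interactionKernel β (1 / κ) γ w) C μ).toReal
    set ε := r - κ ^ 2 / 2 * (e - C) with hε
    have hε0 : 0 < ε := by linarith
    -- `ε/κ²` in kernel energy is `ε/2` in energy; the remaining `ε/2` is left for the exponential
    -- bound.
    obtain ⟨ν, hνO, hν, hνE⟩ := exists_isTame_mem hS hSo hβ (show 0 < 1 / κ by positivity) hγ hγS
      h_conv.continuous hw0 h_conv.finite_zeros hG hE hO hμO (δ := ENNReal.ofReal (ε / κ ^ 2))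
      (by simpa using by positivity) ENNReal.ofReal_ne_top
    have hsum := ENNReal.add_ne_top.2 ⟨hE, ENNReal.ofReal_ne_top (r := ε / κ ^ 2)⟩
    have hνt := ENNReal.toReal_mono hsum hνE
    rw [ENNReal.toReal_add hE ENNReal.ofReal_ne_top,
      ENNReal.toReal_ofReal (by positivity)] at hνt
    filter_upwards [eventually_ofReal_exp_le_unnormalizedEnsemble hS hβ hκ hp hv_cont hv_nonneg
      h_conv hG hν (ne_top_of_le_ne_top hsum hνE) hO hνO (half_pos hε0)] with n hn
    refine le_trans (ENNReal.ofReal_le_ofReal (Real.exp_le_exp.2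
      (mul_le_mul_of_nonneg_left ?_ (sq_nonneg _)))) hn
    have h1 := mul_le_mul_of_nonneg_left hνt (show 0 ≤ κ ^ 2 / 2 by positivity)
    have h2 : κ ^ 2 / 2 * (e + ε / κ ^ 2) = κ ^ 2 / 2 * e + ε / 2 := by field_simp
    rw [h2] at h1
    linarith
  isClosed_le r := by
    rcases le_or_gt 0 (C + 2 * r / κ ^ 2) with h | h
    · simp only [energy_le_coe_iff hβ hκ h_conv.nonneg hG h]
      exact hG.isClosed_kernelEnergy_le _
    · rw [setOf_energy_le_eq_empty hβ hκ h_conv.nonneg hG h]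
      exact isClosed_empty
  isCompact_le r := by
    rcases le_or_gt 0 (C + 2 * r / κ ^ 2) with h | h
    · simp only [energy_le_coe_iff hβ hκ h_conv.nonneg hG h]
      exact hG.isCompact_kernelEnergy_le _ ENNReal.ofReal_ne_top
    · rw [setOf_energy_le_eq_empty hβ hκ h_conv.nonneg hG h]
      exact isCompact_empty
  bddBelow := ⟨_, neg_le_energy hβ hκ h_conv.nonneg hG⟩
  ne_top := by
    obtain ⟨ν, -, hν⟩ := exists_isTame hS hSo hS' hβ (show 0 < 1 / κ by positivity) hγ hγS
      h_conv.continuous h_conv.nonneg h_conv.finite_zeros hG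
    exact ⟨ν, by rw [energy_eq_coe hβ hκ h_conv.nonneg hG hν]; exact EReal.coe_ne_top _⟩

theorem empiricalLaw_apply [Nonempty S] (n k : ℕ) (u : S → ℝ)
    {A : Set (ProbabilityMeasure S)} (hA : MeasurableSet[borel (ProbabilityMeasure S)] A) :
    empiricalLaw β γ n k u A =
      (partitionFunction β γ n k u)⁻¹ * unnormalizedEnsemble β γ n k u (empiricalMeasure ⁻¹' A) := by
  let : MeasurableSpace (ProbabilityMeasure S) := borel _
  have : BorelSpace (ProbabilityMeasure S) := ⟨rfl⟩
  have hm : Measurable (empiricalMeasure : (Fin k → S) → ProbabilityMeasure S) :=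
    continuous_empiricalMeasure.measurable
  rw [empiricalLaw]
  refine (Measure.map_apply hm hA).trans ?_
  rw [ensemble, Measure.smul_apply, smul_eq_mul]

/-- The limit kernel is dominated by a power of the weight. -/
theorem exists_interactionKernel_le_mul_rpow (hS : IsClosed S) (hβ : 0 < β) (hκ : 0 < κ)
    (hv_nonneg : ∀ n x, 0 ≤ v n x) (h_conv : WeightConvergence v w)
    (h_decay : WeightDecay β κ γ v) :
    ∃ d : ℝ, 0 < d ∧ ∃ R : ℝ, 0 < R ∧
      ∀ x y, interactionKernel β (1 / κ) γ w (x, y) ≤ R * w x ^ d := by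
  obtain ⟨a₀, ha₀, haκ, hdec⟩ := h_decay.exists_growthBound_mul_le hS hβ hκ hv_nonneg
  have hκ' : 0 < 1 / κ := by positivity
  -- A power strictly between the critical one and `1/κ` still controls the growth bound, and the
  -- spare power `1/κ - a` becomes `d`.
  obtain ⟨a, ha, haκ'⟩ := exists_between haκ
  obtain ⟨B₁, hB₁0, hB₁⟩ := exists_forall_growthBound_mul_rpow_le h_conv (ha₀.trans_lt ha)
    (hdec _ ha _ tendsto_const_nhds)
  obtain ⟨B₂, hB₂0, hB₂⟩ := exists_forall_growthBound_mul_rpow_le h_conv hκ'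
    (hdec _ haκ _ tendsto_const_nhds)
  refine ⟨1 / κ - a, by linarith, B₁ * B₂ + 1, by positivity, fun x y => ?_⟩
  have hx := h_conv.nonneg x
  have hpow : w x ^ (1 / κ) = w x ^ a * w x ^ (1 / κ - a) := by
    rw [← Real.rpow_add_of_nonneg hx (ha₀.trans ha.le) (by linarith)]
    congr 1
    ring
  have hd : 0 ≤ w x ^ (1 / κ - a) := Real.rpow_nonneg hx _
  calc interactionKernel β (1 / κ) γ w (x, y)
      ≤ (growthBound β γ x * w x ^ (1 / κ)) * (growthBound β γ y * w y ^ (1 / κ)) :=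
        interactionKernel_le hβ h_conv.nonneg _ x y
    _ = (growthBound β γ x * w x ^ a) * (growthBound β γ y * w y ^ (1 / κ)) *
          w x ^ (1 / κ - a) := by rw [hpow]; ring
    _ ≤ B₁ * B₂ * w x ^ (1 / κ - a) := by
        refine mul_le_mul_of_nonneg_right (mul_le_mul (hB₁ x) (hB₂ y) ?_ hB₁0) hd
        exact mul_nonneg (growthBound_pos hβ y).le (Real.rpow_nonneg (h_conv.nonneg y) _)
    _ ≤ (B₁ * B₂ + 1) * w x ^ (1 / κ - a) := by
        refine mul_le_mul_of_nonneg_right ?_ hd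
        linarith

theorem exists_weight_le (hβ : 0 < β) (h_conv : WeightConvergence v w) {a : ℝ} (ha : 0 < a)
    (hdec : ∀ η > 0, ∃ K : Set S, IsCompact K ∧
      ∀ᶠ n in atTop, ∀ x ∉ K, growthBound β γ x * v n x ^ a ≤ η) : ∃ M, ∀ x, w x ≤ M := by
  obtain ⟨B, hB0, hB⟩ := exists_forall_growthBound_mul_rpow_le h_conv ha hdec
  refine ⟨B ^ a⁻¹, fun x => ?_⟩
  have hx := h_conv.nonneg x
  rw [Real.le_rpow_inv_iff_of_pos hx hB0 ha]
  refine le_trans ?_ (hB x)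
  exact le_mul_of_one_le_left (Real.rpow_nonneg hx _) (one_le_growthBound hβ x)

end Bounds

theorem theorem3p1 {S : Set ℝ} [Nonempty S] (hS_closed : IsClosed S) (hS_interval : S.OrdConnected)
    (hS_nondeg : S.Nontrivial) (β κ : ℝ) (hβ : 0 < β) (hκ : 0 < κ) (γ : ℕ) (hγ : 0 < γ)
    (hγS : Even γ → S ⊆ Set.Ici 0)
    (p : ℕ → ℕ) (hp : Tendsto (fun n => (p n : ℝ) / (n : ℝ)) atTop (𝓝 κ))
    (v : ℕ → S → ℝ) (hv_cont : ∀ n, Continuous (v n)) (hv_nonneg : ∀ n x, 0 ≤ v n x)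
    (w : S → ℝ) (h_conv : WeightConvergence v w) (h_decay : WeightDecay β κ γ v) :
    -- the joint laws are genuine probability measures for large `n`
    (∀ᶠ n in atTop, IsProbabilityMeasure (ensemble β γ n (p n) (v n))) ∧
    -- the energy is well defined for every `μ`
    (∀ μ : ProbabilityMeasure S,
      ∫⁻ z, (-pairEnergy β κ γ w z.1 z.2).toENNReal
        ∂((μ : Measure S).prod (μ : Measure S)) ≠ ⊤) ∧
    -- it splits into the two integrals if `∫ log w dμ > -∞`, and is infinite otherwise
    (∀ μ : ProbabilityMeasure S, eintegral (μ : Measure S) (fun x => logE (w x)) ≠ ⊥ →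
      energy β κ γ w μ =
        ((β / 2 * κ ^ 2 : ℝ) : EReal) *
            eintegral ((μ : Measure S).prod (μ : Measure S))
              (fun z => -logE |(z.1 : ℝ) ^ γ - (z.2 : ℝ) ^ γ|)
          - (κ : EReal) * eintegral (μ : Measure S) (fun x => logE (w x))) ∧
    (∀ μ : ProbabilityMeasure S, eintegral (μ : Measure S) (fun x => logE (w x)) = ⊥ →
      energy β κ γ w μ = ⊤) ∧
    -- the limit `c` exists and is finite, and the large deviation principle holds
    ∃ c : ℝ,
      Tendsto (fun n : ℕ => ((((n : ℝ) ^ 2)⁻¹ : ℝ) : EReal) *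
        ENNReal.log (partitionFunction β γ n (p n) (v n))) atTop (𝓝 (c : EReal)) ∧
      SatisfiesLDP (fun n => empiricalLaw β γ n (p n) (v n)) (fun n => (n : ℝ) ^ 2)
        (fun μ => energy β κ γ w μ + (c : EReal)) := by
  obtain ⟨a₀, ha₀, haκ, hdec⟩ := h_decay.exists_growthBound_mul_le hS_closed hβ hκ hv_nonneg
  have hκ' : 0 < 1 / κ := by positivity
  have hdecκ := hdec _ haκ (fun _ => 1 / κ) tendsto_const_nhds
  obtain ⟨C, hG⟩ := exists_vanishingKernel hβ h_conv hκ' hdecκ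
  obtain ⟨M, hM⟩ := exists_weight_le hβ h_conv hκ' hdecκ
  obtain ⟨d, hd, R, hR, hGR⟩ :=
    exists_interactionKernel_le_mul_rpow hS_closed hβ hκ hv_nonneg h_conv h_decay
  have hw0 := h_conv.nonneg
  have hB := hasEnergyBounds_unnormalizedEnsemble hS_closed hS_interval hS_nondeg hβ hκ hγ hγS hp
    hv_cont hv_nonneg h_conv h_decay hG
  obtain ⟨c, hc⟩ := hB.exists_iInf_eq
  refine ⟨?_, lintegral_neg_pairEnergy_ne_top hβ hκ hw0 hG,
    energy_eq_sub hβ hκ h_conv.continuous hw0 hM hG,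
    energy_eq_top hβ hκ h_conv.continuous hw0 hG hd hR hGR, c, hB.tendsto_log_univ hc,
    hB.satisfiesLDP hc fun n A hA => empiricalLaw_apply n (p n) (v n) hA⟩
  filter_upwards [hB.eventually_univ_ne] with n hn
  refine ⟨?_⟩
  rw [ensemble, Measure.smul_apply, smul_eq_mul]
  exact ENNReal.inv_mul_cancel hn.1 hn.2
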